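/- **Setting.** Fix a language of propositional logic: a set of atoms, written as binary strings, and the set $\mathcal S$ of all sentences built from them with $\lnot,\land,\lor,\to,\leftrightarrow$. A *world* is a map $\mathbb W:\mathcal S\to\{0,1\}$; it is *propositionally consistent* (p.c.) if it commutes with the connectives. For $D\subseteq\mathcal S$ let $\mathcal{PC}(D)$ be the set of p.c. worlds in which every $\phi\in D$ is true. Let $\Gamma\subseteq\mathcal S$ be a computably enumerable set that is consistent (in the propositional calculus with all tautologies as logical axioms and modus ponens as its only rule). A *deductive process* is a computable nested sequence $D_1\subseteq D_2\subseteq\cdots$ of finite sets of sentences; it is *$\Gamma$-complete* if $\mathcal{PC}(\bigcup_n D_n)=\mathcal{PC}(\Gamma)$. A *market* is a computable sequence $\overline{\mathbb P}=(\mathbb P_1,\mathbb P_2,\dots)$ of functions $\mathbb P_n:\mathcal S\to\mathbb Q\cap[0,1]$. An *expressible feature of rank $\le n$* is a function of valuation sequences $\overline{\mathbb V}$ (sequences of functions $\mathbb V_i:\mathcal S\to[0,1]$) given by an expression built from the prices $\phi^{*i}:\overline{\mathbb V}\mapsto\mathbb V_i(\phi)$ ($\phi\in\mathcal S$, $i\le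 n$), rational numbers, addition, multiplication, $\max(\cdot,\cdot)$ and $1/\max(1,\cdot)$. A *trading strategy for day $n$* is a finite formal sum $T_n=\sum_j\xi_j\cdot(\phi_j-\phi_j^{*n})$ with sentences $\phi_j$ and expressible features $\xi_j$ of rank $\le n$; its value in a world $\mathbb W$ against $\overline{\mathbb V}$ is $\mathbb W(T_n(\overline{\mathbb V}))=\sum_j\xi_j(\overline{\mathbb V})\,(\mathbb W(\phi_j)-\mathbb V_n(\phi_j))$. A strategy is written down as a finite list of definitions of auxiliary variables by expressions that may use earlier variables, followed by the list of pairs $(\phi_j,\xi_j)$, where the $\xi_j$ may use the variables. A *trader* is a sequence $(T_n)_{n\ge1}$ of strategies, $T_n$ for day $n$; it is *efficiently computable* if a Turing machine writes down $T_n$ from $n$ in time polynomial in $n$. The trader *exploits* $\overline{\mathbb P}$ relative to $\overline D$ if the set $\{\mathbb W(\sum_{i\le n}T_i(\overline{\mathbb P})) : n\ge 1,\ \mathbb W\in\mathcal{PC}(D_n)\}$ is bounded below but not bounded above. A *logical inductor over $\Gamma$* is a market that, for some $\Gamma$-complete deductive process $\overline D$, is exploited relative to $\overline D$ by no efficiently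 computable trader. A *continuous semimeasure* is a function $M:\{0,1\}^{*}\to[0,\infty)$ with $M(\text{empty string})\le1$ and $M(\sigma0)+M(\sigma1)\le M(\sigma)$ for all $\sigma$. It is *lower semicomputable* if it is the pointwise limit of a computable nondecreasing sequence of rational-valued functions, and *universal* if it is lower semicomputable and for every lower semicomputable continuous semimeasure $N$ there is $c>0$ with $M(\sigma)\ge c\,N(\sigma)$ for all $\sigma$. **Theorem (Domination of the Universal Semimeasure).** Let $\overline{\mathbb P}$ be a logical inductor over $\Gamma$, let $b_1,b_2,\dots$ be a computable sequence of distinct atoms of the language that do not occur in any sentence of $\Gamma$, and let $M$ be a universal continuous semimeasure. Then the limit $\mathbb P_\infty(\phi):=\lim_{n\to\infty}\mathbb P_n(\phi)$ exists for every sentence $\phi$, and there is a constant $C>0$ such that for every finite bitstring $\sigma=\sigma_1\cdots\sigma_n$, $$\mathbb P_\infty\big((b_1\leftrightarrow\sigma_1=1)\land\dots\land(b_n\leftrightarrow\sigma_n=1)\big)\ \ge\ C\cdot M(\sigma).$$ Here $(b_i\leftrightarrow\sigma_i=1)$ stands for $b_i$ if $\sigma_i=1$ and for $\lnot b_i$ if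 $\sigma_i=0$, and the empty conjunction (for the empty string $\sigma$) stands for the tautology $b_1\to b_1$. -/

import Mathlib

namespace LogicalInduction

/-! ### Sentences, worlds, provability

A language of propositional logic is given by its set `L` of atoms, which are written as
binary strings. -/

/-- Sentences of the propositional language with set of atoms `L`. -/
inductive Sentence (L : Set (List Bool)) : Type
  | atom : L → Sentence L
  | neg : Sentence L → Sentence L
  | and : Sentence L → Sentence L → Sentence L
  | or : Sentence L → Sentence L → Sentence L
  | imp : Sentence L → Sentence L → Sentence L
  | iff : Sentence L → Sentence L → Sentence L

/-- The atom `a` occurs in a sentence. -/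
def Sentence.Mentions {L : Set (List Bool)} (a : L) : Sentence L → Prop
  | .atom c => c = a
  | .neg φ => φ.Mentions a
  | .and φ ψ => φ.Mentions a ∨ ψ.Mentions a
  | .or φ ψ => φ.Mentions a ∨ ψ.Mentions a
  | .imp φ ψ => φ.Mentions a ∨ ψ.Mentions a
  | .iff φ ψ => φ.Mentions a ∨ ψ.Mentions a

/-- A world is an arbitrary truth assignment to all sentences. -/
abbrev World (L : Set (List Bool)) : Type := Sentence L → Bool

/-- A world is propositionally consistent if it commutes with the connectives. -/
structure World.IsPC {L : Set (List Bool)} (W : World L) : Prop where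
  neg : ∀ φ, W (.neg φ) = !(W φ)
  and : ∀ φ ψ, W (.and φ ψ) = (W φ && W ψ)
  or : ∀ φ ψ, W (.or φ ψ) = (W φ || W ψ)
  imp : ∀ φ ψ, W (.imp φ ψ) = (!(W φ) || W ψ)
  iff : ∀ φ ψ, W (.iff φ ψ) = (W φ == W ψ)

/-- The set `PC(D)` of worlds propositionally consistent with `D`. -/
def pcWorlds {L : Set (List Bool)} (D : Set (Sentence L)) : Set (World L) :=
  {W | W.IsPC ∧ ∀ φ ∈ D, W φ = true}

/-- `Γ ⊢ φ`: the propositional calculus whose logical axioms are the tautologies and whose only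
rule of inference is modus ponens. -/
inductive Provable {L : Set (List Bool)} (Γ : Set (Sentence L)) : Sentence L → Prop
  | ax (φ : Sentence L) : φ ∈ Γ → Provable Γ φ
  | taut (φ : Sentence L) : (∀ W : World L, W.IsPC → W φ = true) → Provable Γ φ
  | mp (φ ψ : Sentence L) : Provable Γ (.imp φ ψ) → Provable Γ φ → Provable Γ ψ

def Consistent {L : Set (List Bool)} (Γ : Set (Sentence L)) : Prop :=
  ¬ ∃ φ, Provable Γ φ ∧ Provable Γ (.neg φ)

/-! ### Writing finite objects as binary strings

All codes below are prefix-free, so that concatenations can be parsed. -/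

/-- A string, self-delimiting: each digit is preceded by `1`, and a `0` marks the end. -/
def encodeStr (s : List Bool) : List Bool :=
  s.flatMap (fun d => [true, d]) ++ [false]

/-- A natural number in binary notation, self-delimiting. -/
def encodeNat (n : ℕ) : List Bool := encodeStr n.bits

/-- A natural number in unary notation, self-delimiting. -/
def encodeUnary (n : ℕ) : List Bool := List.replicate n true ++ [false]

/-- An integer: a sign, then the absolute value in binary. -/
def encodeInt (a : ℤ) : List Bool := decide (a < 0) :: encodeNat a.natAbs

/-- A finite list: each entry is preceded by `1`, and a `0` marks the end. -/
def encodeList {α : Type} (enc : α → List Bool) (l : List α) : List Bool :=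
  l.flatMap (fun a => true :: enc a) ++ [false]

/-- Sentences are written in Polish notation. -/
def Sentence.encode {L : Set (List Bool)} : Sentence L → List Bool
  | .atom a => [false, false, false] ++ encodeStr a
  | .neg φ => [false, false, true] ++ φ.encode
  | .and φ ψ => [false, true, false] ++ φ.encode ++ ψ.encode
  | .or φ ψ => [false, true, true] ++ φ.encode ++ ψ.encode
  | .imp φ ψ => [true, false, false] ++ φ.encode ++ ψ.encode
  | .iff φ ψ => [true, false, true] ++ φ.encode ++ ψ.encode

/-- A set of sentences is computably enumerable. -/
def IsCE {L : Set (List Bool)} (Γ : Set (Sentence L)) : Prop :=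
  REPred (fun s : List Bool => ∃ φ ∈ Γ, φ.encode = s)

/-- A sequence of binary strings is efficiently computable: a Turing machine outputs `x n` on
input `n` in time polynomial in `n`, that is, in the length of `n` written in unary. -/
def EfficientlyComputable (x : ℕ → List Bool) : Prop :=
  Nonempty (Turing.TM2ComputableInPolyTime Computability.unaryEncodeNat
    (id : List Bool → List Bool) x)

/-! ### Markets and deductive processes

Days are numbered from `0`. -/

/-- A market: a computable sequence of rational pricings with values in `[0, 1]`. -/
structure IsMarket {L : Set (List Bool)} (P : ℕ → Sentence L → ℚ) : Prop where
  nonneg : ∀ n φ, 0 ≤ P n φ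
  le_one : ∀ n φ, P n φ ≤ 1
  computable : ∃ f : ℕ × List Bool → ℕ × ℕ, Computable f ∧
    ∀ n φ, P n φ = ((f (n, φ.encode)).1 : ℚ) / ((f (n, φ.encode)).2 : ℚ)

/-- A deductive process: a computable nested sequence of finite sets of sentences. -/
structure IsDeductiveProcess {L : Set (List Bool)} (D : ℕ → Finset (Sentence L)) : Prop where
  mono : ∀ m n, m ≤ n → D m ⊆ D n
  computable : ∃ f : ℕ → List (List Bool), Computable f ∧
    ∀ n s, s ∈ f n ↔ ∃ φ ∈ D n, φ.encode = s

/-- `D` is `Γ`-complete: `PC(D_∞) = PC(Γ)`. -/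
def IsComplete {L : Set (List Bool)} (Γ : Set (Sentence L)) (D : ℕ → Finset (Sentence L)) :
    Prop :=
  pcWorlds {φ | ∃ n, φ ∈ D n} = pcWorlds Γ

/-! ### Expressible features, trading strategies and exploitation -/

/-- Feature expressions, built from prices (`price φ i` is the price of `φ` on day `i`), rational
numbers (`rat a d` is `a / d`), variables, addition, multiplication, maximum and safe
reciprocation. -/
inductive FeatExpr (L : Set (List Bool)) : Type
  | price : Sentence L → ℕ → FeatExpr L
  | rat : ℤ → ℕ → FeatExpr L
  | var : ℕ → FeatExpr L
  | add : FeatExpr L → FeatExpr L → FeatExpr L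
  | mul : FeatExpr L → FeatExpr L → FeatExpr L
  | max : FeatExpr L → FeatExpr L → FeatExpr L
  | safeInv : FeatExpr L → FeatExpr L

/-- The value of a feature expression on the valuation sequence `V`, when the variables
`v_0, v_1, …` have the values listed in `env`. -/
noncomputable def FeatExpr.eval {L : Set (List Bool)} (V : ℕ → Sentence L → ℝ) (env : List ℝ) :
    FeatExpr L → ℝ
  | .price φ i => V i φ
  | .rat a d => (a : ℝ) / (d : ℝ)
  | .var v => env.getD v 0
  | .add x y => x.eval V env + y.eval V env
  | .mul x y => x.eval V env * y.eval V env
  | .max x y => Max.max (x.eval V env) (y.eval V env)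
  | .safeInv x => 1 / Max.max 1 (x.eval V env)

/-- Only prices of days `≤ n` and variables `v_0, …, v_{k-1}` are used, and denominators are
nonzero. -/
def FeatExpr.WellFormed {L : Set (List Bool)} (n k : ℕ) : FeatExpr L → Prop
  | .price _ i => i ≤ n
  | .rat _ d => 0 < d
  | .var v => v < k
  | .add x y => x.WellFormed n k ∧ y.WellFormed n k
  | .mul x y => x.WellFormed n k ∧ y.WellFormed n k
  | .max x y => x.WellFormed n k ∧ y.WellFormed n k
  | .safeInv x => x.WellFormed n k

/-- Prices' days and variables' indices are written in unary, rational numbers in binary. -/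
def FeatExpr.encode {L : Set (List Bool)} : FeatExpr L → List Bool
  | .price φ i => [false, false, false] ++ φ.encode ++ encodeUnary i
  | .rat a d => [false, false, true] ++ encodeInt a ++ encodeNat d
  | .var v => [false, true, false] ++ encodeUnary v
  | .add x y => [false, true, true] ++ x.encode ++ y.encode
  | .mul x y => [true, false, false] ++ x.encode ++ y.encode
  | .max x y => [true, false, true] ++ x.encode ++ y.encode
  | .safeInv x => [true, true, false] ++ x.encode

/-- A trading strategy as it is written down: definitions `v_0 := …, v_1 := …, …` of variables,
which may use the earlier variables, and then the list of pairs `(φ, ξ)` of sentences and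
coefficients, which may use all variables. It stands for the trade `∑ ξ · (φ - φ^{*n})`. -/
structure Strategy (L : Set (List Bool)) : Type where
  defs : List (FeatExpr L)
  trades : List (Sentence L × FeatExpr L)

/-- The strategy is one for day `n`: its features have rank at most `n`. -/
def Strategy.IsForDay {L : Set (List Bool)} (T : Strategy L) (n : ℕ) : Prop :=
  (∀ (i : ℕ) (hi : i < T.defs.length), (T.defs[i]).WellFormed n i) ∧
    ∀ t ∈ T.trades, t.2.WellFormed n T.defs.length

/-- The values of the variables on the valuation sequence `V`. -/
noncomputable def Strategy.env {L : Set (List Bool)} (T : Strategy L) (V : ℕ → Sentence L → ℝ) :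
    List ℝ :=
  T.defs.foldl (fun env e => env ++ [e.eval V env]) []

/-- The value `W(T(V))` in the world `W` of the trade made by the strategy `T` for day `n` on the
valuation sequence `V`, namely `∑ ξ(V) · (W(φ) - V_n(φ))`. -/
noncomputable def Strategy.value {L : Set (List Bool)} (T : Strategy L) (n : ℕ)
    (V : ℕ → Sentence L → ℝ) (W : World L) : ℝ :=
  (T.trades.map (fun t => t.2.eval V (T.env V) * ((if W t.1 then 1 else 0) - V n t.1))).sum

def Strategy.encode {L : Set (List Bool)} (T : Strategy L) : List Bool :=
  encodeList FeatExpr.encode T.defs ++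
    encodeList (fun t : Sentence L × FeatExpr L => t.1.encode ++ t.2.encode) T.trades

/-- A trader: a strategy for each day. -/
def IsTrader {L : Set (List Bool)} (T : ℕ → Strategy L) : Prop :=
  ∀ n, (T n).IsForDay n

/-- The trader `T` exploits the valuation sequence `V` relative to `D`: its plausible net worths
are bounded below but not above. -/
def Exploits {L : Set (List Bool)} (T : ℕ → Strategy L) (V : ℕ → Sentence L → ℝ)
    (D : ℕ → Finset (Sentence L)) : Prop :=
  let worths : Set ℝ := {x | ∃ n : ℕ, ∃ W ∈ pcWorlds (D n : Set (Sentence L)),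
    x = ∑ i ∈ Finset.range (n + 1), (T i).value i V W}
  BddBelow worths ∧ ¬ BddAbove worths

/-- The logical induction criterion relative to `D`: no efficiently computable trader exploits
the market. -/
def SatisfiesLIC {L : Set (List Bool)} (P : ℕ → Sentence L → ℚ)
    (D : ℕ → Finset (Sentence L)) : Prop :=
  ¬ ∃ T : ℕ → Strategy L, IsTrader T ∧ EfficientlyComputable (fun n => (T n).encode) ∧
    Exploits T (fun n φ => (P n φ : ℝ)) D

/-- A (computable) logical inductor over `Γ`: a market that satisfies the logical induction
criterion relative to some `Γ`-complete deductive process. -/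
def IsLogicalInductor {L : Set (List Bool)} (Γ : Set (Sentence L)) (P : ℕ → Sentence L → ℚ) :
    Prop :=
  IsMarket P ∧ ∃ D : ℕ → Finset (Sentence L),
    IsDeductiveProcess D ∧ IsComplete Γ D ∧ SatisfiesLIC P D

/-! ### Universal continuous semimeasures -/

/-- Continuous semimeasures on finite bitstrings. -/
structure IsSemimeasure (M : List Bool → ℝ) : Prop where
  nonneg : ∀ σ, 0 ≤ M σ
  nil_le_one : M [] ≤ 1
  add_le : ∀ σ, M (σ ++ [false]) + M (σ ++ [true]) ≤ M σ

/-- `M` is the pointwise limit of a computable nondecreasing sequence of rational-valued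
functions. -/
def LowerSemicomputable (M : List Bool → ℝ) : Prop :=
  ∃ f : List Bool × ℕ → ℕ × ℕ, Computable f ∧ ∃ q : List Bool → ℕ → ℚ,
    (∀ σ n, q σ n = ((f (σ, n)).1 : ℚ) / ((f (σ, n)).2 : ℚ)) ∧
    (∀ σ, Monotone (q σ)) ∧
    ∀ σ, Filter.Tendsto (fun n => (q σ n : ℝ)) Filter.atTop (nhds (M σ))

/-- A universal continuous semimeasure: a lower semicomputable one that dominates all lower
semicomputable ones up to positive constants. -/
def IsUniversalSemimeasure (M : List Bool → ℝ) : Prop :=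
  IsSemimeasure M ∧ LowerSemicomputable M ∧
    ∀ N : List Bool → ℝ, IsSemimeasure N → LowerSemicomputable N →
      ∃ c : ℝ, 0 < c ∧ ∀ σ, c * N σ ≤ M σ

/-! ### The sentence saying that the string of the atoms `b` starts with `σ` -/

/-- The atom `a` or its negation. -/
def literal {L : Set (List Bool)} (a : L) (d : Bool) : Sentence L :=
  if d then .atom a else .neg (.atom a)

/-- The conjunction of the literals saying that `b k, b (k + 1), …` have the truth values listed
in `σ`. The empty conjunction is the tautology `b k → b k`. -/
def startsWithFrom {L : Set (List Bool)} (b : ℕ → L) : ℕ → List Bool → Sentence L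
  | k, [] => .imp (.atom (b k)) (.atom (b k))
  | k, [d] => literal (b k) d
  | k, d :: e :: σ => .and (literal (b k) d) (startsWithFrom b (k + 1) (e :: σ))

/-- The sentence saying that the string `b 0, b 1, …` starts with `σ`. -/
def startsWith {L : Set (List Bool)} (b : ℕ → L) (σ : List Bool) : Sentence L :=
  startsWithFrom b 0 σ

end LogicalInduction

open LogicalInduction

/-!
Both claims are proved by exhibiting an efficiently computable trader that would exploit the
market if the claim failed.

*Convergence* (`exists_tendsto_price`). If the price of `φ` falls below `a` and rises above
`b > a` infinitely often, a trader buys below `a` and sells above `b`, each time in proportion to what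
it may still buy or sell, so that it always holds between `0` and `1` units of `φ`. Its profit is
at least `b - a` per unit sold, up to a constant (`profit_le_worth`), and the amount sold is
unbounded: otherwise the holdings would converge, to `1` because of the low prices and to `0`
because of the high ones (`exists_lt_sum_sold`). The strategy for day `n` contains `n` instances
of one definition, and a Turing machine writes it down with a loop
(`efficientlyComputable_fill_range`).

*Domination* (`exists_mul_semimeasure_le`). If no constant works, then for each `κ` there is a
string `σ` whose sentence has a limiting price below `4 ^ (-κ) * M σ`. A trader goes through an
enumeration of all pairs `(κ, σ)` in which each pair recurs infinitely often, and buys the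
sentence of `σ` when its price is below `4 ^ (-κ)` times the current lower approximation of `M σ`.
The amounts bought on level `κ` are scaled such that they sum to at most `1` along each path of
the binary tree (`totalStake_le_one`). As `M` is a semimeasure, the amounts weighted with `M` then
sum to at most `1` (`sum_mul_semimeasure_le`). So level `κ` costs at most `4 ^ (-κ)` per unit of
weight; with weight `2 ^ κ` for level `κ` the total loss is at most `2` (`sum_cost_le`). On the
other hand, a string that stays underpriced is bought until along some path the amounts sum to at
least `1 / 2` (`exists_half_le_totalStake`). The atoms `b i` do not occur in `Γ`, so that by
compactness there is a plausible world that follows this path (`exists_world_startsWith`); there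
the trader gains `2 ^ κ / 2`.

The enumeration, the approximation of `M` and the atoms `b i` are merely computable. The trader
trades only on a sparse set of days `D 0 < D 1 < …`, which makes it efficient
(`exists_efficientlyComputable_delay`). A day `2 ^ m * (2 * y + 1)` offers the index `y` and the
clock `m`; the machine runs a universal program on `y` against the clock and prints its output if
the program halts exactly when the clock runs out (`efficientlyComputable_of_codeMachine`). Thus
each index `y` gets one day `d y > y`, which is determined by the running time on `y`, and the
trading days are the chain `d 0, d (d 0), …`. The strategy for a day of the chain must mention the
earlier ones, hence the running times of the program itself, which Kleene's recursion theorem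
makes available (`exists_selfTimed`). The universal program is run by Mathlib's stack machine for
partial recursive functions; the surrounding machine is assembled from program fragments (`Frag`)
with verified time bounds.
-/

namespace LogicalInduction

open Turing Turing.TM2

/-! ### Program fragments for stack machines -/

section Fragments

variable {K : Type} {Γ : K → Type}

/-- The internal state of the machines below: one register per stack, which receives the symbol
popped last from that stack (`none` if the stack was empty). -/
abbrev Reg (Γ : K → Type) : Type := ∀ k, Option (Γ k)

/-- Renaming of the labels in a statement. -/
def relabel {Λ Λ' σ : Type} (f : Λ → Λ') : Stmt Γ Λ σ → Stmt Γ Λ' σ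
  | .push k g q => .push k g (relabel f q)
  | .peek k g q => .peek k g (relabel f q)
  | .pop k g q => .pop k g (relabel f q)
  | .load g q => .load g (relabel f q)
  | .branch g q₁ q₂ => .branch g (relabel f q₁) (relabel f q₂)
  | .goto l => .goto (fun s => f (l s))
  | .halt => .halt

theorem stepAux_relabel [DecidableEq K] {Λ Λ' σ : Type} (f : Λ → Λ') (q : Stmt Γ Λ σ) (v : σ)
    (S : ∀ k, List (Γ k)) :
    stepAux (relabel f q) v S =
      ⟨(stepAux q v S).l.map f, (stepAux q v S).var, (stepAux q v S).stk⟩ := by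
  induction q generalizing v S with
  | branch g q₁ q₂ h₁ h₂ =>
    simp only [relabel, stepAux]
    cases g v <;> simp [h₁, h₂]
  | _ => simp_all [relabel, stepAux]

/-- A program fragment: a finite set of labels, one of them the entry, and a statement for each
label. A statement jumps to a label of the fragment or to `none`, the exit. -/
structure Frag (Γ : K → Type) where
  Λ : Type
  fin : Fintype Λ
  entry : Λ
  code : Λ → Stmt Γ (Option Λ) (Reg Γ)

attribute [instance] Frag.fin

namespace Frag

variable [DecidableEq K]

/-- `F.Steps n c c'`: the fragment goes from `c` to `c'` in `n` steps. -/
inductive Steps (F : Frag Γ) :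
    ℕ → Cfg Γ (Option F.Λ) (Reg Γ) → Cfg Γ (Option F.Λ) (Reg Γ) → Prop
  | refl (c) : Steps F 0 c c
  | head {n} (l : F.Λ) (v S c) : Steps F n (stepAux (F.code l) v S) c →
      Steps F (n + 1) ⟨some (some l), v, S⟩ c

theorem Steps.trans {F : Frag Γ} {m n : ℕ} {a b c} (h : F.Steps m a b) (h' : F.Steps n b c) :
    F.Steps (m + n) a c := by
  induction h with
  | refl => simpa using h'
  | @head n' l v S c _ ih =>
    have := Steps.head l v S _ (ih h')
    rwa [show n' + 1 + n = n' + n + 1 by omega]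

/-- If `G` contains a copy of `F`, runs of `F` are runs of `G`. -/
theorem Steps.embed {F G : Frag Γ} (ι : Option F.Λ → Option G.Λ)
    (hι : ∀ l, ∃ l', ι (some l) = some l' ∧ G.code l' = relabel ι (F.code l)) {n c c'}
    (h : F.Steps n c c') :
    G.Steps n ⟨c.l.map ι, c.var, c.stk⟩ ⟨c'.l.map ι, c'.var, c'.stk⟩ := by
  induction h with
  | refl => exact .refl _
  | head l v S c _ ih =>
    obtain ⟨l', h₁, h₂⟩ := hι l
    simp only [Option.map_some, h₁]
    refine .head _ _ _ _ ?_
    rw [h₂, stepAux_relabel]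
    exact ih

/-- From the entry, with the stacks `S`, the fragment gets to the exit in at most `t` steps and
leaves the stacks `S'`. -/
def Runs (F : Frag Γ) (S : ∀ k, List (Γ k)) (t : ℕ) (S' : ∀ k, List (Γ k)) : Prop :=
  ∀ v, ∃ v' n, n ≤ t ∧ F.Steps n ⟨some (some F.entry), v, S⟩ ⟨some none, v', S'⟩

theorem Runs.mono {F : Frag Γ} {S S' t t'} (h : F.Runs S t S') (ht : t ≤ t') : F.Runs S t' S' :=
  fun v => by
    obtain ⟨v', n, hn, h⟩ := h v
    exact ⟨v', n, hn.trans ht, h⟩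

theorem Runs.congr {F : Frag Γ} {S S' S'' t t'} (h : F.Runs S t S') (hS : S' = S'')
    (ht : t ≤ t') : F.Runs S t' S'' :=
  hS ▸ h.mono ht

/-- Push a symbol. -/
def push (k : K) (a : Γ k) : Frag Γ where
  Λ := Unit
  fin := inferInstance
  entry := ()
  code _ := .push k (fun _ => a) (.goto fun _ => none)

theorem runs_push (k : K) (a : Γ k) (S) :
    (push k a).Runs S 1 (Function.update S k (a :: S k)) :=
  fun v => ⟨v, 1, le_rfl, .head _ _ _ _ (.refl _)⟩

/-- Do nothing. -/
def skip : Frag Γ where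
  Λ := Unit
  fin := inferInstance
  entry := ()
  code _ := .goto fun _ => none

theorem runs_skip (S : ∀ k, List (Γ k)) : skip.Runs S 1 S :=
  fun v => ⟨v, 1, le_rfl, .head _ _ _ _ (.refl _)⟩

/-- Sequential composition. -/
def seq (F G : Frag Γ) : Frag Γ where
  Λ := F.Λ ⊕ G.Λ
  fin := inferInstance
  entry := .inl F.entry
  code
    | .inl l => relabel (fun o => some (o.elim (.inr G.entry) .inl)) (F.code l)
    | .inr l => relabel (Option.map .inr) (G.code l)

theorem Runs.seq {F G : Frag Γ} {S S' S'' t t'} (hF : F.Runs S t S') (hG : G.Runs S' t' S'') :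
    (F.seq G).Runs S (t + t') S'' := by
  intro v
  obtain ⟨v', n, hn, h⟩ := hF v
  obtain ⟨v'', n', hn', h'⟩ := hG v'
  have h₁ := Steps.embed (G := F.seq G) (fun o => some (o.elim (.inr G.entry) .inl))
    (fun l => ⟨_, rfl, rfl⟩) h
  have h₂ := Steps.embed (G := F.seq G) (Option.map .inr) (fun l => ⟨_, rfl, rfl⟩) h'
  exact ⟨v'', n + n', by omega, h₁.trans h₂⟩

section

variable [∀ k, Fintype (Γ k)]

/-- Pop a symbol and continue as it says. -/
def switch (k : K) (body : Option (Γ k) → Frag Γ) : Frag Γ where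
  Λ := Option (Σ a, (body a).Λ)
  fin := inferInstance
  entry := none
  code
    | none => .pop k (fun s a => Function.update s k a)
        (.goto fun s => some (some ⟨s k, (body (s k)).entry⟩))
    | some ⟨a, l⟩ => relabel (Option.map fun l => some ⟨a, l⟩) ((body a).code l)

theorem runs_switch {k : K} {body : Option (Γ k) → Frag Γ} {S S' t}
    (h : (body (S k).head?).Runs (Function.update S k (S k).tail) t S') :
    (switch k body).Runs S (t + 1) S' := by
  intro v
  obtain ⟨v', n, hn, h⟩ := h (Function.update v k (S k).head?)
  have h₁ := Steps.embed (G := switch k body) (Option.map fun l => some ⟨(S k).head?, l⟩)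
    (fun l => ⟨_, rfl, rfl⟩) h
  refine ⟨v', n + 1, by omega, .head (F := switch k body) none v S _ ?_⟩
  have h₂ : stepAux ((switch k body).code none) v S =
      ⟨some (some (some ⟨(S k).head?, (body (S k).head?).entry⟩)), Function.update v k (S k).head?,
        Function.update S k (S k).tail⟩ := by
    simp only [switch, stepAux, Cfg.mk.injEq, and_true]
    rw [Function.update_self]
  rw [h₂]
  exact h₁

/-- Pop the symbols of a stack one by one, until it is empty, and do for each what it says. -/
def loop (k : K) (body : Γ k → Frag Γ) : Frag Γ where
  Λ := Option (Σ a, (body a).Λ)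
  fin := inferInstance
  entry := none
  code
    | none => .pop k (fun s a => Function.update s k a)
        (.goto fun s => (s k).map fun a => some ⟨a, (body a).entry⟩)
    | some ⟨a, l⟩ => relabel (fun o => some (o.map fun l => ⟨a, l⟩)) ((body a).code l)

theorem runs_loop_nil {k : K} {body : Γ k → Frag Γ} {S} (h : S k = []) :
    (loop k body).Runs S 1 S := by
  intro v
  refine ⟨Function.update v k none, 1, le_rfl, .head (F := loop k body) none v S _ ?_⟩
  have : Function.update S k [] = S := by rw [← h]; simp
  simp only [loop, stepAux, h, Function.update_self, List.head?_nil, List.tail_nil, Option.map_none,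
    this]
  exact .refl _

theorem runs_loop_cons {k : K} {body : Γ k → Frag Γ} {S S' S'' a l t t'} (hk : S k = a :: l)
    (h : (body a).Runs (Function.update S k l) t S') (h' : (loop k body).Runs S' t' S'') :
    (loop k body).Runs S (1 + t + t') S'' := by
  intro v
  obtain ⟨v', n, hn, h⟩ := h (Function.update v k (some a))
  obtain ⟨v'', n', hn', h'⟩ := h' v'
  have h₁ := Steps.embed (G := loop k body) (fun o => some (o.map fun l => ⟨a, l⟩))
    (fun l => ⟨_, rfl, rfl⟩) h
  refine ⟨v'', n + n' + 1, by omega, .head (F := loop k body) none v S _ ?_⟩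
  refine Steps.trans ?_ h'
  simpa [loop, hk] using h₁

end

/-- A fragment as a complete machine: at the exit the registers are cleared and the machine
halts. -/
def toFinTM2 [Fintype K] [∀ k, Fintype (Γ k)] (F : Frag Γ) (k₀ k₁ : K) : FinTM2 where
  K := K
  k₀ := k₀
  k₁ := k₁
  Γ := Γ
  Λ := Option F.Λ
  main := some F.entry
  σ := Reg Γ
  initialState := fun _ => none
  m
    | some l => F.code l
    | none => .load (fun _ _ => none) .halt

theorem Steps.iterate [Fintype K] [∀ k, Fintype (Γ k)] {F : Frag Γ} {k₀ k₁ : K} {n c c'}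
    (h : F.Steps n c c') :
    (flip bind (F.toFinTM2 k₀ k₁).step)^[n] (some c : Option (F.toFinTM2 k₀ k₁).Cfg) =
      (some c' : Option (F.toFinTM2 k₀ k₁).Cfg) := by
  induction h with
  | refl => rfl
  | head l v S c _ ih =>
    rw [Function.iterate_succ_apply]
    exact ih

theorem initList_toFinTM2 [Fintype K] [∀ k, Fintype (Γ k)] (F : Frag Γ) (k₀ k₁ : K)
    (s : List (Γ k₀)) : initList (F.toFinTM2 k₀ k₁) s =
      (⟨some (some F.entry), fun _ => none, Function.update (fun _ => []) k₀ s⟩ :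
        Cfg Γ (Option F.Λ) (Reg Γ)) := by
  have h : (initList (F.toFinTM2 k₀ k₁) s).stk =
      (Function.update (fun _ => []) k₀ s : ∀ k, List (Γ k)) := by
    refine funext fun (k : K) => ?_
    by_cases hk : k = k₀
    · subst hk
      simp [toFinTM2, initList]
      rfl
    · rw [Function.update_of_ne hk]
      exact dif_neg hk
  rw [← h]
  rfl

theorem haltList_toFinTM2 [Fintype K] [∀ k, Fintype (Γ k)] (F : Frag Γ) (k₀ k₁ : K)
    (s : List (Γ k₁)) : haltList (F.toFinTM2 k₀ k₁) s =
      (⟨none, fun _ => none, Function.update (fun _ => []) k₁ s⟩ :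
        Cfg Γ (Option F.Λ) (Reg Γ)) := by
  have h : (haltList (F.toFinTM2 k₀ k₁) s).stk =
      (Function.update (fun _ => []) k₁ s : ∀ k, List (Γ k)) := by
    refine funext fun (k : K) => ?_
    by_cases hk : k = k₁
    · subst hk
      simp [toFinTM2, haltList]
      rfl
    · rw [Function.update_of_ne hk]
      exact dif_neg hk
  rw [← h]
  rfl

theorem map_unaryEncodeNat {α : Type} (f : Bool → α) (n : ℕ) :
    (Computability.unaryEncodeNat n).map f = List.replicate n (f true) := by
  induction n with
  | zero => rfl
  | succ n ih => simp [Computability.unaryEncodeNat, List.replicate_succ, ih]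

/-- A fragment that turns the input `1 … 1` into the output `x n`, and empties the other stacks,
in polynomially many steps shows that `x` is efficiently computable. -/
theorem efficientlyComputable [Fintype K] [∀ k, Fintype (Γ k)] (F : Frag Γ) (k₀ k₁ : K)
    (e₀ : Γ k₀ ≃ Bool) (e₁ : Γ k₁ ≃ Bool) (x : ℕ → List Bool) (p : Polynomial ℕ)
    (h : ∀ n, F.Runs (Function.update (fun _ => []) k₀ (List.replicate n (e₀.symm true))) (p.eval n)
      (Function.update (fun _ => []) k₁ ((x n).map e₁.symm))) :
    EfficientlyComputable x := by
  have key : ∀ n (s : List (Γ k₀)), s = List.replicate n (e₀.symm true) →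
      Nonempty (TM2OutputsInTime (F.toFinTM2 k₀ k₁) s (some ((x n).map e₁.symm))
        (p.eval n + 1)) := by
    rintro n s rfl
    obtain ⟨v', m, hm, hs⟩ := h n (fun _ => none)
    have h₁ := hs.iterate (k₀ := k₀) (k₁ := k₁)
    refine ⟨⟨⟨m + 1, ?_⟩, Nat.succ_le_succ hm⟩⟩
    rw [Function.iterate_succ_apply']
    have h₂ := initList_toFinTM2 F k₀ k₁ (List.replicate n (e₀.symm true))
    have h₃ := haltList_toFinTM2 F k₀ k₁ ((x n).map e₁.symm)
    erw [h₂, h₁, Option.map_some, h₃]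
    rfl
  refine ⟨{ tm := F.toFinTM2 k₀ k₁, inputAlphabet := e₀, outputAlphabet := e₁, time := p + 1,
            outputsFun := fun n => ?_ }⟩
  have hl : (Computability.unaryEncodeNat n).length = n :=
    Computability.unary_decode_encode_nat n
  rw [hl, Polynomial.eval_add, Polynomial.eval_one]
  exact (key n _ (map_unaryEncodeNat e₀.symm n)).some

end Frag

end Fragments

namespace Frag

section

variable {K : Type} {Γ : K → Type} [DecidableEq K]

/-- Push the symbols of `w`, the last one first. -/
def pushWord (k : K) : List (Γ k) → Frag Γ
  | [] => skip
  | a :: w => (pushWord k w).seq (push k a)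

theorem runs_pushWord (k : K) (w : List (Γ k)) (S) :
    (pushWord k w).Runs S (w.length + 1) (Function.update S k (w ++ S k)) := by
  induction w with
  | nil => simpa [pushWord] using runs_skip S
  | cons a w ih => simpa [pushWord] using ih.seq (runs_push k a _)

variable [∀ k, Fintype (Γ k)]

/-- Empty a stack. -/
def clear (k : K) : Frag Γ := loop k fun _ => skip

theorem runs_clear (k : K) (S : ∀ k, List (Γ k)) :
    (clear k).Runs S (2 * (S k).length + 1) (Function.update S k []) := by
  generalize hl : S k = l
  induction l generalizing S with
  | nil =>
    have e : Function.update S k [] = S := hl ▸ Function.update_eq_self k S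
    rw [e]
    exact runs_loop_nil hl
  | cons a l ih =>
    have := runs_loop_cons hl (runs_skip _) (ih (Function.update S k l) (by simp))
    simp only [Function.update_idem] at this
    exact this.mono (by simp; omega)

/-- Move a stack to another one, renaming the symbols; the order is reversed. -/
def move (k k' : K) (f : Γ k → Γ k') : Frag Γ := loop k fun a => push k' (f a)

theorem runs_move {k k' : K} (hk : k ≠ k') (f : Γ k → Γ k') (S : ∀ k, List (Γ k)) :
    (move k k' f).Runs S (2 * (S k).length + 1)
      (Function.update (Function.update S k []) k' (((S k).map f).reverse ++ S k')) := by
  generalize hl : S k = l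
  induction l generalizing S with
  | nil =>
    have e : Function.update S k [] = S := hl ▸ Function.update_eq_self k S
    rw [e, List.map_nil, List.reverse_nil, List.nil_append, Function.update_eq_self]
    exact runs_loop_nil hl
  | cons a l ih =>
    have := runs_loop_cons (body := fun a => push k' (f a)) hl (runs_push k' (f a) _)
      (ih _ (by rw [Function.update_of_ne hk, Function.update_self]))
    have e : Function.update (Function.update (Function.update (Function.update S k l) k'
        (f a :: Function.update S k l k')) k []) k' ((l.map f).reverse ++
          Function.update (Function.update S k l) k' (f a :: Function.update S k l k') k') =
        Function.update (Function.update S k []) k' (((a :: l).map f).reverse ++ S k') := by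
      funext j
      by_cases h : j = k'
      · subst h
        simp [hk.symm]
      · by_cases h' : j = k
        · subst h'
          simp [h]
        · simp [h, h']
    rw [e] at this
    exact this.mono (by simp; omega)

end

end Frag

/-! ### The stacks -/

open PartrecToTM2 (Γ' K')

/-- The stacks: input, output, the number of the day in unary, a buffer, a parity bit, a flag, a
clock, the binary digits of a number, and the four stacks of Mathlib's machine for partial
recursive functions. -/
inductive Stk
  | inp | out | day | tmp | par | flag | clk | bits
  | w (k : K')
  deriving DecidableEq

instance : Fintype Stk where
  elems := {.inp, .out, .day, .tmp, .par, .flag, .clk, .bits, .w .main, .w .rev, .w .aux,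
    .w .stack}
  complete k := by
    rcases k with _ | _ | _ | _ | _ | _ | _ | _ | k
    case w => cases k <;> simp
    all_goals simp

/-- The alphabets of the stacks. -/
abbrev Alph : Stk → Type
  | .w _ => Γ'
  | .inp | .out | .day | .tmp | .par | .flag | .clk | .bits => Bool

instance : ∀ k, Fintype (Alph k)
  | .w _ => inferInstanceAs (Fintype Γ')
  | .inp | .out | .day | .tmp | .par | .flag | .clk | .bits => inferInstanceAs (Fintype Bool)

/-- The contents of the stacks. -/
structure St where
  inp : List Bool := []
  out : List Bool := []
  day : List Bool := []
  tmp : List Bool := []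
  par : List Bool := []
  flag : List Bool := []
  clk : List Bool := []
  bits : List Bool := []
  work : K' → List Γ' := fun _ => []

/-- The contents of the stacks as a function of the stack. -/
def St.get (s : St) : ∀ k, List (Alph k)
  | .inp => s.inp
  | .out => s.out
  | .day => s.day
  | .tmp => s.tmp
  | .par => s.par
  | .flag => s.flag
  | .clk => s.clk
  | .bits => s.bits
  | .w k => s.work k

section

variable (s : St)

@[simp] theorem St.get_inp : s.get .inp = s.inp := rfl
@[simp] theorem St.get_out : s.get .out = s.out := rfl
@[simp] theorem St.get_day : s.get .day = s.day := rfl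
@[simp] theorem St.get_tmp : s.get .tmp = s.tmp := rfl
@[simp] theorem St.get_par : s.get .par = s.par := rfl
@[simp] theorem St.get_flag : s.get .flag = s.flag := rfl
@[simp] theorem St.get_clk : s.get .clk = s.clk := rfl
@[simp] theorem St.get_bits : s.get .bits = s.bits := rfl
@[simp] theorem St.get_w (k) : s.get (.w k) = s.work k := rfl

@[simp] theorem St.update_inp (l) : Function.update s.get .inp l = St.get { s with inp := l } := by
  funext k; cases k <;> rfl
@[simp] theorem St.update_out (l) : Function.update s.get .out l = St.get { s with out := l } := by
  funext k; cases k <;> rfl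
@[simp] theorem St.update_day (l) : Function.update s.get .day l = St.get { s with day := l } := by
  funext k; cases k <;> rfl
@[simp] theorem St.update_tmp (l) : Function.update s.get .tmp l = St.get { s with tmp := l } := by
  funext k; cases k <;> rfl
@[simp] theorem St.update_par (l) : Function.update s.get .par l = St.get { s with par := l } := by
  funext k; cases k <;> rfl
@[simp] theorem St.update_flag (l) :
    Function.update s.get .flag l = St.get { s with flag := l } := by
  funext k; cases k <;> rfl
@[simp] theorem St.update_clk (l) : Function.update s.get .clk l = St.get { s with clk := l } := by
  funext k; cases k <;> rfl
@[simp] theorem St.update_bits (l) :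
    Function.update s.get .bits l = St.get { s with bits := l } := by
  funext k; cases k <;> rfl
@[simp] theorem St.update_w (k : K') (l) :
    Function.update s.get (.w k) l = St.get { s with work := Function.update s.work k l } := by
  funext j
  rcases j with _ | _ | _ | _ | _ | _ | _ | _ | j
  case w =>
    by_cases h : j = k
    · subst h
      simp
    · simp [h]
  all_goals rfl

end

theorem St.get_default : St.get {} = fun _ => [] := by
  funext k; cases k <;> rfl

/-- Polynomial time programs with these stacks. -/
theorem efficientlyComputable_of_runs (F : Frag Alph) (x : ℕ → List Bool) (p : Polynomial ℕ)
    (h : ∀ n, F.Runs (St.get { inp := List.replicate n true }) (p.eval n)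
      (St.get { out := x n })) : EfficientlyComputable x := by
  refine F.efficientlyComputable .inp .out (Equiv.refl Bool) (Equiv.refl Bool) x p fun n => ?_
  have := h n
  rw [← St.get_default]
  simpa using this

/-! ### Printing templates -/

/-- Replace the holes (`none`) of a template by the unary code of a number. -/
def fill (n : ℕ) (t : List (Option Bool)) : List Bool :=
  t.flatMap fun o => o.elim (encodeUnary n) fun b => [b]

theorem fill_nil (n : ℕ) : fill n [] = [] := rfl

theorem fill_cons (n : ℕ) (o : Option Bool) (t : List (Option Bool)) :
    fill n (o :: t) = (o.elim (encodeUnary n) fun b => [b]) ++ fill n t := by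
  simp [fill]

theorem fill_append (n : ℕ) (t u : List (Option Bool)) :
    fill n (t ++ u) = fill n t ++ fill n u := by
  simp [fill]

theorem fill_map_some (n : ℕ) (w : List Bool) : fill n (w.map some) = w := by
  induction w with
  | nil => rfl
  | cons a w ih => simp [fill_cons, ih]

open Frag

/-- Print the unary code of the number in the stack `day`. -/
def printDay : Frag Alph :=
  (push .out false).seq <| (loop .day fun _ => (push .out true).seq (push .tmp true)).seq <|
    move .tmp .day id

theorem runs_printDay_loop (n : ℕ) (s : St) (h : s.day = List.replicate n true) :
    (loop .day fun _ => (push .out true).seq (push .tmp true) : Frag Alph).Runs s.get (3 * n + 1)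
      (St.get { s with day := [], out := List.replicate n true ++ s.out,
                       tmp := List.replicate n true ++ s.tmp }) := by
  induction n generalizing s with
  | zero =>
    have : s = { s with day := [], out := s.out, tmp := s.tmp } := by
      cases s; simp_all
    simpa [← this] using
      runs_loop_nil (body := fun _ => (push .out true).seq (push .tmp true) (Γ := Alph)) h
  | succ n ih =>
    have h₁ := runs_loop_cons (Γ := Alph) (k := .day)
      (body := fun _ => (push .out true).seq (push .tmp true)) (S := s.get)
      h ((runs_push _ _ _).seq (runs_push _ _ _))
      (by simpa using ih { s with day := List.replicate n true, out := true :: s.out,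
                                  tmp := true :: s.tmp } rfl)
    refine Runs.mono ?_ (t := 1 + (1 + 1) + (3 * n + 1)) (by omega)
    simpa [List.replicate_succ', List.append_assoc] using h₁

theorem runs_printDay (n : ℕ) (s : St) (h : s.day = List.replicate n true) (h' : s.tmp = []) :
    printDay.Runs s.get (5 * n + 3) (St.get { s with out := encodeUnary n ++ s.out }) := by
  have h₁ := runs_push (Γ := Alph) .out false s.get
  simp only [St.get_out, St.update_out] at h₁
  have h₂ := runs_printDay_loop n { s with out := false :: s.out } h
  have h₃ := runs_move (Γ := Alph) (show Stk.tmp ≠ .day by simp) id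
    (St.get { s with day := [], out := List.replicate n true ++ false :: s.out,
                     tmp := List.replicate n true ++ s.tmp })
  have := h₁.seq (h₂.seq h₃)
  refine Runs.mono ?_ (t := 1 + ((3 * n + 1) + (2 * n + 1))) (by omega)
  simpa [h, h', encodeUnary, printDay] using this

/-- Print a template, with the number in the stack `day` for the holes. -/
def print : List (Option Bool) → Frag Alph
  | [] => skip
  | none :: t => (print t).seq printDay
  | some b :: t => (print t).seq (push .out b)

theorem runs_print (t : List (Option Bool)) (n : ℕ) (s : St) (h : s.day = List.replicate n true)
    (h' : s.tmp = []) :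
    (print t).Runs s.get ((t.length + 1) * (5 * n + 3))
      (St.get { s with out := fill n t ++ s.out }) := by
  induction t with
  | nil => exact (runs_skip s.get).mono (by simp)
  | cons o t ih =>
    cases o with
    | none =>
      have h₁ := runs_printDay n { s with out := fill n t ++ s.out } h h'
      have := ih.seq h₁
      simp only [fill_cons, Option.elim, List.append_assoc]
      exact this.mono (by simp only [List.length_cons]; ring_nf; omega)
    | some b =>
      have h₁ := runs_push (Γ := Alph) .out b (St.get { s with out := fill n t ++ s.out })
      simp only [St.get_out, St.update_out] at h₁
      have := ih.seq h₁
      simp only [fill_cons, Option.elim, List.append_assoc]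
      exact this.mono (by simp only [List.length_cons]; ring_nf; omega)

theorem runs_print_loop (t : List (Option Bool)) (n : ℕ) (s : St)
    (h : s.day = List.replicate n true) (h' : s.tmp = []) :
    (loop .day fun _ => print t : Frag Alph).Runs s.get
      (n * ((t.length + 1) * (5 * n + 3) + 1) + 1)
      (St.get { s with day := [], out := (List.range n).flatMap (fill · t) ++ s.out }) := by
  induction n generalizing s with
  | zero =>
    have : s = { s with day := [], out := s.out } := by
      cases s; simp_all
    simpa [← this] using runs_loop_nil (body := fun _ => print t) h
  | succ n ih =>
    have h₁ := runs_loop_cons (Γ := Alph) (k := .day) (body := fun _ => print t) (S := s.get) h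
      (by simpa using runs_print t n { s with day := List.replicate n true } rfl h')
      (ih { s with day := List.replicate n true, out := fill n t ++ s.out } rfl h')
    refine Runs.mono ?_ (t := 1 + ((t.length + 1) * (5 * n + 3)) +
      (n * ((t.length + 1) * (5 * n + 3) + 1) + 1)) ?_
    · simpa [List.range_succ, List.append_assoc] using h₁
    · nlinarith [Nat.zero_le (n * (t.length + 1)), Nat.zero_le (t.length + 1)]

/-- The strings that consist of a fixed string, a template filled with each number below `n`, in
order, and a template filled with `n` are efficiently computable. -/
theorem efficientlyComputable_fill_range (w : List Bool) (t₁ t₂ : List (Option Bool)) :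
    EfficientlyComputable fun n => w ++ (List.range n).flatMap (fill · t₁) ++ fill n t₂ := by
  let p : Polynomial ℕ := (2 * .X + 1) + (((.C (t₂.length + 1)) * (5 * .X + 3)) +
    ((.X * (.C (t₁.length + 1) * (5 * .X + 3) + 1) + 1) + .C (w.length + 1)))
  -- The output stack is filled from its end.
  refine efficientlyComputable_of_runs ((move .inp .day id).seq <| (print t₂).seq <|
    (loop .day fun _ => print t₁).seq (pushWord .out w)) _ p fun n => ?_
  have h₁ := runs_move (Γ := Alph) (show Stk.inp ≠ .day by simp) id
    (St.get { inp := List.replicate n true })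
  have h₂ := runs_print t₂ n { day := List.replicate n true } rfl rfl
  have h₃ := runs_print_loop t₁ n { day := List.replicate n true, out := fill n t₂ } rfl rfl
  have h₄ := runs_pushWord (Γ := Alph) .out w
    (St.get { out := (List.range n).flatMap (fill · t₁) ++ fill n t₂ })
  simp at h₁ h₂ h₃ h₄
  have := h₁.seq (h₂.seq (h₃.seq h₄))
  rw [List.append_assoc]
  refine this.mono (le_of_eq ?_)
  simp [p]

open Turing.ToPartrec
open PartrecToTM2 (Λ' trNormal tr codeSupp trList trNat)

/-! ### Mathlib's machine for partial recursive functions, with finitely many labels -/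

section Next

variable {K : Type} {Γ : K → Type} [DecidableEq K] {Λ σ : Type}

/-- One step of a machine, where a machine that has halted stays as it is. -/
def next (R : Λ → Stmt Γ Λ σ) (c : Cfg Γ Λ σ) : Cfg Γ Λ σ := (step R c).getD c

theorem next_some (R : Λ → Stmt Γ Λ σ) (l v S) :
    next R ⟨some l, v, S⟩ = stepAux (R l) v S := rfl

theorem next_none (R : Λ → Stmt Γ Λ σ) (v S) : next R ⟨none, v, S⟩ = ⟨none, v, S⟩ := rfl

theorem next_iterate_of_halted {R : Λ → Stmt Γ Λ σ} {c} (h : c.l = none) (n : ℕ) :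
    (next R)^[n] c = c := by
  obtain ⟨l, v, S⟩ := c
  obtain rfl : l = none := h
  exact Function.iterate_fixed (next_none R v S) n

theorem exists_next_iterate {R : Λ → Stmt Γ Λ σ} {a b}
    (h : StateTransition.Reaches (step R) a b) : ∃ n, (next R)^[n] a = b := by
  induction h with
  | refl => exact ⟨0, rfl⟩
  | tail _ h ih =>
    obtain ⟨n, rfl⟩ := ih
    refine ⟨n + 1, ?_⟩
    rw [Function.iterate_succ_apply', next, Option.mem_def.1 h]
    rfl

/-- The number of symbols that a statement may push. -/
def growth : Stmt Γ Λ σ → ℕ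
  | .push _ _ q => growth q + 1
  | .peek _ _ q => growth q
  | .pop _ _ q => growth q
  | .load _ q => growth q
  | .branch _ q₁ q₂ => growth q₁ + growth q₂
  | .goto _ => 0
  | .halt => 0

theorem length_stepAux_le (q : Stmt Γ Λ σ) (v : σ) (S : ∀ k, List (Γ k)) (k : K) :
    ((stepAux q v S).stk k).length ≤ (S k).length + growth q := by
  induction q generalizing v S with
  | push k' f q ih =>
    have := ih v (Function.update S k' (f v :: S k'))
    simp only [stepAux, growth]
    by_cases h : k = k'
    · subst h
      simp at this
      omega
    · simp [h] at this
      omega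
  | pop k' f q ih =>
    have := ih (f v (S k').head?) (Function.update S k' (S k').tail)
    simp only [stepAux, growth]
    by_cases h : k = k'
    · subst h
      simp at this
      omega
    · simp [h] at this
      omega
  | branch f q₁ q₂ h₁ h₂ =>
    have := h₁ v S
    have := h₂ v S
    simp only [stepAux, growth]
    cases f v <;> simp <;> omega
  | peek k' f q ih => exact ih _ _
  | load f q ih => exact ih _ _
  | goto => simp [stepAux]
  | halt => simp [stepAux]

theorem length_next_iterate_le [Fintype Λ] (R : Λ → Stmt Γ Λ σ) (c : Cfg Γ Λ σ) (k : K) (n : ℕ) :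
    (((next R)^[n] c).stk k).length ≤ (c.stk k).length + n * ∑ l, growth (R l) := by
  induction n with
  | zero => simp
  | succ n ih =>
    rw [Function.iterate_succ_apply']
    generalize (next R)^[n] c = c' at ih
    obtain ⟨l | l, v, S⟩ := c'
    · rw [next_none]
      simp only at ih ⊢
      nlinarith [Nat.zero_le (∑ l, growth (R l))]
    · rw [next_some]
      have h₁ := length_stepAux_le (R l) v S k
      have h₂ : growth (R l) ≤ ∑ l, growth (R l) :=
        Finset.single_le_sum (f := fun l => growth (R l)) (fun _ _ => Nat.zero_le _)
          (Finset.mem_univ l)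
      simp only at ih ⊢
      linarith

end Next

/-- The labels that occur in runs of the machine for the code `c`. -/
abbrev CodeLabel (c : Code) : Type := {l // l ∈ codeSupp c .halt}

/-- The label where the machine for the code `c` starts. -/
def codeEntry (c : Code) : CodeLabel c :=
  ⟨trNormal c .halt, (PartrecToTM2.tr_supports c .halt).1⟩

/-- The stack alphabets of the machine for partial recursive functions. -/
abbrev WorkAlph (_ : K') : Type := Γ'

/-- The statements of Mathlib's machine for partial recursive functions. -/
def partrecStmt (l : Λ') : Stmt WorkAlph Λ' (Option Γ') := tr l

/-- The machine for the code `c`. -/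
def codeMachine (c : Code) (l : CodeLabel c) : Stmt WorkAlph (CodeLabel c) (Option Γ') :=
  relabel (fun l => if h : l ∈ codeSupp c .halt then ⟨l, h⟩ else codeEntry c) (partrecStmt l.1)

theorem next_codeMachine (c : Code) {a b : Cfg WorkAlph Λ' (Option Γ')}
    {a' : Cfg WorkAlph (CodeLabel c) (Option Γ')} (ha : a = ⟨a'.l.map (·.1), a'.var, a'.stk⟩)
    (h : next partrecStmt a = b) :
    b = ⟨(next (codeMachine c) a').l.map (·.1), (next (codeMachine c) a').var,
      (next (codeMachine c) a').stk⟩ := by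
  obtain ⟨l | l, v, S⟩ := a'
  · subst ha h
    rfl
  · have hs : SupportsStmt (codeSupp c .halt) (partrecStmt l.1) :=
      (PartrecToTM2.tr_supports c .halt).2 _ l.2
    have hl : ∀ o ∈ (stepAux (partrecStmt l.1) v S).l, o ∈ codeSupp c .halt := by
      intro o ho
      let _ : Inhabited Λ' := ⟨trNormal c .halt⟩
      have := step_supports partrecStmt (PartrecToTM2.tr_supports c .halt)
        (c := ⟨some l.1, v, S⟩) rfl (Finset.some_mem_insertNone.2 l.2)
      rw [ho] at this
      exact Finset.some_mem_insertNone.1 this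
    rw [next_some, codeMachine, stepAux_relabel]
    subst ha
    rw [← h]
    have : next partrecStmt (⟨some l.1, v, S⟩ : Cfg WorkAlph Λ' (Option Γ')) =
        stepAux (partrecStmt l.1) v S := rfl
    simp only [Option.map_some, this]
    generalize stepAux (partrecStmt l.1) v S = d at hl
    obtain ⟨o, v', S'⟩ := d
    cases o with
    | none => rfl
    | some o => simp [hl o rfl]

/-- The initial configuration of the machine for `c` with the input `v`. -/
def codeInit (c : Code) (v : List ℕ) : Cfg WorkAlph (CodeLabel c) (Option Γ') :=
  ⟨some (codeEntry c), none, K'.elim (trList v) [] [] []⟩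

/-- The initial configuration of Mathlib's machine for `c` with the input `v`. -/
def partrecInit (c : Code) (v : List ℕ) : Cfg WorkAlph Λ' (Option Γ') := PartrecToTM2.init c v

theorem exists_codeMachine_halts {c : Code} {v w : List ℕ} (h : w ∈ c.eval v) :
    ∃ n, (next (codeMachine c))^[n] (codeInit c v) = ⟨none, none, K'.elim (trList w) [] [] []⟩ := by
  have h₁ : PartrecToTM2.halt w ∈
      StateTransition.eval (step partrecStmt) (partrecInit c v) := by
    have := PartrecToTM2.tr_eval c v
    unfold partrecStmt partrecInit
    rw [this]
    exact Part.mem_map _ h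
  obtain ⟨n, hn⟩ := exists_next_iterate (StateTransition.mem_eval.1 h₁).1
  refine ⟨n, ?_⟩
  have key : ∀ n, (next partrecStmt)^[n] (partrecInit c v) =
      (⟨((next (codeMachine c))^[n] (codeInit c v)).l.map (·.1),
        ((next (codeMachine c))^[n] (codeInit c v)).var,
        ((next (codeMachine c))^[n] (codeInit c v)).stk⟩ : Cfg WorkAlph Λ' (Option Γ')) := by
    intro n
    induction n with
    | zero => rfl
    | succ n ih =>
      rw [Function.iterate_succ_apply', Function.iterate_succ_apply']
      exact next_codeMachine c ih rfl
  rw [key n] at hn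
  generalize (next (codeMachine c))^[n] (codeInit c v) = d at hn
  obtain ⟨l, v', S⟩ := d
  injection hn with h₁ h₂ h₃
  obtain rfl : l = none := Option.map_eq_none_iff.1 h₁
  obtain rfl : v' = none := h₂
  obtain rfl : S = K'.elim (trList w) [] [] [] := h₃
  rfl

/-! ### Running a machine against a clock -/

/-- A statement of a machine with the four work stacks as a statement of a machine with all
stacks. The register of the first work stack holds the internal state. When the simulated machine
halts, the flag is raised. -/
def simulate {Λ : Type} : Stmt WorkAlph Λ (Option Γ') → Stmt Alph (Option (Option Λ)) (Reg Alph)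
  | .push k f q => .push (.w k) (fun s => f (s (.w .main))) (simulate q)
  | .peek k f q => .peek (.w k)
      (fun s a => Function.update s (.w .main) (f (s (.w .main)) a)) (simulate q)
  | .pop k f q => .pop (.w k)
      (fun s a => Function.update s (.w .main) (f (s (.w .main)) a)) (simulate q)
  | .load f q => .load (fun s => Function.update s (.w .main) (f (s (.w .main)))) (simulate q)
  | .branch f q₁ q₂ => .branch (fun s => f (s (.w .main))) (simulate q₁) (simulate q₂)
  | .goto l => .goto fun s => some (some (l (s (.w .main))))
  | .halt => .push .flag (fun _ => true) (.goto fun _ => none)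

/-- The configuration of the simulation, with the contents `s` of the other stacks. -/
def simCfg {Λ : Type} (s : St) (v : Reg Alph) (c : Cfg WorkAlph Λ (Option Γ')) :
    Cfg Alph (Option (Option Λ)) (Reg Alph) :=
  ⟨some (c.l.map some), v,
    St.get { s with work := c.stk, flag := if c.l.isSome then s.flag else true :: s.flag }⟩

theorem stepAux_simulate {Λ : Type} (q : Stmt WorkAlph Λ (Option Γ')) (s : St) (v : Reg Alph)
    (S : K' → List Γ') : ∃ v' : Reg Alph,
      v' (.w .main) = (stepAux q (v (.w .main)) S).var ∧
      stepAux (simulate q) v (St.get { s with work := S }) =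
        simCfg s v' (stepAux q (v (.w .main)) S) := by
  induction q generalizing v S with
  | push k f q ih =>
    obtain ⟨v', h₁, h₂⟩ := ih v (Function.update S k (f (v (.w .main)) :: S k))
    refine ⟨v', h₁, ?_⟩
    simp only [simulate, stepAux, St.update_w, St.get_w]
    exact h₂
  | peek k f q ih =>
    obtain ⟨v', h₁, h₂⟩ := ih (Function.update v (.w .main) (f (v (.w .main)) (S k).head?)) S
    rw [Function.update_self] at h₁ h₂
    exact ⟨v', h₁, h₂⟩
  | pop k f q ih =>
    obtain ⟨v', h₁, h₂⟩ := ih (Function.update v (.w .main) (f (v (.w .main)) (S k).head?))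
      (Function.update S k (S k).tail)
    rw [Function.update_self] at h₁ h₂
    refine ⟨v', h₁, ?_⟩
    simp only [simulate, stepAux, St.update_w, St.get_w]
    exact h₂
  | load f q ih =>
    obtain ⟨v', h₁, h₂⟩ := ih (Function.update v (.w .main) (f (v (.w .main)))) S
    rw [Function.update_self] at h₁ h₂
    exact ⟨v', h₁, h₂⟩
  | branch f q₁ q₂ ih₁ ih₂ =>
    simp only [simulate, stepAux]
    cases f (v (.w .main))
    · exact ih₂ v S
    · exact ih₁ v S
  | goto l => exact ⟨v, rfl, rfl⟩
  | halt =>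
    refine ⟨v, rfl, ?_⟩
    simp [simulate, stepAux, simCfg]

/-- Run a machine until it halts or the clock has run out; each step takes a symbol from the
clock. -/
def clocked {Λ : Type} [Fintype Λ] (R : Λ → Stmt WorkAlph Λ (Option Γ')) (entry : Λ) :
    Frag Alph where
  Λ := Option Λ
  fin := inferInstance
  entry := none
  code
    | none => .load (fun s => Function.update s (.w .main) none) (.goto fun _ => some (some entry))
    | some l => .pop .clk (fun s a => Function.update s .clk a)
        (.branch (fun s => (s .clk).isSome) (simulate (R l)) (.goto fun _ => none))

section

variable {Λ : Type} [Fintype Λ] {R : Λ → Stmt WorkAlph Λ (Option Γ')} {entry : Λ}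

theorem clocked_code_some_cons (l : Λ) (a : Bool) (m : List Bool) (s : St) (v : Reg Alph)
    (S : K' → List Γ') :
    ∃ v' : Reg Alph, v' (.w .main) = (stepAux (R l) (v (.w .main)) S).var ∧
      stepAux ((clocked R entry).code (some l)) v (St.get { s with work := S, clk := a :: m }) =
        simCfg { s with clk := m } v' (stepAux (R l) (v (.w .main)) S) := by
  obtain ⟨v', h₁, h₂⟩ := stepAux_simulate (R l) { s with clk := m }
    (Function.update v .clk (some a)) S
  refine ⟨v', by simpa using h₁, ?_⟩
  simpa [clocked] using h₂

theorem steps_clocked {n : ℕ} {c : Cfg WorkAlph Λ (Option Γ')}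
    (h : ∀ i < n, ((next R)^[i] c).l.isSome) (hc : c.l.isSome) (s : St) (v : Reg Alph)
    (hv : v (.w .main) = c.var) (m : List Bool) :
    ∃ v' : Reg Alph, v' (.w .main) = ((next R)^[n] c).var ∧
      (clocked R entry).Steps n (simCfg { s with clk := List.replicate n true ++ m } v c)
        (simCfg { s with clk := m } v' ((next R)^[n] c)) := by
  induction n generalizing c v with
  | zero => exact ⟨v, hv, .refl _⟩
  | succ n ih =>
    obtain ⟨l | l, x, S⟩ := c
    · simp at hc
    simp only at hv
    subst hv
    obtain ⟨v', h₁, h₂⟩ := clocked_code_some_cons (R := R) (entry := entry) l true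
      (List.replicate n true ++ m) s v S
    rw [Function.iterate_succ_apply, next_some]
    cases n with
    | zero =>
      refine ⟨v', h₁, .head (F := clocked R entry) (some l) _ _ _ ?_⟩
      erw [h₂]
      exact .refl _
    | succ n =>
      obtain ⟨v'', h₃, h₄⟩ := ih (c := stepAux (R l) (v (.w .main)) S)
        (fun i hi => h (i + 1) (by omega)) (h 1 (by omega)) v' h₁
      refine ⟨v'', h₃, .head (F := clocked R entry) (some l) _ _ _ ?_⟩
      erw [h₂]
      exact h₄

/-- The effect of a run against a clock of a machine that halts after exactly `r` steps. -/
theorem runs_clocked {r : ℕ} {S : K' → List Γ'} (c : Cfg WorkAlph Λ (Option Γ'))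
    (hc : c = ⟨some entry, none, S⟩)
    (h : ∀ i < r, ((next R)^[i] c).l.isSome) (hr : ((next R)^[r] c).l = none) (s : St) (m : ℕ)
    (hs : s.clk = List.replicate m true) (hS : s.work = S) :
    (clocked R entry).Runs s.get (m + 2) (St.get { s with
      clk := List.replicate (m - r) true
      work := ((next R)^[m] c).stk
      flag := if r ≤ m then true :: s.flag else s.flag }) := by
  intro v
  have h₀ : stepAux ((clocked R entry).code none) v s.get =
      simCfg { s with clk := List.replicate m true } (Function.update v (.w .main) none) c := by
    subst hc
    rw [← hs, ← hS]
    rfl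
  have hci : c.l.isSome := by rw [hc]; rfl
  by_cases hrm : r ≤ m
  · obtain ⟨v', h₁, h₂⟩ := steps_clocked (R := R) (entry := entry) h hci s
      (Function.update v (.w .main) none) (by rw [hc]; simp) (List.replicate (m - r) true)
    rw [← List.replicate_add, Nat.add_sub_cancel' hrm] at h₂
    refine ⟨v', r + 1, by omega, .head (F := clocked R entry) none _ _ _ ?_⟩
    rw [h₀]
    have e : (next R)^[m] c = (next R)^[r] c := by
      conv_lhs => rw [← Nat.sub_add_cancel hrm, Function.iterate_add_apply]
      exact next_iterate_of_halted hr _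
    have e' : simCfg { s with clk := List.replicate (m - r) true } v' ((next R)^[r] c) =
        ⟨some none, v', St.get { s with
          clk := List.replicate (m - r) true
          work := ((next R)^[m] c).stk
          flag := if r ≤ m then true :: s.flag else s.flag }⟩ := by
      rw [simCfg, hr, if_pos hrm, e]
      rfl
    erw [← e']
    exact h₂
  · obtain ⟨v', h₁, h₂⟩ := steps_clocked (R := R) (entry := entry) (n := m)
      (fun i hi => h i (by omega)) hci s
      (Function.update v (.w .main) none) (by rw [hc]; simp) []
    rw [List.append_nil] at h₂
    have hl := h m (by omega)
    generalize (next R)^[m] c = d at h₂ hl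
    obtain ⟨l | l, x, S'⟩ := d
    · simp at hl
    refine ⟨Function.update v' .clk none, m + 2, le_rfl,
      .head (F := clocked R entry) none _ _ _ ?_⟩
    rw [h₀]
    refine h₂.trans (.head (F := clocked R entry) (some l) _ _ _ ?_)
    simp only [clocked, stepAux, Function.update_self, List.head?_nil, Option.isSome_none,
      St.get_clk, St.update_clk, List.tail_nil, cond_false, hrm, if_false,
      Nat.sub_eq_zero_of_le (Nat.le_of_not_le hrm), List.replicate_zero,
      Option.isSome_some, if_true]
    exact .refl _

end

/-! ### Extracting a clock and a binary number from a unary number -/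

/-- With `1 … 1` in the input stack, `n` ones say: leave `n / 2` ones in the buffer and the parity
of `n` in the stack `par`, where there is a `0` initially. -/
def halve : Frag Alph :=
  loop .inp fun _ => switch .inp fun o =>
    match o with
    | none => switch .par fun _ => push .par true
    | some _ => push .tmp true

theorem runs_halve (n : ℕ) : ∀ s : St, s.inp = List.replicate n true → s.par = [false] →
    halve.Runs s.get (2 * n + 4) (St.get { s with
      inp := [], par := [n.bodd], tmp := List.replicate (n / 2) true ++ s.tmp }) := by
  induction n using Nat.twoStepInduction with
  | zero =>
    intro s h h'
    exact (runs_loop_nil (Γ := Alph) (k := .inp) (S := s.get) h).congr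
      (by cases s; simp_all) (by omega)
  | one =>
    intro s h h'
    have h₁ := runs_push (Γ := Alph) .par true (St.get { s with inp := [], par := [] })
    have h₂ := runs_switch (Γ := Alph) (k := .par) (body := fun _ => push .par true)
      (S := St.get { s with inp := [] }) (by simpa [h'] using h₁)
    have h₃ := runs_switch (Γ := Alph) (k := .inp) (body := fun o => match o with
        | none => switch .par fun _ => push .par true
        | some _ => push .tmp true) (S := St.get { s with inp := [] }) (by simpa using h₂)
    have h₄ := runs_loop_cons (Γ := Alph) (k := .inp) (S := s.get) (a := true) (l := [])
      (body := fun _ => switch .inp fun o => match o with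
        | none => switch .par fun _ => push .par true
        | some _ => push .tmp true) (by simpa using h) (by simpa using h₃)
      (runs_loop_nil rfl)
    refine (Runs.mono h₄ (by omega))
  | more n ih _ =>
    intro s h h'
    have h₁ := runs_push (Γ := Alph) .tmp true (St.get { s with inp := List.replicate n true })
    have h₃ := runs_switch (Γ := Alph) (k := .inp) (body := fun o => match o with
        | none => switch .par fun _ => push .par true
        | some _ => push .tmp true) (S := St.get { s with inp := List.replicate (n + 1) true })
        (by simpa [List.replicate_succ] using h₁)
    have h₄ := runs_loop_cons (Γ := Alph) (k := .inp) (S := s.get) (a := true)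
      (l := List.replicate (n + 1) true)
      (body := fun _ => switch .inp fun o => match o with
        | none => switch .par fun _ => push .par true
        | some _ => push .tmp true) (by simpa [List.replicate_succ] using h) (by simpa using h₃)
      (ih { s with inp := List.replicate n true, tmp := true :: s.tmp } rfl h')
    have e : (n + 2) / 2 = n / 2 + 1 := by omega
    exact Runs.congr h₄ (by simp [e, List.replicate_succ', List.append_assoc]) (by omega)

/-- Halve the number in the input stack, which is one more than it seems. As long as the flag is
not raised, even numbers add one to the clock, and the first odd number raises the flag. From then
on, the parities go to the stack `bits`. -/
def halveStep : Frag Alph :=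
  (push .inp true).seq <| (push .par false).seq <| halve.seq <| (move .tmp .inp id).seq <|
    switch .par fun p => switch .flag fun f =>
      match f with
      | none => match p with
        | some true => push .flag true
        | _ => push .clk true
      | some _ => (push .flag true).seq (push .bits (p.getD false))

theorem runs_halveStep_aux (n : ℕ) (s : St) (hi : s.inp = List.replicate n true) (ht : s.tmp = [])
    (hp : s.par = []) {t : ℕ} {s' : St}
    (h : (switch .flag fun f =>
      match f with
      | none => match (some (n + 1).bodd : Option Bool) with
        | some true => push .flag true
        | _ => push .clk true
      | some _ => (push .flag true).seq (push .bits ((some (n + 1).bodd).getD false)) :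
        Frag Alph).Runs (St.get { s with inp := List.replicate ((n + 1) / 2) true }) t s'.get) :
    halveStep.Runs s.get (3 * n + t + 12) s'.get := by
  have h₁ := runs_push (Γ := Alph) .inp true s.get
  have h₂ := runs_push (Γ := Alph) .par false (St.get { s with inp := List.replicate (n + 1) true })
  have h₃ := runs_halve (n + 1)
    { s with inp := List.replicate (n + 1) true, par := [false] } rfl rfl
  have h₄ := runs_move (Γ := Alph) (show Stk.tmp ≠ .inp by simp) id (St.get { s with
      inp := [], par := [(n + 1).bodd], tmp := List.replicate ((n + 1) / 2) true ++ s.tmp })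
  have h₅ := runs_switch (Γ := Alph) (k := .par) (S := St.get { s with
      inp := List.replicate ((n + 1) / 2) true, par := [(n + 1).bodd] })
      (body := fun p => switch .flag fun f =>
      match f with
      | none => match p with
        | some true => push .flag true
        | _ => push .clk true
      | some _ => (push .flag true).seq (push .bits (p.getD false))) (t := t) (S' := s'.get)
      (by
        simp only [St.get_par, List.head?_cons, List.tail_cons, St.update_par]
        rw [← hp]
        exact h)
  refine Runs.mono ((h₁.congr ?_ le_rfl).seq ((h₂.congr ?_ le_rfl).seq (h₃.seq
    ((h₄.congr ?_ le_rfl).seq h₅)))) ?_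
  · simp [hi, List.replicate_succ]
  · simp [hp]
  · cases s
    simp_all
  · simp [ht]
    omega

theorem runs_halveStep_raised (n : ℕ) (s : St) (hi : s.inp = List.replicate n true)
    (ht : s.tmp = []) (hp : s.par = []) (hf : s.flag = [true]) :
    halveStep.Runs s.get (3 * n + 16) (St.get { s with
      inp := List.replicate ((n + 1) / 2) true, bits := (n + 1).bodd :: s.bits }) := by
  have h₁ := runs_push (Γ := Alph) .flag true
    (St.get { s with inp := List.replicate ((n + 1) / 2) true, flag := [] })
  have h₂ := runs_push (Γ := Alph) .bits (n + 1).bodd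
    (St.get { s with inp := List.replicate ((n + 1) / 2) true, flag := [true] })
  simp only [St.get_flag, St.update_flag] at h₁
  refine (runs_halveStep_aux n s hi ht hp (runs_switch (t := 2) ?_)).mono (by omega)
  simp only [St.get_flag, hf, List.head?_cons, List.tail_cons, St.update_flag, Option.getD_some]
  have := h₁.seq h₂
  simpa [← hf] using this

theorem runs_halveStep_odd (n : ℕ) (s : St) (hi : s.inp = List.replicate n true)
    (ht : s.tmp = []) (hp : s.par = []) (hf : s.flag = []) (hn : (n + 1).bodd = true) :
    halveStep.Runs s.get (3 * n + 16) (St.get { s with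
      inp := List.replicate ((n + 1) / 2) true, flag := [true] }) := by
  have h₁ := runs_push (Γ := Alph) .flag true
    (St.get { s with inp := List.replicate ((n + 1) / 2) true, flag := [] })
  simp only [St.get_flag, St.update_flag] at h₁
  refine (runs_halveStep_aux n s hi ht hp (runs_switch (t := 1) ?_)).mono (by omega)
  rw [hn]
  simp only [St.get_flag, hf, List.head?_nil, List.tail_nil, St.update_flag]
  exact h₁

theorem runs_halveStep_even (n : ℕ) (s : St) (hi : s.inp = List.replicate n true)
    (ht : s.tmp = []) (hp : s.par = []) (hf : s.flag = []) (hn : (n + 1).bodd = false) :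
    halveStep.Runs s.get (3 * n + 16) (St.get { s with
      inp := List.replicate ((n + 1) / 2) true, clk := true :: s.clk }) := by
  have h₁ := runs_push (Γ := Alph) .clk true
    (St.get { s with inp := List.replicate ((n + 1) / 2) true, flag := [] })
  simp only [St.get_clk, St.update_clk] at h₁
  refine (runs_halveStep_aux n s hi ht hp (runs_switch (t := 1) ?_)).mono (by omega)
  rw [hn]
  simp only [St.get_flag, hf, List.head?_nil, List.tail_nil, St.update_flag]
  simpa [← hf] using h₁

theorem bits_eq_bodd_cons {n : ℕ} (h : n ≠ 0) : n.bits = n.bodd :: (n / 2).bits := by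
  rw [← Nat.div2_val]
  conv_lhs => rw [← Nat.bit_bodd_div2 n]
  refine Nat.bits_append_bit _ _ fun h' => ?_
  have := Nat.bit_bodd_div2 n
  rw [h'] at this
  cases hb : n.bodd
  · rw [hb] at this
    exact absurd (by simpa using this.symm) h
  · rfl

/-- Take the number in the input stack apart: `2 ^ m * (2 * y + 1)` is turned into `m`, in unary
notation, and `y`, in binary notation. -/
def split : Frag Alph := loop .inp fun _ => halveStep

theorem runs_split_cons (n : ℕ) (s : St) (hi : s.inp = List.replicate (n + 1) true) {s' s'' : St}
    (h : halveStep.Runs (St.get { s with inp := List.replicate n true }) (3 * n + 16) s'.get)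
    {t : ℕ} (h' : split.Runs s'.get t s''.get) :
    split.Runs s.get (3 * n + 17 + t) s''.get := by
  have := runs_loop_cons (Γ := Alph) (k := .inp) (S := s.get) (a := true)
    (l := List.replicate n true) (body := fun _ => halveStep) hi (by simpa using h) h'
  exact this.mono (by omega)

theorem runs_split_raised (n : ℕ) : ∀ s : St, s.inp = List.replicate n true → s.tmp = [] →
    s.par = [] → s.flag = [true] →
    split.Runs s.get (40 * n + 1) (St.get { s with
      inp := [], bits := n.bits.reverse ++ s.bits }) := by
  induction n using Nat.strong_induction_on with
  | _ n ih =>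
    intro s hi ht hp hf
    cases n with
    | zero =>
      exact (runs_loop_nil (Γ := Alph) (k := .inp) (S := s.get) hi).congr
        (by cases s; simp_all) (by omega)
    | succ n =>
      have h₁ := runs_split_cons n s hi
        (runs_halveStep_raised n { s with inp := List.replicate n true } rfl ht hp hf)
        (ih ((n + 1) / 2) (by omega) _ rfl ht hp hf)
      refine h₁.congr ?_ (by omega)
      simp [bits_eq_bodd_cons n.succ_ne_zero]

theorem runs_split (m y : ℕ) : ∀ s : St, s.inp = List.replicate (2 ^ m * (2 * y + 1)) true →
    s.tmp = [] → s.par = [] → s.flag = [] →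
    split.Runs s.get (40 * (2 ^ m * (2 * y + 1)) + 1) (St.get { s with
      inp := [], flag := [true], clk := List.replicate m true ++ s.clk,
      bits := y.bits.reverse ++ s.bits }) := by
  induction m with
  | zero =>
    intro s hi ht hp hf
    have e : (2 * y + 1) / 2 = y := by omega
    have h₁ := runs_split_cons (2 * y) s (by simpa using hi)
      (runs_halveStep_odd (2 * y) { s with inp := List.replicate (2 * y) true } rfl ht hp hf
        (by simp)) (runs_split_raised ((2 * y + 1) / 2) _ rfl ht hp rfl)
    rw [e] at h₁
    exact h₁.congr (by simp) (by simp; omega)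
  | succ m ih =>
    intro s hi ht hp hf
    obtain ⟨k, hk⟩ : ∃ k, 2 ^ m * (2 * y + 1) = k + 1 :=
      ⟨_, (Nat.succ_pred_eq_of_pos (by positivity)).symm⟩
    have e : 2 ^ (m + 1) * (2 * y + 1) = 2 * k + 1 + 1 := by rw [pow_succ]; linarith
    have e' : (2 * k + 1 + 1) / 2 = 2 ^ m * (2 * y + 1) := by omega
    rw [e] at hi ⊢
    have h₁ := runs_split_cons (2 * k + 1) s hi
      (runs_halveStep_even (2 * k + 1) { s with inp := List.replicate (2 * k + 1) true } rfl ht hp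
        hf (by simp)) (ih _ (by rw [e']) ht hp hf)
    exact h₁.congr (by simp [List.replicate_succ']) (by omega)

/-! ### Printing a template that a partial recursive function has computed -/

/-- A binary digit on the work stacks. -/
def digit (b : Bool) : Γ' := if b then .bit1 else .bit0

/-- The binary code of an entry of a template. -/
def symCode : Option Bool → List Bool
  | none => [false]
  | some b => [true, b]

/-- A template as a binary string. The entries are listed backwards, as they are printed, and a
`1` marks the end, so that the last digit is `1`, as in the binary notation of a number. -/
def templateCode (t : List (Option Bool)) : List Bool := t.reverse.flatMap symCode ++ [true]

/-- Print the template that is written on the stack `main`. -/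
def printMain : Frag Alph :=
  loop (.w .main) fun a => match a with
    | .bit0 => printDay
    | .bit1 => switch (.w .main) fun o => match o with
      | some .bit0 => push .out false
      | some .bit1 => push .out true
      | _ => skip
    | _ => skip

/-- The contents of the work stacks, if only the first is not empty. -/
def mainOnly (l : List Γ') : K' → List Γ' := K'.elim l [] [] []

@[simp] theorem mainOnly_main (l : List Γ') : mainOnly l .main = l := rfl

@[simp] theorem update_mainOnly (l l' : List Γ') :
    Function.update (mainOnly l) .main l' = mainOnly l' := K'.elim_update_main

theorem runs_printMain (t : List (Option Bool)) (n : ℕ) : ∀ s : St,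
    s.day = List.replicate n true → s.tmp = [] →
    s.work = mainOnly ((t.flatMap symCode ++ [true]).map digit ++ [.cons]) →
    printMain.Runs s.get ((t.length + 1) * (5 * n + 4)) (St.get { s with
      work := mainOnly [], out := fill n t.reverse ++ s.out }) := by
  induction t with
  | nil =>
    intro s hd ht hw
    have h₁ := runs_skip (St.get { s with work := mainOnly [] })
    have h₂ := runs_switch (Γ := Alph) (k := .w .main) (body := fun o => match o with
      | some .bit0 => push .out false
      | some .bit1 => push .out true
      | _ => skip) (S := St.get { s with work := mainOnly [.cons] }) (t := 1)
      (S' := St.get { s with work := mainOnly [] }) (by simpa using h₁)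
    exact (runs_loop_cons (Γ := Alph) (k := .w .main) (S := s.get) (a := .bit1) (l := [.cons])
      (by rw [St.get_w, hw]; rfl) (by simpa [hw] using h₂)
      (runs_loop_nil (S := St.get { s with work := mainOnly [] }) rfl)).congr
        (by simp [fill_nil]) (by simp)
  | cons o t ih =>
    intro s hd ht hw
    cases o with
    | none =>
      have h₁ := runs_printDay n { s with work := mainOnly ((t.flatMap symCode ++ [true]).map digit
        ++ [.cons]) } hd ht
      exact (runs_loop_cons (Γ := Alph) (k := .w .main) (S := s.get) (a := .bit0)
        (l := (t.flatMap symCode ++ [true]).map digit ++ [.cons]) (by rw [St.get_w, hw]; rfl)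
        (by simpa [hw] using h₁) (ih { s with
          work := mainOnly ((t.flatMap symCode ++ [true]).map digit ++ [.cons])
          out := encodeUnary n ++ s.out } hd ht rfl)).congr
        (by simp [fill_append, fill_cons, fill_nil]) (by simp; ring_nf; omega)
    | some b =>
      have h₁ := runs_push .out b (St.get { s with
        work := mainOnly ((t.flatMap symCode ++ [true]).map digit ++ [.cons]) })
      have h₂ := runs_switch (Γ := Alph) (k := .w .main) (body := fun o => match o with
        | some .bit0 => push .out false
        | some .bit1 => push .out true
        | _ => skip) (S := St.get { s with
          work := mainOnly (digit b :: (t.flatMap symCode ++ [true]).map digit ++ [.cons]) })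
        (t := 1) (S' := St.get { s with
          work := mainOnly ((t.flatMap symCode ++ [true]).map digit ++ [.cons])
          out := b :: s.out })
        (by cases b <;> simpa [digit] using h₁)
      exact (runs_loop_cons (Γ := Alph) (k := .w .main) (S := s.get) (a := .bit1)
        (l := digit b :: (t.flatMap symCode ++ [true]).map digit ++ [.cons])
        (by rw [St.get_w, hw]; rfl)
        (by simpa [hw] using h₂) (ih { s with
          work := mainOnly ((t.flatMap symCode ++ [true]).map digit ++ [.cons])
          out := b :: s.out } hd ht rfl)).congr
        (by simp [fill_append, fill_cons, fill_nil]) (by simp; ring_nf; omega)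

/-- Empty all stacks but the output. -/
def cleanUp : Frag Alph :=
  (clear .day).seq <| (clear .clk).seq <| (clear (.w .main)).seq <| (clear (.w .rev)).seq <|
    (clear (.w .aux)).seq <| clear (.w .stack)

theorem runs_cleanUp (s : St) (B : ℕ) (hi : s.inp = []) (ht : s.tmp = []) (hp : s.par = [])
    (hf : s.flag = []) (hb : s.bits = []) (hd : s.day.length ≤ B) (hc : s.clk.length ≤ B)
    (hw : ∀ k, (s.work k).length ≤ B) :
    cleanUp.Runs s.get (12 * B + 6) (St.get { out := s.out }) := by
  have h₁ := runs_clear .day s.get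
  have h₂ := runs_clear .clk (St.get { s with day := [] })
  have h₃ := runs_clear (.w .main) (St.get { s with day := [], clk := [] })
  have h₄ := runs_clear (.w .rev) (St.get { s with
    day := [], clk := [], work := Function.update s.work .main [] })
  have h₅ := runs_clear (.w .aux) (St.get { s with
    day := [], clk := [], work := Function.update (Function.update s.work .main []) .rev [] })
  have h₆ := runs_clear (.w .stack) (St.get { s with
    day := [], clk := []
    work := Function.update (Function.update (Function.update s.work .main []) .rev []) .aux [] })
  simp only [St.update_day, St.update_clk, St.update_w] at h₁ h₂ h₃ h₄ h₅ h₆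
  refine Runs.congr (h₁.seq (h₂.seq (h₃.seq (h₄.seq (h₅.seq h₆))))) ?_ ?_
  · congr 1
    cases s
    simp only at hi ht hp hf hb
    subst hi ht hp hf hb
    simp only [St.mk.injEq, true_and]
    funext k
    cases k <;> rfl
  · have := hw .main
    have := hw .rev
    have := hw .aux
    have := hw .stack
    simp
    omega

theorem trNat_eq_bits (n : ℕ) : trNat n = n.bits.map digit := by
  induction n using Nat.strong_induction_on with
  | _ n ih =>
    rcases eq_or_ne n 0 with rfl | hn
    · rfl
    have h := ih (n / 2) (by omega)
    rw [bits_eq_bodd_cons hn, List.map_cons, ← h]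
    have e : (n : Num) = cond n.bodd (Num.bit1 (n / 2 : ℕ)) (Num.bit0 (n / 2 : ℕ)) := by
      rw [← Num.ofNat'_eq, ← Num.ofNat'_eq, ← Nat.div2_val]
      conv_lhs => rw [← Nat.bit_bodd_div2 n, Num.ofNat'_bit]
      cases n.bodd <;> rfl
    simp only [trNat, e]
    cases hb : n.bodd with
    | true => cases ((n / 2 : ℕ) : Num) <;> rfl
    | false =>
      have h₂ : n / 2 ≠ 0 := by
        intro h₂
        obtain rfl : n = 1 := by omega
        simp at hb
      have h₃ : ((n / 2 : ℕ) : Num) ≠ 0 := by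
        intro h₃
        apply h₂
        have := congrArg (fun m : Num => (m : ℕ)) h₃
        simpa using this
      cases hm : ((n / 2 : ℕ) : Num) with
      | zero => exact absurd hm h₃
      | pos p => rfl

/-! ### Waiting until a computation has finished -/

/-- Copy the input to the stack `day`. -/
def copyInput : Frag Alph :=
  (loop .inp fun _ => (push .day true).seq (push .tmp true)).seq (move .tmp .inp id)

theorem runs_copyInput (n : ℕ) :
    copyInput.Runs (St.get { inp := List.replicate n true }) (5 * n + 2)
      (St.get { inp := List.replicate n true, day := List.replicate n true }) := by
  have h : ∀ (n : ℕ) (s : St), s.inp = List.replicate n true →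
      (loop .inp fun _ => (push .day true).seq (push .tmp true) : Frag Alph).Runs s.get (3 * n + 1)
        (St.get { s with inp := [], day := List.replicate n true ++ s.day,
                         tmp := List.replicate n true ++ s.tmp }) := by
    intro n
    induction n with
    | zero =>
      intro s hi
      exact (runs_loop_nil (Γ := Alph) (k := .inp) (S := s.get) hi).congr
        (by cases s; simp_all) (by omega)
    | succ n ih =>
      intro s hi
      exact (runs_loop_cons (Γ := Alph) (k := .inp) (S := s.get) hi
        ((runs_push _ _ _).seq (runs_push _ _ _))
        (by simpa using ih { s with inp := List.replicate n true, day := true :: s.day,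
                                    tmp := true :: s.tmp } rfl)).congr
        (by simp [List.replicate_succ']) (by omega)
  have h₁ := h n { inp := List.replicate n true } rfl
  have h₂ := runs_move (Γ := Alph) (show Stk.tmp ≠ .inp by simp) id
    (St.get { day := List.replicate n true, tmp := List.replicate n true })
  simp only [List.append_nil] at h₁
  exact (h₁.seq h₂).congr (by simp) (by simp; omega)

/-- Print the two digits that stand for the strategy without trades. -/
def printEmpty : Frag Alph := pushWord .out [false, false]

/-- On the day `2 ^ m * (2 * y + 1)`, run the machine for the code `c` with the input `[e, y]`
against a clock showing `m`. If it halts just when the clock runs out, print the template that it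
has computed. -/
def delayed (c : Code) (e : ℕ) : Frag Alph :=
  copyInput.seq <| split.seq <| (clear .flag).seq <| (push (.w .main) .cons).seq <|
    (move .bits (.w .main) digit).seq <| (pushWord (.w .main) (trNat e ++ [.cons])).seq <|
    (clocked (codeMachine c) (codeEntry c)).seq <|
    (switch .flag fun o => match o with
      | none => printEmpty
      | some _ => switch .clk fun o => match o with
        | none => printMain
        | some _ => printEmpty).seq cleanUp

theorem runs_printEmpty (s : St) :
    printEmpty.Runs s.get 3 (St.get { s with out := [false, false] ++ s.out }) := by
  have := runs_pushWord (Γ := Alph) .out [false, false] s.get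
  exact this.congr (by simp) (by simp)

theorem length_bits_le (n : ℕ) : n.bits.length ≤ n := by
  rw [Nat.size_eq_bits_len]
  exact Nat.size_le.2 Nat.lt_two_pow_self

/-- The number of symbols on the first work stack when the clock has run out on day `n`. -/
def workBound (c : Code) (e n : ℕ) : ℕ :=
  (trNat e).length + 2 + n * (1 + ∑ l, growth (codeMachine c l))

section

variable {c : Code} {e : ℕ} {g : ℕ → List (Option Bool)} {r : ℕ → ℕ}

theorem runs_delayed_tail
    (hr : ∀ y, ∀ i < r y, ((next (codeMachine c))^[i] (codeInit c [e, y])).l.isSome)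
    (hr' : ∀ y, (next (codeMachine c))^[r y] (codeInit c [e, y]) =
      ⟨none, none, mainOnly ((templateCode (g y)).map digit ++ [.cons])⟩)
    {n m y : ℕ} (hm : m ≤ n) (hy : y ≤ n) :
    ((clocked (codeMachine c) (codeEntry c)).seq <|
      (switch .flag fun o => match o with
        | none => printEmpty
        | some _ => switch .clk fun o => match o with
          | none => printMain
          | some _ => printEmpty).seq cleanUp).Runs
      (St.get { day := List.replicate n true, clk := List.replicate m true,
                work := mainOnly (trList [e, y]) })
      (n + 2 + ((workBound c e n + 1) * (5 * n + 4) + 5) + (12 * workBound c e n + 6))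
      (St.get { out := if m = r y then fill n (g y) else [false, false] }) := by
  have hn : n ≤ workBound c e n := by
    unfold workBound
    nlinarith [Nat.zero_le (n * ∑ l, growth (codeMachine c l))]
  have hc := runs_clocked (codeInit c [e, y]) rfl (hr y) (by rw [hr' y])
    { day := List.replicate n true, clk := List.replicate m true,
      work := mainOnly (trList [e, y]) } m rfl rfl
  have hlen : ∀ k, (((next (codeMachine c))^[m] (codeInit c [e, y])).stk k).length ≤
      workBound c e n := by
    intro k
    refine (length_next_iterate_le _ _ k m).trans ?_
    have h₁ : ((codeInit c [e, y]).stk k).length ≤ (trNat e).length + 2 + n := by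
      have := length_bits_le y
      cases k <;> (simp [codeInit, trNat_eq_bits]; try omega)
    have h₂ : m * ∑ l, growth (codeMachine c l) ≤ n * ∑ l, growth (codeMachine c l) :=
      Nat.mul_le_mul_right _ hm
    unfold workBound
    rw [mul_add]
    omega
  generalize hd : (next (codeMachine c))^[m] (codeInit c [e, y]) = d at hc hlen
  -- The clean-up after the output `[false, false]`.
  have hclean : ∀ o k, k ≤ n → cleanUp.Runs
      (St.get { day := List.replicate n true, clk := List.replicate k true, work := d.stk,
                out := o }) (12 * workBound c e n + 6) (St.get { out := o }) := fun o k hk =>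
    runs_cleanUp { day := List.replicate n true, clk := List.replicate k true, work := d.stk,
                   out := o } _ rfl rfl rfl rfl rfl (by simpa using hn)
      (by simpa using hk.trans hn) hlen
  have hsum : ∀ t, t ≤ (workBound c e n + 1) * (5 * n + 4) + 5 →
      m + 2 + (t + (12 * workBound c e n + 6)) ≤
        n + 2 + ((workBound c e n + 1) * (5 * n + 4) + 5) + (12 * workBound c e n + 6) := by
    intro t ht
    omega
  by_cases hrm : r y ≤ m
  · rw [if_pos hrm] at hc
    by_cases hmr : m = r y
    · subst hmr
      rw [if_pos rfl]
      have hdw : d.stk = mainOnly ((templateCode (g y)).map digit ++ [.cons]) := by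
        rw [← hd, hr' y]
      have hg : (g y).length ≤ workBound c e n := by
        refine le_trans ?_ (hlen .main)
        rw [hdw, templateCode]
        simp only [mainOnly_main, List.length_append, List.length_map, List.length_flatMap]
        have : ∀ t : List (Option Bool),
            t.length ≤ (t.map fun o => (symCode o).length).sum := by
          intro t
          induction t with
          | nil => simp
          | cons o t ih =>
            rw [List.map_cons, List.sum_cons, List.length_cons]
            cases o <;> simp only [symCode, List.length_cons, List.length_nil] at ih ⊢ <;> omega
        have := this (g y).reverse
        rw [List.length_reverse] at this
        omega
      have hp := runs_printMain (g y).reverse n { day := List.replicate n true, work := d.stk }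
        rfl rfl (by rw [hdw, templateCode])
      simp only [List.reverse_reverse, List.append_nil] at hp
      have h₁ := runs_switch (Γ := Alph) (k := .clk) (body := fun o => match o with
          | none => printMain
          | some _ => printEmpty) (S := St.get { day := List.replicate n true, work := d.stk })
        (by simpa using hp)
      have h₂ := runs_switch (Γ := Alph) (k := .flag) (body := fun o => match o with
        | none => printEmpty
        | some _ => switch .clk fun o => match o with
          | none => printMain
          | some _ => printEmpty)
        (S := St.get { day := List.replicate n true, work := d.stk, flag := [true] })
        (by simpa using h₁)
      have h₃ := runs_cleanUp
        { day := List.replicate n true, work := mainOnly [], out := fill n (g y) }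
        (workBound c e n) rfl rfl rfl rfl rfl (by simpa using hn)
        (by simp) (by intro k; cases k <;> simp [mainOnly])
      rw [Nat.sub_self] at hc
      refine Runs.congr (hc.seq ((h₂.congr ?_ le_rfl).seq h₃)) rfl (hsum _ ?_)
      · simp
      · have := Nat.mul_le_mul_right (5 * n + 4) (Nat.succ_le_succ hg)
        simp only [Nat.succ_eq_add_one] at this
        omega
    · rw [if_neg hmr]
      obtain ⟨k, hk⟩ : ∃ k, m - r y = k + 1 := ⟨m - r y - 1, by omega⟩
      rw [hk] at hc
      have h₀ := runs_printEmpty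
        { day := List.replicate n true, clk := List.replicate k true, work := d.stk }
      have h₁ := runs_switch (Γ := Alph) (k := .clk) (body := fun o => match o with
          | none => printMain
          | some _ => printEmpty)
        (S := St.get { day := List.replicate n true, clk := List.replicate (k + 1) true,
                       work := d.stk }) (by simpa [List.replicate_succ] using h₀)
      have h₂ := runs_switch (Γ := Alph) (k := .flag) (body := fun o => match o with
        | none => printEmpty
        | some _ => switch .clk fun o => match o with
          | none => printMain
          | some _ => printEmpty)
        (S := St.get { day := List.replicate n true, clk := List.replicate (k + 1) true,
                       work := d.stk, flag := [true] })
        (by simpa using h₁)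
      exact Runs.congr (hc.seq (h₂.seq (hclean _ k (by omega)))) rfl (hsum _ (by omega))
  · have hmr : m ≠ r y := by omega
    rw [if_neg hmr]
    rw [if_neg hrm] at hc
    have h₀ := runs_printEmpty
      { day := List.replicate n true, clk := List.replicate (m - r y) true, work := d.stk }
    have h₂ := runs_switch (Γ := Alph) (k := .flag) (body := fun o => match o with
        | none => printEmpty
        | some _ => switch .clk fun o => match o with
          | none => printMain
          | some _ => printEmpty)
        (S := St.get { day := List.replicate n true, clk := List.replicate (m - r y) true,
                       work := d.stk })
        (by simpa using h₀)
    exact Runs.congr (hc.seq (h₂.seq (hclean _ (m - r y) (by omega)))) rfl (hsum _ (by omega))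

/-- The output of a machine for a total function, delayed to a day that reveals its running
time, is efficiently computable. -/
theorem efficientlyComputable_of_codeMachine
    (hr : ∀ y, ∀ i < r y, ((next (codeMachine c))^[i] (codeInit c [e, y])).l.isSome)
    (hr' : ∀ y, (next (codeMachine c))^[r y] (codeInit c [e, y]) =
      ⟨none, none, mainOnly ((templateCode (g y)).map digit ++ [.cons])⟩)
    (x : ℕ → List Bool) (hx₀ : x 0 = [false, false])
    (hx : ∀ m y, x (2 ^ m * (2 * y + 1)) =
      if m = r y then fill (2 ^ m * (2 * y + 1)) (g y) else [false, false]) :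
    EfficientlyComputable x := by
  let W : Polynomial ℕ := .C ((trNat e).length + 2) +
    .X * .C (1 + ∑ l, growth (codeMachine c l))
  let p : Polynomial ℕ := (5 * .X + 2) + (40 * .X + 1) + 4 + (2 * .X + 1) +
    .C ((trNat e).length + 2) + (.X + 2 + ((W + 1) * (5 * .X + 4) + 5) + (12 * W + 6))
  refine efficientlyComputable_of_runs (delayed c e) x p fun n => ?_
  have hp : p.eval n = (5 * n + 2) + (40 * n + 1) + 4 + (2 * n + 1) + ((trNat e).length + 2) +
      (n + 2 + ((workBound c e n + 1) * (5 * n + 4) + 5) + (12 * workBound c e n + 6)) := by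
    have hW : W.eval n = workBound c e n := by
      simp only [W, workBound, Polynomial.eval_add, Polynomial.eval_C, Polynomial.eval_mul,
        Polynomial.eval_X]
    clear_value W
    simp [p, hW]
  -- For `n = 0` the clock shows `0`, when no machine has halted yet.
  obtain ⟨m, y, f, hm, hy, hf, hxn, hs⟩ : ∃ m y f, m ≤ n ∧ y ≤ n ∧ List.length f ≤ 1 ∧
      x n = (if m = r y then fill n (g y) else [false, false]) ∧
      split.Runs (St.get { inp := List.replicate n true, day := List.replicate n true })
        (40 * n + 1) (St.get { day := List.replicate n true, clk := List.replicate m true,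
                               bits := y.bits.reverse, flag := f }) := by
    rcases eq_or_ne n 0 with rfl | hn
    · refine ⟨0, 0, [], le_rfl, le_rfl, by simp, ?_, ?_⟩
      · have : r 0 ≠ 0 := by
          intro h
          have := hr' 0
          rw [h] at this
          exact absurd (congrArg Cfg.l this) (by simp [codeInit])
        rw [hx₀, if_neg this.symm]
      · exact runs_loop_nil (Γ := Alph) rfl
    · obtain ⟨m, k, hk, rfl⟩ := Nat.exists_eq_two_pow_mul_odd hn
      obtain ⟨y, rfl⟩ := hk
      have hpos : 1 ≤ 2 ^ m := Nat.one_le_two_pow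
      have hlt : m < 2 ^ m := Nat.lt_two_pow_self
      refine ⟨m, y, [true], by nlinarith, by nlinarith, by simp, hx m y, ?_⟩
      simpa using runs_split m y
        { inp := List.replicate (2 ^ m * (2 * y + 1)) true
          day := List.replicate (2 ^ m * (2 * y + 1)) true } rfl rfl rfl rfl
  have h₁ := runs_clear .flag (St.get
    { day := List.replicate n true, clk := List.replicate m true, bits := y.bits.reverse,
      flag := f })
  have h₂ := runs_push (.w .main) .cons (St.get
    { day := List.replicate n true, clk := List.replicate m true, bits := y.bits.reverse })
  have h₃ := runs_move (Γ := Alph) (show Stk.bits ≠ .w .main by simp) digit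
    (St.get { day := List.replicate n true, clk := List.replicate m true,
              bits := y.bits.reverse, work := mainOnly [.cons] })
  have h₄ := runs_pushWord (Γ := Alph) (.w .main) (trNat e ++ [.cons])
    (St.get { day := List.replicate n true, clk := List.replicate m true,
              work := mainOnly (trNat y ++ [.cons]) })
  have h₅ := runs_delayed_tail hr hr' hm hy
  have e₀ : (fun _ => [] : K' → List Γ') = mainOnly [] := by funext k; cases k <;> rfl
  rw [hp, hxn]
  refine Runs.congr ((runs_copyInput n).seq (hs.seq ((h₁.congr ?_ le_rfl).seq
    ((h₂.congr ?_ le_rfl).seq ((h₃.congr ?_ le_rfl).seq ((h₄.congr ?_ le_rfl).seq h₅)))))) rfl ?_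
  · simp
  · simp [e₀]
  · simp [trNat_eq_bits]
  · simp
  · have := length_bits_le y
    simp
    omega

end

/-! ### The running time of a machine is a partial recursive function -/

section Primrec

variable {α β γ : Type} [Primcodable α] [Primcodable β] [Primcodable γ]

/-- Finitely many primitive recursive functions can be combined by a case distinction. -/
theorem primrec₂_of_finite [Finite α] {f : α → β → γ} (h : ∀ a, Primrec (f a)) : Primrec₂ f := by
  classical
  have : Fintype α := .ofFinite α
  have key : ∀ l : List α, ∃ g : α × β → Option γ, Primrec g ∧
      ∀ a ∈ l, ∀ b, g (a, b) = some (f a b) := by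
    intro l
    induction l with
    | nil => exact ⟨fun _ => none, .const _, by simp⟩
    | cons a₀ l ih =>
      obtain ⟨g, hg, hl⟩ := ih
      refine ⟨fun p => if p.1 = a₀ then some (f a₀ p.2) else g p,
        .ite (Primrec.eq.comp .fst (.const a₀)) (Primrec.option_some.comp ((h a₀).comp .snd))
          hg, ?_⟩
      intro a ha b
      by_cases e : a = a₀
      · simp [e]
      · simp [e, hl a (by simpa [e] using ha) b]
  obtain ⟨g, hg, hl⟩ := key Finset.univ.toList
  refine Primrec.option_some_iff.1 (hg.of_eq fun p => ?_)
  exact hl p.1 (by simp) p.2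

end Primrec

noncomputable instance : Primcodable Γ' := .ofEquiv _ (Fintype.equivFin Γ')

noncomputable instance (c : Code) : Primcodable (CodeLabel c) := .ofEquiv _ (Fintype.equivFin _)

/-- The contents of the four work stacks as a quadruple. -/
def stacksEquiv : (K' → List Γ') ≃ List Γ' × List Γ' × List Γ' × List Γ' where
  toFun S := (S .main, S .rev, S .aux, S .stack)
  invFun t := K'.elim t.1 t.2.1 t.2.2.1 t.2.2.2
  left_inv S := by funext k; cases k <;> rfl
  right_inv _ := rfl

noncomputable instance : Primcodable (K' → List Γ') := .ofEquiv _ stacksEquiv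

/-- Configurations as triples. -/
def cfgEquiv (Λ : Type) :
    Cfg WorkAlph Λ (Option Γ') ≃ Option Λ × Option Γ' × (K' → List Γ') where
  toFun c := (c.l, c.var, c.stk)
  invFun t := ⟨t.1, t.2.1, t.2.2⟩
  left_inv _ := rfl
  right_inv _ := rfl

noncomputable instance (Λ : Type) [Primcodable Λ] : Primcodable (Cfg WorkAlph Λ (Option Γ')) :=
  .ofEquiv _ (cfgEquiv Λ)

theorem primrec_stacksEquiv_symm : Primrec stacksEquiv.symm := Primrec.of_equiv_symm

theorem primrec_stack (k : K') : Primrec fun S : K' → List Γ' => S k := by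
  have h : Primrec stacksEquiv := Primrec.of_equiv
  cases k with
  | main => exact Primrec.fst.comp h
  | rev => exact Primrec.fst.comp (Primrec.snd.comp h)
  | aux => exact Primrec.fst.comp (Primrec.snd.comp (Primrec.snd.comp h))
  | stack => exact Primrec.snd.comp (Primrec.snd.comp (Primrec.snd.comp h))

theorem primrec_elim {α : Type} [Primcodable α] {f₁ f₂ f₃ f₄ : α → List Γ'} (h₁ : Primrec f₁)
    (h₂ : Primrec f₂) (h₃ : Primrec f₃) (h₄ : Primrec f₄) :
    Primrec fun a => K'.elim (f₁ a) (f₂ a) (f₃ a) (f₄ a) :=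
  primrec_stacksEquiv_symm.comp (h₁.pair (h₂.pair (h₃.pair h₄)))

theorem primrec_update (k : K') :
    Primrec₂ fun (S : K' → List Γ') (l : List Γ') => Function.update S k l := by
  have h : ∀ k', Primrec fun p : (K' → List Γ') × List Γ' => p.1 k' := fun k' =>
    (primrec_stack k').comp .fst
  have e : ∀ k' : K', Primrec fun p : (K' → List Γ') × List Γ' =>
      Function.update p.1 k p.2 k' := by
    intro k'
    by_cases hk : k' = k
    · subst hk
      simpa using Primrec.snd
    · simpa [hk] using h k'
  refine (primrec_elim (e .main) (e .rev) (e .aux) (e .stack)).of_eq fun p => ?_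
  funext k'
  cases k' <;> rfl

section

variable {Λ : Type} [Primcodable Λ]

theorem primrec_cfg_mk {α : Type} [Primcodable α] {f₁ : α → Option Λ} {f₂ : α → Option Γ'}
    {f₃ : α → K' → List Γ'} (h₁ : Primrec f₁) (h₂ : Primrec f₂) (h₃ : Primrec f₃) :
    Primrec fun a => (⟨f₁ a, f₂ a, f₃ a⟩ : Cfg WorkAlph Λ (Option Γ')) := by
  have h : Primrec (cfgEquiv Λ).symm := Primrec.of_equiv_symm
  exact h.comp (h₁.pair (h₂.pair h₃))

theorem primrec_stepAux [Finite Λ] (q : Stmt WorkAlph Λ (Option Γ')) :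
    Primrec₂ fun (v : Option Γ') (S : K' → List Γ') => stepAux q v S := by
  have hd : ∀ {α β : Type} [Primcodable α] [Finite α] [Primcodable β] (f : α → β), Primrec f :=
    fun f => .dom_finite f
  induction q with
  | push k f q ih =>
    exact ih.comp .fst ((primrec_update k).comp .snd
      (Primrec.list_cons.comp ((hd f).comp .fst) ((primrec_stack k).comp .snd)))
  | peek k f q ih =>
    have h : Primrec fun p : Option Γ' × Option Γ' => f p.1 p.2 := hd _
    exact ih.comp (h.comp (Primrec.pair .fst (Primrec.list_head?.comp
      ((primrec_stack k).comp .snd)))) .snd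
  | pop k f q ih =>
    have h : Primrec fun p : Option Γ' × Option Γ' => f p.1 p.2 := hd _
    exact ih.comp (h.comp (Primrec.pair .fst (Primrec.list_head?.comp
      ((primrec_stack k).comp .snd)))) ((primrec_update k).comp .snd
      (Primrec.list_tail.comp ((primrec_stack k).comp .snd)))
  | load f q ih => exact ih.comp ((hd f).comp .fst) .snd
  | branch f q₁ q₂ h₁ h₂ => exact Primrec.cond ((hd f).comp .fst) h₁ h₂
  | goto l => exact primrec_cfg_mk (Primrec.option_some.comp ((hd l).comp .fst)) .fst .snd
  | halt => exact primrec_cfg_mk (.const _) .fst .snd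

theorem primrec_cfg_l : Primrec fun c : Cfg WorkAlph Λ (Option Γ') => c.l := by
  have h : Primrec (cfgEquiv Λ) := Primrec.of_equiv
  exact Primrec.fst.comp h

theorem primrec_next [Finite Λ] (R : Λ → Stmt WorkAlph Λ (Option Γ')) : Primrec (next R) := by
  have h : Primrec (cfgEquiv Λ) := Primrec.of_equiv
  have h₁ : Primrec₂ fun (l : Λ) (p : Option Γ' × (K' → List Γ')) => stepAux (R l) p.1 p.2 :=
    primrec₂_of_finite fun l => primrec_stepAux (R l)
  refine (Primrec.option_casesOn primrec_cfg_l Primrec.id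
    (h₁.comp .snd ((Primrec.snd.comp h).comp .fst)).to₂).of_eq fun c => ?_
  obtain ⟨l | l, v, S⟩ := c <;> rfl

end

theorem primrec_bits : Primrec Nat.bits := by
  have h : Primrec₂ fun (_ : Unit) (n : ℕ) => n.bits := by
    refine Primrec.nat_strong_rec _ (g := fun _ l => if l.length = 0 then some [] else
      (l[l.length / 2]?).map fun t => l.length.bodd :: t) ?_ ?_
    · refine Primrec.ite (Primrec.eq.comp (Primrec.list_length.comp .snd) (.const 0))
        (.const (some [])) ?_
      refine Primrec.option_map (Primrec.list_getElem?.comp .snd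
        (Primrec.nat_div.comp (Primrec.list_length.comp .snd) (.const 2))) ?_
      exact (Primrec.list_cons.comp (Primrec.nat_bodd.comp
        (Primrec.list_length.comp (Primrec.snd.comp .fst))) .snd).to₂
    · intro _ n
      rcases eq_or_ne n 0 with rfl | hn
      · simp
      · have : n / 2 < n := by omega
        simp [hn, this, bits_eq_bodd_cons hn]
  exact h.comp (.const ()) .id

theorem primrec_trList_pair : Primrec₂ fun e y : ℕ => trList [e, y] := by
  have h : Primrec trNat := by
    refine (Primrec.list_map primrec_bits
      ((Primrec.dom_finite digit).comp .snd).to₂).of_eq fun n => ?_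
    exact (trNat_eq_bits n).symm
  refine (Primrec.list_append.comp (h.comp .fst) (Primrec.list_cons.comp (.const .cons)
    (Primrec.list_append.comp (h.comp .snd) (.const [.cons])))).of_eq fun p => ?_
  simp [trList]

theorem primrec_codeInit (c : Code) : Primrec₂ fun e y : ℕ => codeInit c [e, y] :=
  primrec_cfg_mk (.const _) (.const _)
    (primrec_elim primrec_trList_pair (.const _) (.const _) (.const _))

/-- The number of steps that the machine for the code `c` makes on the input `[e, y]`. -/
noncomputable def runtime (c : Code) (e y : ℕ) : Part ℕ :=
  Nat.rfind (fun n => Part.some ((next (codeMachine c))^[n] (codeInit c [e, y])).l.isNone :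
    ℕ →. Bool)

theorem partrec_runtime (c : Code) : Partrec₂ (runtime c) := by
  have h₀ : Primrec (Option.isNone : Option (CodeLabel c) → Bool) := Primrec.dom_finite _
  have h : Primrec₂ fun (p : ℕ × ℕ) (n : ℕ) =>
      ((next (codeMachine c))^[n] (codeInit c [p.1, p.2])).l.isNone :=
    h₀.comp (primrec_cfg_l.comp (Primrec.nat_iterate .snd
      ((primrec_codeInit c).comp (Primrec.fst.comp .fst) (Primrec.snd.comp .fst))
      ((primrec_next (codeMachine c)).comp .snd).to₂))
  exact Partrec.rfind h.to_comp.partrec₂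

theorem mem_runtime {c : Code} {e y n : ℕ} : n ∈ runtime c e y ↔
    ((next (codeMachine c))^[n] (codeInit c [e, y])).l = none ∧
      ∀ i < n, ((next (codeMachine c))^[i] (codeInit c [e, y])).l.isSome := by
  refine Nat.mem_rfind.trans (and_congr ?_ (forall_congr' fun i => forall_congr' fun _ => ?_))
  · simp
  · cases ((next (codeMachine c))^[i] (codeInit c [e, y])).l <;> simp

/-! ### Strategies that are revealed late enough to be efficiently computable -/

/-- The number whose binary notation is the code of a template. -/
def templateNum (t : List (Option Bool)) : ℕ := (templateCode t).foldr Nat.bit 0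

theorem bits_templateNum (t : List (Option Bool)) : (templateNum t).bits = templateCode t := by
  have h : ∀ l : List Bool, ((l ++ [true]).foldr Nat.bit 0).bits = l ++ [true] ∧
      (l ++ [true]).foldr Nat.bit 0 ≠ 0 := by
    intro l
    induction l with
    | nil => simp
    | cons b l ih =>
      rw [List.cons_append, List.foldr_cons, Nat.bits_append_bit _ _ fun h => absurd h ih.2, ih.1]
      exact ⟨rfl, Nat.bit_ne_zero _ ih.2⟩
  exact (h _).1

theorem primrec_templateNum : Primrec templateNum := by
  have h₁ : Primrec symCode := .dom_finite _
  have h₂ : Primrec templateCode := Primrec.list_append.comp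
    (Primrec.list_flatMap .list_reverse (h₁.comp .snd).to₂) (.const [true])
  have h₃ : Primrec₂ Nat.bit := by
    refine (Primrec.cond .fst (Primrec.succ.comp (Primrec.nat_mul.comp (.const 2) .snd))
      (Primrec.nat_mul.comp (.const 2) .snd)).of_eq fun p => ?_
    obtain ⟨b, n⟩ := p
    cases b <;> simp [Nat.bit_val]
  exact Primrec.list_foldr h₂ (.const 0)
    (h₃.comp (Primrec.fst.comp .snd) (Primrec.snd.comp .snd)).to₂

/-- The day on which a strategy is revealed that has the index `y` and takes time `s` to compute. -/
def revealDay (s y : ℕ) : ℕ := 2 ^ s * (2 * y + 1)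

theorem lt_revealDay (s y : ℕ) : y < revealDay s y := by
  have : 1 ≤ 2 ^ s := Nat.one_le_two_pow
  unfold revealDay
  nlinarith

theorem revealDay_inj {s y s' y' : ℕ} (h : revealDay s y = revealDay s' y') : s = s' ∧ y = y' := by
  unfold revealDay at h
  induction s generalizing s' with
  | zero =>
    cases s' with
    | zero => simp at h; omega
    | succ s' => rw [pow_succ'] at h; simp only [pow_zero, mul_assoc] at h; omega
  | succ s ih =>
    cases s' with
    | zero => rw [pow_succ'] at h; simp only [pow_zero, mul_assoc] at h; omega
    | succ s' =>
      have := ih (s' := s') (by rw [pow_succ', pow_succ', mul_assoc, mul_assoc] at h; omega)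
      omega

theorem primrec_revealDay : Primrec₂ revealDay := by
  have h : Primrec₂ fun s y : ℕ => (fun n => 2 * n)^[s] (2 * y + 1) :=
    Primrec.nat_iterate .fst (Primrec.succ.comp (Primrec.nat_mul.comp (.const 2) .snd))
      (Primrec.nat_mul.comp (.const 2) .snd).to₂
  refine h.of_eq fun s y => ?_
  induction s with
  | zero => simp [revealDay]
  | succ s ih => rw [Function.iterate_succ_apply', ih, revealDay, revealDay]; ring

section Chain

variable {d : ℕ → ℕ}

/-- The chain `0, d 0, d (d 0), …` as it is found by a search, the latest element first. The search
stops at the first element that is at least `y`. -/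
def searchChain (d : ℕ → ℕ) (y : ℕ) : ℕ → List ℕ
  | 0 => [0]
  | j + 1 => if (searchChain d y j).headI < y then
      d (searchChain d y j).headI :: searchChain d y j else searchChain d y j

/-- The elements `d^[i] 0, …, d 0, 0` of the chain. -/
def chain (d : ℕ → ℕ) (i : ℕ) : List ℕ := ((List.range (i + 1)).map fun j => d^[j] 0).reverse

theorem chain_succ (i : ℕ) : chain d (i + 1) = d^[i + 1] 0 :: chain d i := by
  rw [chain, List.range_succ]
  simp [chain]

theorem headI_chain (i : ℕ) : (chain d i).headI = d^[i] 0 := by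
  cases i with
  | zero => simp [chain]
  | succ i => rw [chain_succ]; rfl

theorem tail_reverse_chain (i : ℕ) :
    (chain d i).reverse.tail = (List.range i).map fun j => d^[j + 1] 0 := by
  rw [chain, List.reverse_reverse, List.range_succ_eq_map]
  simp [Function.comp_def]

theorem strictMono_iterate_zero (hd : ∀ y, y < d y) : StrictMono fun i => d^[i] 0 :=
  strictMono_nat_of_lt_succ fun i => by
    simp only [Function.iterate_succ_apply']
    exact hd _

theorem exists_searchChain (y j : ℕ) : ∃ i, searchChain d y j = chain d i := by
  induction j with
  | zero => exact ⟨0, by simp [searchChain, chain]⟩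
  | succ j ih =>
    obtain ⟨i, hi⟩ := ih
    rw [searchChain, hi]
    split_ifs
    · exact ⟨i + 1, by rw [chain_succ, headI_chain, Function.iterate_succ_apply']⟩
    · exact ⟨i, rfl⟩

theorem searchChain_iterate_zero (hd : ∀ y, y < d y) (i j : ℕ) :
    searchChain d (d^[i] 0) j = chain d (min j i) := by
  have hm := strictMono_iterate_zero hd
  induction j with
  | zero => simp [searchChain, chain]
  | succ j ih =>
    rw [searchChain, ih, headI_chain]
    rcases lt_or_ge j i with h | h
    · rw [min_eq_left h.le, min_eq_left (by omega), if_pos (hm h), chain_succ,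
        Function.iterate_succ_apply']
    · rw [min_eq_right h, min_eq_right (by omega), if_neg (lt_irrefl _)]

theorem searchChain_self (hd : ∀ y, y < d y) (i : ℕ) :
    searchChain d (d^[i] 0) (d^[i] 0) = chain d i := by
  rw [searchChain_iterate_zero hd, min_eq_right ((strictMono_iterate_zero hd).le_apply)]

end Chain

/-- The part of a search of the chain of days that uses the first `j` running times. -/
noncomputable def partSearch (c : Code) (e y j : ℕ) : Part (List ℕ) :=
  Nat.rec (Part.some [0]) (fun _ IH => IH.bind fun l =>
    cond (decide (l.headI < y))
      ((runtime c e l.headI).map fun s => revealDay s l.headI :: l) (Part.some l)) j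

theorem partSearch_eq {c : Code} {e y : ℕ} {r : ℕ → ℕ} (hr : ∀ y' < y, r y' ∈ runtime c e y')
    (j : ℕ) : partSearch c e y j = Part.some (searchChain (fun y => revealDay (r y) y) y j) := by
  induction j with
  | zero => rfl
  | succ j ih =>
    have : partSearch c e y (j + 1) = (partSearch c e y j).bind fun l =>
      cond (decide (l.headI < y))
      ((runtime c e l.headI).map fun s => revealDay s l.headI :: l) (Part.some l) := rfl
    rw [this, ih, Part.bind_some, searchChain]
    split_ifs with h
    · rw [decide_eq_true h, cond_true, Part.eq_some_iff.2 (hr _ h), Part.map_some]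
    · rw [decide_eq_false h, cond_false]

/-- The template of the strategy with the index `y`, given the chain of days as it is found by
`searchChain`. Indices outside the chain get the code of the strategy without trades. -/
def chainTemplate (tmpl : List ℕ → List (Option Bool)) (y : ℕ) (l : List ℕ) : List (Option Bool) :=
  if l.headI = y then tmpl l.reverse.tail else [some false, some false]

theorem partrec_search (c : Code) : Partrec₂ fun e y : ℕ => partSearch c e y y := by
  have hh : Computable fun a : (ℕ × ℕ) × ℕ × List ℕ => a.2.2.headI :=
    Primrec.list_headI.to_comp.comp (Computable.snd.comp .snd)
  have hs : Partrec₂ fun (a : ℕ × ℕ) (b : ℕ × List ℕ) =>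
      cond (decide (b.2.headI < a.2))
        ((runtime c a.1 b.2.headI).map fun s => revealDay s b.2.headI :: b.2) (Part.some b.2) := by
    refine Partrec.cond ?_ ?_ ?_
    · have : Computable₂ fun a b : ℕ => decide (a < b) := Primrec.nat_lt.decide.to_comp
      exact this.comp hh (Computable.snd.comp .fst)
    · refine Partrec.map ((partrec_runtime c).comp (Computable.fst.comp .fst) hh) ?_
      exact Computable.list_cons.comp
        (primrec_revealDay.to_comp.comp .snd (hh.comp .fst))
        (Computable.snd.comp (Computable.snd.comp .fst))
    · exact Computable.snd.comp .snd
  exact Partrec.nat_rec (f := fun a : ℕ × ℕ => a.2) (g := fun _ => Part.some [0]) Computable.snd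
    (Computable.const [0]) hs

/-- Kleene's recursion theorem yields a program that knows its own running times, when it is run
by a universal machine. -/
theorem exists_selfTimed {tmpl : List ℕ → List (Option Bool)} (ht : Computable tmpl) :
    ∃ (c : Code) (e : ℕ) (r : ℕ → ℕ), (∀ y, r y ∈ runtime c e y) ∧
      ∀ y, (next (codeMachine c))^[r y] (codeInit c [e, y]) = ⟨none, none,
        mainOnly (trList [templateNum (chainTemplate tmpl y
          (searchChain (fun y => revealDay (r y) y) y y))])⟩ := by
  have hU : Partrec₂ fun e y : ℕ => (Denumerable.ofNat Nat.Partrec.Code e).eval y :=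
    Nat.Partrec.Code.eval_part.comp ((Computable.ofNat _).comp .fst) .snd
  obtain ⟨c, hc⟩ := Code.exists_code (Nat.Partrec'.part_iff₂.2 hU)
  have hf : Partrec₂ fun (k : Nat.Partrec.Code) (y : ℕ) =>
      (partSearch c (Encodable.encode k) y y).map fun l =>
        templateNum (chainTemplate tmpl y l) := by
    refine Partrec.map ((partrec_search c).comp (Computable.encode.comp .fst) .snd) ?_
    refine primrec_templateNum.to_comp.comp ?_
    have h₁ : Computable fun a : (Nat.Partrec.Code × ℕ) × List ℕ => decide (a.2.headI = a.1.2) :=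
      (Primrec.eq (α := ℕ)).decide.to_comp.comp (Primrec.list_headI.to_comp.comp .snd)
        (Computable.snd.comp .fst)
    refine (Computable.cond h₁ (ht.comp (Primrec.list_tail.to_comp.comp
      (Computable.list_reverse.comp .snd))) (.const [some false, some false])).of_eq fun a => ?_
    simp [chainTemplate, Bool.cond_eq_ite]
  obtain ⟨k, hk⟩ := Nat.Partrec.Code.fixed_point₂ hf
  replace hk : ∀ y, k.eval y = (partSearch c (Encodable.encode k) y y).map fun l =>
      templateNum (chainTemplate tmpl y l) := fun y => congrFun hk y
  -- If the program halts, then the machine halts with its result.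
  have halts : ∀ {y n : ℕ}, n ∈ k.eval y → ∃ s ∈ runtime c (Encodable.encode k) y,
      (next (codeMachine c))^[s] (codeInit c [Encodable.encode k, y]) =
        ⟨none, none, mainOnly (trList [n])⟩ := by
    intro y n hn
    have h := hc (Encodable.encode k ::ᵥ y ::ᵥ .nil)
    simp only [List.Vector.head_cons, List.Vector.tail_cons, Denumerable.ofNat_encode] at h
    rw [Part.eq_some_iff.2 hn] at h
    have h' : [n] ∈ c.eval [Encodable.encode k, y] := by
      refine (congrArg ([n] ∈ ·) h).mpr ?_
      simp [pure, Part.map_eq_map]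
    classical
    have hex := exists_codeMachine_halts h'
    have hl : ∃ s, ((next (codeMachine c))^[s] (codeInit c [Encodable.encode k, y])).l = none := by
      obtain ⟨s, hs⟩ := hex
      exact ⟨s, by rw [hs]⟩
    refine ⟨Nat.find hl, mem_runtime.2 ⟨Nat.find_spec hl, fun i hi => ?_⟩, ?_⟩
    · exact Option.isSome_iff_ne_none.2 (Nat.find_min hl hi)
    · obtain ⟨s, hs⟩ := hex
      have hle : Nat.find hl ≤ s := Nat.find_min' hl (by rw [hs])
      rw [← Nat.sub_add_cancel hle, Function.iterate_add_apply,
        next_iterate_of_halted (Nat.find_spec hl)] at hs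
      exact hs
  -- The program halts on every input, since it asks only for the running times on smaller ones.
  have total : ∀ y, (k.eval y).Dom := by
    intro y
    induction y using Nat.strong_induction_on with
    | _ y ih =>
      have : ∀ y', ∃ s, y' < y → s ∈ runtime c (Encodable.encode k) y' := by
        intro y'
        by_cases h : y' < y
        · obtain ⟨s, hs, -⟩ := halts (Part.get_mem (ih y' h))
          exact ⟨s, fun _ => hs⟩
        · exact ⟨0, fun h' => absurd h' h⟩
      choose r hr using this
      rw [hk, partSearch_eq hr]
      trivial
  choose r hr hr' using fun y => halts (Part.get_mem (total y))
  refine ⟨c, Encodable.encode k, r, hr, fun y => ?_⟩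
  rw [hr' y]
  congr 4
  refine Part.get_eq_of_mem ?_ _
  rw [hk, partSearch_eq fun y' _ => hr y']
  exact Part.mem_map _ (Part.mem_some _)

/-- Every computable sequence of strategies becomes efficiently computable if each strategy waits
for a day `D i` that is late enough. The strategies may depend on the earlier such days, and
`none` in a template stands for the current day. -/
theorem exists_efficientlyComputable_delay {tmpl : List ℕ → List (Option Bool)}
    (ht : Computable tmpl) : ∃ D : ℕ → ℕ, StrictMono D ∧ ∀ x : ℕ → List Bool,
      (∀ i, x (D i) = fill (D i) (tmpl ((List.range i).map D))) →
      (∀ n, (∀ i, n ≠ D i) → x n = [false, false]) → EfficientlyComputable x := by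
  obtain ⟨c, e, r, hr, hr'⟩ := exists_selfTimed ht
  set d : ℕ → ℕ := fun y => revealDay (r y) y with hd_def
  have hd : ∀ y, y < d y := fun y => lt_revealDay _ _
  have hm := strictMono_iterate_zero hd
  refine ⟨fun i => d^[i + 1] 0, fun i j h => hm (by omega), fun x hx hx' => ?_⟩
  refine efficientlyComputable_of_codeMachine (c := c) (e := e) (r := r)
    (g := fun y => chainTemplate tmpl y (searchChain d y y))
    (fun y i hi => (mem_runtime.1 (hr y)).2 i hi) (fun y => ?_) x ?_ fun m y => ?_
  · rw [hr' y, trList, trNat_eq_bits, bits_templateNum]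
    rfl
  · refine hx' 0 fun i => ?_
    simp only [Function.iterate_succ_apply']
    exact ((Nat.zero_le _).trans_lt (hd _)).ne
  · have key : ∀ i, 2 ^ m * (2 * y + 1) = d^[i + 1] 0 → m = r y ∧ y = d^[i] 0 := by
      intro i hi
      rw [Function.iterate_succ_apply'] at hi
      obtain ⟨h₁, h₂⟩ := revealDay_inj hi
      rw [h₂]
      exact ⟨h₂ ▸ h₁, rfl⟩
    by_cases h : ∃ i, 2 ^ m * (2 * y + 1) = d^[i + 1] 0
    · obtain ⟨i, hi⟩ := h
      obtain ⟨h₁, h₂⟩ := key i hi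
      rw [if_pos h₁, hi, hx i, h₂, searchChain_self hd, chainTemplate, if_pos (headI_chain i),
        tail_reverse_chain]
    · push Not at h
      rw [hx' _ h]
      split_ifs with hmr
      · obtain ⟨i, hi⟩ := exists_searchChain (d := d) y y
        rw [hi, chainTemplate, headI_chain, if_neg]
        · simp [fill_cons, fill_nil]
        · intro hy
          refine h i ?_
          rw [Function.iterate_succ_apply', hy, hmr]
          rfl
      · rfl

end LogicalInduction

namespace LogicalInduction

/-! ### Plausible worlds -/

section Worlds

variable {L : Set (List Bool)}

/-- The truth value of a sentence when the atoms have the truth values `v`. -/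
def Sentence.val (v : L → Bool) : Sentence L → Bool
  | .atom a => v a
  | .neg φ => !(φ.val v)
  | .and φ ψ => φ.val v && ψ.val v
  | .or φ ψ => φ.val v || ψ.val v
  | .imp φ ψ => !(φ.val v) || ψ.val v
  | .iff φ ψ => φ.val v == ψ.val v

theorem isPC_val (v : L → Bool) : World.IsPC fun φ => Sentence.val v φ :=
  ⟨fun _ => rfl, fun _ _ => rfl, fun _ _ => rfl, fun _ _ => rfl, fun _ _ => rfl⟩

theorem World.IsPC.eq_val {W : World L} (hW : W.IsPC) (φ : Sentence L) :
    W φ = φ.val fun a => W (.atom a) := by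
  induction φ with
  | atom a => rfl
  | neg φ h => rw [hW.neg, h, Sentence.val]
  | and φ ψ h₁ h₂ => rw [hW.and, h₁, h₂, Sentence.val]
  | or φ ψ h₁ h₂ => rw [hW.or, h₁, h₂, Sentence.val]
  | imp φ ψ h₁ h₂ => rw [hW.imp, h₁, h₂, Sentence.val]
  | iff φ ψ h₁ h₂ => rw [hW.iff, h₁, h₂, Sentence.val]

theorem Sentence.val_congr {v v' : L → Bool} {φ : Sentence L}
    (h : ∀ a, φ.Mentions a → v a = v' a) : φ.val v = φ.val v' := by
  induction φ with
  | atom a => exact h a rfl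
  | neg φ ih => rw [val, val, ih h]
  | and φ ψ h₁ h₂ | or φ ψ h₁ h₂ | imp φ ψ h₁ h₂ | iff φ ψ h₁ h₂ =>
    rw [val, val, h₁ fun a ha => h a (.inl ha), h₂ fun a ha => h a (.inr ha)]

theorem Sentence.continuous_val (φ : Sentence L) : Continuous fun v : L → Bool => φ.val v := by
  induction φ with
  | atom a => exact continuous_apply a
  | neg φ ih => exact (continuous_of_discreteTopology (f := fun b : Bool => !b)).comp ih
  | and φ ψ h₁ h₂ =>
    exact (continuous_of_discreteTopology (f := fun p : Bool × Bool => p.1 && p.2)).comp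
      (h₁.prodMk h₂)
  | or φ ψ h₁ h₂ =>
    exact (continuous_of_discreteTopology (f := fun p : Bool × Bool => p.1 || p.2)).comp
      (h₁.prodMk h₂)
  | imp φ ψ h₁ h₂ =>
    exact (continuous_of_discreteTopology (f := fun p : Bool × Bool => !p.1 || p.2)).comp
      (h₁.prodMk h₂)
  | iff φ ψ h₁ h₂ =>
    exact (continuous_of_discreteTopology (f := fun p : Bool × Bool => p.1 == p.2)).comp
      (h₁.prodMk h₂)

/-- Sentences without a common model prove everything, by a tautology and modus ponens. -/
theorem provable_of_unsatisfiable {Γ : Set (Sentence L)} (l : List (Sentence L))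
    (hl : ∀ φ ∈ l, φ ∈ Γ) (h : ∀ v : L → Bool, ∃ φ ∈ l, φ.val v = false) (ψ : Sentence L) :
    Provable Γ ψ := by
  have h₁ : Provable Γ (l.foldr .imp ψ) := by
    refine .taut _ fun W hW => ?_
    obtain ⟨φ, hφ, hf⟩ := h fun a => W (.atom a)
    rw [← hW.eq_val] at hf
    clear h hl
    induction l with
    | nil => simp at hφ
    | cons χ l ih =>
      rw [List.foldr_cons, hW.imp]
      rcases List.mem_cons.1 hφ with rfl | hφ
      · simp [hf]
      · simp [ih hφ]
  clear h
  induction l with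
  | nil => exact h₁
  | cons χ l ih =>
    exact ih (fun φ hφ => hl φ (List.mem_cons_of_mem _ hφ))
      (.mp _ _ h₁ (.ax _ (hl _ List.mem_cons_self)))

/-- The compactness theorem. -/
theorem exists_model {Γ : Set (Sentence L)} (hΓ : Consistent Γ) (a : L) :
    ∃ v : L → Bool, ∀ φ ∈ Γ, φ.val v = true := by
  by_contra hcon
  have hclosed : ∀ φ : Γ, IsClosed {v : L → Bool | φ.1.val v = true} := fun φ =>
    (isClosed_discrete {true}).preimage φ.1.continuous_val
  have hempty : (Set.univ ∩ ⋂ φ : Γ, {v : L → Bool | φ.1.val v = true}) = ∅ := by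
    rw [Set.univ_inter, Set.eq_empty_iff_forall_notMem]
    intro v hv
    exact hcon ⟨v, fun φ hφ => Set.mem_iInter.1 hv ⟨φ, hφ⟩⟩
  obtain ⟨u, hu⟩ := isCompact_univ.elim_finite_subfamily_closed _ hclosed hempty
  have key : ∀ ψ, Provable Γ ψ := provable_of_unsatisfiable (u.toList.map (·.1))
    (by
      intro φ hφ
      obtain ⟨χ, -, rfl⟩ := List.mem_map.1 hφ
      exact χ.2) fun v => by
    by_contra hv
    have : v ∈ (∅ : Set (L → Bool)) := by
      rw [← hu]
      refine ⟨trivial, Set.mem_iInter₂.2 fun φ hφ => ?_⟩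
      by_contra hf
      exact hv ⟨φ.1, List.mem_map.2 ⟨φ, Finset.mem_toList.2 hφ, rfl⟩, by simpa using hf⟩
    exact this
  exact hΓ ⟨.atom a, key _, key _⟩

theorem apply_literal {W : World L} (hW : W.IsPC) (a : L) (d : Bool) :
    W (literal a d) = (W (.atom a) == d) := by
  cases d <;> simp [literal, hW.neg]

theorem apply_startsWithFrom {W : World L} (hW : W.IsPC) (b : ℕ → L) (k : ℕ) (σ : List Bool)
    (h : ∀ i, ∀ hi : i < σ.length, W (.atom (b (k + i))) = σ[i]) :
    W (startsWithFrom b k σ) = true := by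
  induction σ generalizing k with
  | nil => simp [startsWithFrom, hW.imp]
  | cons d σ ih =>
    have h₀ : W (literal (b k) d) = true := by
      rw [apply_literal hW, beq_iff_eq]
      exact h 0 (by simp)
    cases σ with
    | nil => exact h₀
    | cons e σ =>
      rw [startsWithFrom, hW.and, h₀, ih (k + 1), Bool.and_self]
      intro i hi
      have := h (i + 1) (by simpa using hi)
      rwa [Nat.add_assoc, Nat.add_comm 1 i]

/-- Since `Γ` says nothing about the atoms `b i`, they can have any truth values in a plausible
world. -/
theorem exists_world_startsWith {Γ : Set (Sentence L)} (hΓ : Consistent Γ) {b : ℕ → L}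
    (hb : Function.Injective b) (hfresh : ∀ i, ∀ φ ∈ Γ, ¬ φ.Mentions (b i))
    {D : ℕ → Finset (Sentence L)} (hD : IsComplete Γ D) (ρ : List Bool) :
    ∃ W : World L, (∀ n, W ∈ pcWorlds (D n : Set (Sentence L))) ∧
      ∀ σ, σ <+: ρ → W (startsWith b σ) = true := by
  obtain ⟨v, hv⟩ := exists_model hΓ (b 0)
  set v' : L → Bool := Function.extend b (fun i => ρ.getD i false) v with hv'
  have hpc : World.IsPC fun φ => Sentence.val v' φ := isPC_val v'
  have hmem : (fun φ => Sentence.val v' φ) ∈ pcWorlds Γ := by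
    refine ⟨hpc, fun φ hφ => ?_⟩
    rw [← hv φ hφ]
    refine Sentence.val_congr fun a ha => ?_
    rw [hv', Function.extend_apply']
    rintro ⟨i, rfl⟩
    exact hfresh i φ hφ ha
  rw [← hD] at hmem
  refine ⟨_, fun n => ⟨hpc, fun φ hφ => hmem.2 φ ⟨n, hφ⟩⟩, fun σ hσ => ?_⟩
  refine apply_startsWithFrom hpc b 0 σ fun i hi => ?_
  simp only [Sentence.val, hv', hb.extend_apply]
  rw [hσ.getElem hi, Nat.zero_add, List.getD_eq_getElem]

end Worlds

open Filter

/-! ### Prices converge -/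

section Hysteresis

/-- The holdings of a trader that buys below the price `a` and sells above the price `b`, in
proportion to the amount that it may still buy or sell, when the prices are `p`. -/
def holding (a b : ℝ) (p : ℕ → ℝ) : ℕ → ℝ
  | 0 => 0
  | n + 1 => holding a b p n + ((1 - holding a b p n) * max 0 (a - p n) -
      holding a b p n * max 0 (p n - b))

/-- The amount bought on day `n`. -/
def bought (a b : ℝ) (p : ℕ → ℝ) (n : ℕ) : ℝ := (1 - holding a b p n) * max 0 (a - p n)

/-- The amount sold on day `n`. -/
def sold (a b : ℝ) (p : ℕ → ℝ) (n : ℕ) : ℝ := holding a b p n * max 0 (p n - b)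

variable {a b : ℝ} {p : ℕ → ℝ}

theorem holding_succ (n : ℕ) :
    holding a b p (n + 1) = holding a b p n + (bought a b p n - sold a b p n) := rfl

theorem holding_eq_sum (n : ℕ) :
    holding a b p n =
      ∑ i ∈ Finset.range n, bought a b p i - ∑ i ∈ Finset.range n, sold a b p i := by
  induction n with
  | zero => simp [holding]
  | succ n ih => rw [holding_succ, Finset.sum_range_succ, Finset.sum_range_succ, ih]; ring

/-- The thresholds `a ≤ b` and the prices `p` lie in `[0, 1]`. -/
structure InUnitInterval (a b : ℝ) (p : ℕ → ℝ) : Prop where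
  nonneg : 0 ≤ a
  le : a ≤ b
  le_one : b ≤ 1
  price_nonneg : ∀ n, 0 ≤ p n
  price_le_one : ∀ n, p n ≤ 1

theorem holding_mem (H : InUnitInterval a b p) (n : ℕ) :
    0 ≤ holding a b p n ∧ holding a b p n ≤ 1 := by
  induction n with
  | zero => simp [holding]
  | succ n ih =>
    have h₁ : max 0 (a - p n) ≤ 1 :=
      max_le zero_le_one (by linarith [H.price_nonneg n, H.le, H.le_one])
    have h₂ : max 0 (p n - b) ≤ 1 :=
      max_le zero_le_one (by linarith [H.price_le_one n, H.nonneg, H.le])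
    have h₃ : (0 : ℝ) ≤ max 0 (a - p n) := le_max_left _ _
    have h₄ : (0 : ℝ) ≤ max 0 (p n - b) := le_max_left _ _
    rw [holding]
    constructor <;> nlinarith

theorem bought_nonneg (H : InUnitInterval a b p) (n : ℕ) : 0 ≤ bought a b p n :=
  mul_nonneg (by linarith [(holding_mem H n).2]) (le_max_left _ _)

theorem sold_nonneg (H : InUnitInterval a b p) (n : ℕ) : 0 ≤ sold a b p n :=
  mul_nonneg (holding_mem H n).1 (le_max_left _ _)

/-- Each unit that has been bought and sold yields a profit of at least `b - a`. -/
theorem profit_le_worth (H : InUnitInterval a b p) (w : ℝ) (hw : 0 ≤ w) (n : ℕ) :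
    (b - a) * ∑ i ∈ Finset.range n, sold a b p i - 1 ≤
      ∑ i ∈ Finset.range n, (bought a b p i - sold a b p i) * (w - p i) := by
  have h₁ : ∀ i, (bought a b p i - sold a b p i) * w - a * bought a b p i + b * sold a b p i ≤
      (bought a b p i - sold a b p i) * (w - p i) := by
    intro i
    have hB : bought a b p i * p i ≤ bought a b p i * a := by
      unfold bought
      rcases le_total (a - p i) 0 with h | h
      · simp [max_eq_left h]
      · exact mul_le_mul_of_nonneg_left (by linarith)
          (bought_nonneg H i)
    have hS : sold a b p i * b ≤ sold a b p i * p i := by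
      unfold sold
      rcases le_total (p i - b) 0 with h | h
      · simp [max_eq_left h]
      · exact mul_le_mul_of_nonneg_left (by linarith)
          (sold_nonneg H i)
    linarith
  refine le_trans ?_ (Finset.sum_le_sum fun i _ => h₁ i)
  rw [Finset.sum_add_distrib, Finset.sum_sub_distrib, ← Finset.sum_mul, ← Finset.mul_sum,
    ← Finset.mul_sum, Finset.sum_sub_distrib]
  have h := holding_eq_sum (a := a) (b := b) (p := p) n
  have hh := holding_mem H n
  set B := ∑ i ∈ Finset.range n, bought a b p i
  set S := ∑ i ∈ Finset.range n, sold a b p i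
  have hB : B = holding a b p n + S := by linarith
  rw [← h, hB]
  nlinarith [mul_nonneg hh.1 hw, mul_le_mul_of_nonneg_left hh.2 H.nonneg, H.le, H.le_one]

/-- If the price oscillates, the amount that is sold is unbounded: otherwise the holdings would
converge, both to `1` and to `0`. -/
theorem exists_lt_sum_sold (H : InUnitInterval a b p) {ε : ℝ} (hε : 0 < ε)
    (h₁ : ∃ᶠ n in atTop, p n < a - ε) (h₂ : ∃ᶠ n in atTop, b + ε < p n) (K : ℝ) :
    ∃ n, K < ∑ i ∈ Finset.range n, sold a b p i := by
  by_contra! hK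
  have hmem := holding_mem H
  have hS : Summable (sold a b p) :=
    summable_of_sum_range_le (sold_nonneg H) hK
  have hB : Summable (bought a b p) := by
    refine summable_of_sum_range_le (c := K + 1) (bought_nonneg H) fun n => ?_
    have := holding_eq_sum (a := a) (b := b) (p := p) n
    linarith [hK n, (hmem n).2]
  have hlim : Tendsto (holding a b p) atTop (nhds (∑' i, bought a b p i - ∑' i, sold a b p i)) := by
    refine (hB.hasSum.tendsto_sum_nat.sub hS.hasSum.tendsto_sum_nat).congr fun n => ?_
    rw [holding_eq_sum]
  set h := ∑' i, bought a b p i - ∑' i, sold a b p i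
  have hh₁ : (1 - h) * ε ≤ 0 := by
    refine le_of_tendsto_of_tendsto_of_frequently ((hlim.const_sub 1).mul_const ε)
      hB.tendsto_atTop_zero (h₁.mono fun n hn => ?_)
    exact mul_le_mul_of_nonneg_left (le_max_of_le_right (by linarith)) (by linarith [(hmem n).2])
  have hh₂ : h * ε ≤ 0 := by
    refine le_of_tendsto_of_tendsto_of_frequently (hlim.mul_const ε)
      hS.tendsto_atTop_zero (h₂.mono fun n hn => ?_)
    exact mul_le_mul_of_nonneg_left (le_max_of_le_right (by linarith)) (hmem n).1
  nlinarith

end Hysteresis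

/-! ### The trader that exploits oscillating prices -/

section BandTrader

variable {L : Set (List Bool)}

/-- All prices are taken on day `n`, and all variables become `v_n`. -/
def FeatExpr.atDay (n : ℕ) : FeatExpr L → FeatExpr L
  | .price φ _ => .price φ n
  | .rat a d => .rat a d
  | .var _ => .var n
  | .add x y => .add (x.atDay n) (y.atDay n)
  | .mul x y => .mul (x.atDay n) (y.atDay n)
  | .max x y => .max (x.atDay n) (y.atDay n)
  | .safeInv x => .safeInv (x.atDay n)

/-- The template that yields the code of `x.atDay n` on day `n`. -/
def FeatExpr.template : FeatExpr L → List (Option Bool)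
  | .price φ _ => ([false, false, false] ++ φ.encode).map some ++ [none]
  | .rat a d => ([false, false, true] ++ encodeInt a ++ encodeNat d).map some
  | .var _ => [false, true, false].map some ++ [none]
  | .add x y => [false, true, true].map some ++ x.template ++ y.template
  | .mul x y => [true, false, false].map some ++ x.template ++ y.template
  | .max x y => [true, false, true].map some ++ x.template ++ y.template
  | .safeInv x => [true, true, false].map some ++ x.template

theorem fill_template (n : ℕ) (x : FeatExpr L) : fill n x.template = (x.atDay n).encode := by
  induction x <;>
    simp only [FeatExpr.template, FeatExpr.atDay, FeatExpr.encode, fill_append, fill_map_some,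
      fill_cons, fill_nil, Option.elim_none, List.append_nil, *]

/-- A rational constant. -/
def FeatExpr.const (r : ℚ) : FeatExpr L := .rat r.num r.den

theorem FeatExpr.eval_const (r : ℚ) (V : ℕ → Sentence L → ℝ) (env : List ℝ) :
    (FeatExpr.const r).eval V env = r := (Rat.cast_def r).symm

/-- The amount that the trader with thresholds `a` and `b` buys, if `v_0` is the amount that it
holds. -/
def bandTrade (φ : Sentence L) (a b : ℚ) : FeatExpr L :=
  .add (.mul (.add (.const 1) (.mul (.const (-1)) (.var 0)))
      (.max (.const 0) (.add (.const a) (.mul (.const (-1)) (.price φ 0)))))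
    (.mul (.const (-1)) (.mul (.var 0) (.max (.const 0) (.add (.price φ 0) (.const (-b))))))

theorem eval_bandTrade (φ : Sentence L) (a b : ℚ) (n : ℕ) (V : ℕ → Sentence L → ℝ) (env : List ℝ)
    (h : env.getD n 0 = holding a b (fun i => V i φ) n) :
    ((bandTrade φ a b).atDay n).eval V env =
      bought a b (fun i => V i φ) n - sold a b (fun i => V i φ) n := by
  have hc : ∀ r : ℚ, (FeatExpr.const r : FeatExpr L).atDay n = .const r := fun _ => rfl
  simp only [bandTrade, FeatExpr.atDay, hc, FeatExpr.eval, FeatExpr.eval_const, h, bought, sold]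
  push_cast
  ring_nf

/-- The strategy of the trader that buys `φ` below the price `a` and sells above the price `b`. The
variables are its holdings on the days `0, …, n`. -/
def bandStrategy (φ : Sentence L) (a b : ℚ) (n : ℕ) : Strategy L where
  defs := .const 0 :: (List.range n).map fun i => (FeatExpr.add (.var 0) (bandTrade φ a b)).atDay i
  trades := [(φ, (bandTrade φ a b).atDay n)]

theorem env_bandStrategy (φ : Sentence L) (a b : ℚ) (n : ℕ) (V : ℕ → Sentence L → ℝ) :
    (bandStrategy φ a b n).env V = (List.range (n + 1)).map (holding a b fun i => V i φ) := by
  induction n with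
  | zero => simp [bandStrategy, Strategy.env, FeatExpr.eval_const, holding]
  | succ n ih =>
    have hrec : (bandStrategy φ a b (n + 1)).env V = (bandStrategy φ a b n).env V ++
        [((FeatExpr.add (.var 0) (bandTrade φ a b)).atDay n).eval V
          ((bandStrategy φ a b n).env V)] := by
      simp [bandStrategy, Strategy.env, List.range_succ]
    have hget : ((List.range (n + 1)).map (holding a b fun i => V i φ)).getD n 0 =
        holding a b (fun i => V i φ) n := by
      simp [List.getD_eq_getElem?_getD]
    rw [hrec, ih, List.range_succ (n := n + 1), List.map_append]
    congr 2
    rw [FeatExpr.atDay, FeatExpr.eval, eval_bandTrade _ _ _ _ _ _ hget, FeatExpr.atDay,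
      FeatExpr.eval, hget, holding_succ]

theorem value_bandStrategy (φ : Sentence L) (a b : ℚ) (n : ℕ) (V : ℕ → Sentence L → ℝ)
    (W : World L) : (bandStrategy φ a b n).value n V W =
      (bought a b (fun i => V i φ) n - sold a b (fun i => V i φ) n) *
        ((if W φ then 1 else 0) - V n φ) := by
  rw [Strategy.value, env_bandStrategy]
  simp only [bandStrategy, List.map_cons, List.map_nil, List.sum_cons, List.sum_nil, add_zero]
  rw [eval_bandTrade]
  simp [List.getD_eq_getElem?_getD]

theorem wellFormed_bandTrade (φ : Sentence L) (a b : ℚ) {i n k : ℕ} (hn : i ≤ n) (hk : i < k) :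
    ((bandTrade φ a b).atDay i).WellFormed n k := by
  have hc : ∀ r : ℚ, (FeatExpr.const r : FeatExpr L).WellFormed n k := fun r => r.den_pos
  exact ⟨⟨⟨hc _, hc _, hk⟩, hc _, hc _, hc _, hn⟩, hc _, hk, hc _, hn, hc _⟩

theorem isTrader_bandStrategy (φ : Sentence L) (a b : ℚ) : IsTrader (bandStrategy φ a b) := by
  intro n
  constructor
  · intro i hi
    cases i with
    | zero => exact Rat.den_pos _
    | succ i =>
      have h : i < n := by simpa [bandStrategy] using hi
      simp only [bandStrategy, List.getElem_cons_succ, List.getElem_map, List.getElem_range]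
      exact ⟨Nat.lt_succ_self _, wellFormed_bandTrade φ a b h.le (Nat.lt_succ_self _)⟩
  · simp only [bandStrategy, List.mem_singleton, forall_eq]
    exact wellFormed_bandTrade φ a b le_rfl (by simp)

theorem efficientlyComputable_bandStrategy (φ : Sentence L) (a b : ℚ) :
    EfficientlyComputable fun n => (bandStrategy φ a b n).encode := by
  have h := efficientlyComputable_fill_range (true :: (FeatExpr.const 0 : FeatExpr L).encode)
    (some true :: (FeatExpr.add (.var 0) (bandTrade φ a b)).template)
    (some false :: some true :: (φ.encode.map some ++ (bandTrade φ a b).template ++ [some false]))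
  convert h using 2 with n
  simp [Strategy.encode, encodeList, bandStrategy, fill_cons, fill_append, fill_template,
    fill_map_some, fill_nil, List.flatMap_map]

/-- A logical inductor's prices converge. If the price of a sentence oscillated, a trader could buy
low and sell high forever. -/
theorem exists_tendsto_price {P : ℕ → Sentence L → ℚ} (hP : IsMarket P)
    {D : ℕ → Finset (Sentence L)} (hD : ∃ W, ∀ n, W ∈ pcWorlds (D n : Set (Sentence L)))
    (hLIC : SatisfiesLIC P D) (φ : Sentence L) :
    ∃ x : ℝ, Tendsto (fun n => (P n φ : ℝ)) atTop (nhds x) := by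
  have hp₀ : ∀ n, (0 : ℝ) ≤ P n φ := fun n => by exact_mod_cast hP.nonneg n φ
  have hp₁ : ∀ n, (P n φ : ℝ) ≤ 1 := fun n => by exact_mod_cast hP.le_one n φ
  refine tendsto_of_no_upcrossings (s := Set.range ((↑) : ℚ → ℝ)) Rat.denseRange_cast ?_
    (isBoundedUnder_of ⟨1, hp₁⟩) (isBoundedUnder_of ⟨0, hp₀⟩)
  rintro _ ⟨a, rfl⟩ _ ⟨b, rfl⟩ hab ⟨h₁, h₂⟩
  obtain ⟨n₁, hn₁⟩ := h₁.exists
  obtain ⟨n₂, hn₂⟩ := h₂.exists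
  -- Thresholds strictly between `a` and `b` leave a margin of `(b - a) / 3`.
  set a' : ℚ := (2 * a + b) / 3 with ha'
  set b' : ℚ := (a + 2 * b) / 3 with hb'
  have hε : (0 : ℝ) < (b - a) / 3 := by linarith
  have ea : (a' : ℝ) = (2 * a + b) / 3 := by rw [ha']; push_cast; ring
  have eb : (b' : ℝ) = (a + 2 * b) / 3 := by rw [hb']; push_cast; ring
  have H : InUnitInterval (a' : ℝ) (b' : ℝ) fun n => (P n φ : ℝ) := by
    have := hp₀ n₁
    have := hp₁ n₂
    refine ⟨?_, ?_, ?_, hp₀, hp₁⟩ <;> linarith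
  have hworth : ∀ n (W : World L), ∑ i ∈ Finset.range n,
      (bandStrategy φ a' b' i).value i (fun n φ => (P n φ : ℝ)) W = ∑ i ∈ Finset.range n,
        (bought a' b' (fun n => (P n φ : ℝ)) i - sold a' b' (fun n => (P n φ : ℝ)) i) *
          ((if W φ then 1 else 0) - P i φ) := fun n W =>
    Finset.sum_congr rfl fun i _ => value_bandStrategy φ a' b' i _ W
  have hprofit : ∀ n (W : World L), ((b' : ℝ) - a') *
      ∑ i ∈ Finset.range n, sold a' b' (fun n => (P n φ : ℝ)) i - 1 ≤ ∑ i ∈ Finset.range n,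
      (bandStrategy φ a' b' i).value i (fun n φ => (P n φ : ℝ)) W := fun n W => by
    rw [hworth]
    exact profit_le_worth H _ (by split_ifs <;> norm_num) n
  refine hLIC ⟨bandStrategy φ a' b', isTrader_bandStrategy φ a' b',
    efficientlyComputable_bandStrategy φ a' b', ⟨-1, ?_⟩, ?_⟩
  · rintro _ ⟨n, W, -, rfl⟩
    refine le_trans ?_ (hprofit _ W)
    have := Finset.sum_nonneg fun i (_ : i ∈ Finset.range (n + 1)) => sold_nonneg H i
    have hba : (0 : ℝ) ≤ b' - a' := by linarith
    linarith [mul_nonneg hba this]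
  · rintro ⟨K, hK⟩
    obtain ⟨W, hW⟩ := hD
    obtain ⟨n, hn⟩ := exists_lt_sum_sold H hε (h₁.mono fun n hn => by linarith)
      (h₂.mono fun n hn => by linarith) ((K + 1) / (b' - a'))
    have hba : (0 : ℝ) < b' - a' := by linarith
    have h₁ := hK ⟨n, W, hW n, rfl⟩
    have h₂ := hprofit (n + 1) W
    rw [Finset.sum_range_succ] at h₂
    rw [div_lt_iff₀' hba] at hn
    have h₃ := mul_nonneg hba.le (sold_nonneg H n)
    simp only [mul_add] at h₂
    linarith

end BandTrader

/-! ### Stakes on the prefixes of a string -/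

theorem IsSemimeasure.le_one {M : List Bool → ℝ} (hM : IsSemimeasure M) (σ : List Bool) :
    M σ ≤ 1 := by
  induction σ using List.reverseRecOn with
  | nil => exact hM.nil_le_one
  | append_singleton σ d ih =>
    have := hM.add_le σ
    cases d
    · linarith [hM.nonneg (σ ++ [true])]
    · linarith [hM.nonneg (σ ++ [false])]

/-- If the stakes `x` on the prefixes of any one string sum to at most `c`, then the total of all
stakes, weighted with a semimeasure, is at most `c` times the weight of the empty string. -/
theorem sum_mul_semimeasure_le {ι : Type} [DecidableEq ι] {M : List Bool → ℝ}
    (hM : ∀ σ, 0 ≤ M σ) (hadd : ∀ σ, M (σ ++ [false]) + M (σ ++ [true]) ≤ M σ) (F : Finset ι)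
    (σ : ι → List Bool) (x : ι → ℝ) (c : ℝ) (n : ℕ) (hF : ∀ m ∈ F, (σ m).length ≤ n)
    (hc : ∀ ρ, ∑ m ∈ F with σ m <+: ρ, x m ≤ c) : ∑ m ∈ F, x m * M (σ m) ≤ c * M [] := by
  induction n generalizing M F σ c with
  | zero =>
    have hnil : ∀ m ∈ F, σ m = [] := fun m hm => List.length_eq_zero_iff.1 (Nat.le_zero.1 (hF m hm))
    have h := hc []
    rw [Finset.filter_true_of_mem fun m hm => by rw [hnil m hm]] at h
    rw [Finset.sum_congr rfl fun m hm => by rw [hnil m hm], ← Finset.sum_mul]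
    exact mul_le_mul_of_nonneg_right h (hM [])
  | succ n ih =>
    -- The stakes on strings that begin with `d`.
    have hd : ∀ d : Bool, ∑ m ∈ F with (σ m).head? = some d, x m * M (σ m) ≤
        (c - ∑ m ∈ F with σ m = [], x m) * M [d] := by
      intro d
      have hcons : ∀ m ∈ F.filter (fun m => (σ m).head? = some d), σ m = d :: (σ m).tail := by
        intro m hm
        exact (List.cons_head?_tail (Finset.mem_filter.1 hm).2).symm
      have := ih (M := fun τ => M (d :: τ)) (fun _ => hM _) (fun τ => hadd (d :: τ))
        (F.filter fun m => (σ m).head? = some d) (fun m => (σ m).tail)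
        (c - ∑ m ∈ F with σ m = [], x m) (fun m hm => by
          have := hF m (Finset.mem_filter.1 hm).1
          rw [List.length_tail]
          omega) fun ρ => by
        rw [le_sub_iff_add_le, ← Finset.sum_union]
        · refine le_of_eq_of_le (Finset.sum_congr ?_ fun _ _ => rfl) (hc (d :: ρ))
          ext m
          simp only [Finset.mem_union, Finset.mem_filter]
          cases h : σ m with
          | nil => simp
          | cons e τ =>
            simp only [List.head?_cons, Option.some.injEq, List.tail_cons, List.cons_prefix_cons,
              reduceCtorEq, and_false, or_false]
            tauto
        · refine Finset.disjoint_left.2 fun m hm hm' => ?_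
          have h₁ := (Finset.mem_filter.1 (Finset.mem_filter.1 hm).1).2
          rw [(Finset.mem_filter.1 hm').2] at h₁
          simp at h₁
      refine le_of_eq_of_le (Finset.sum_congr rfl fun m hm => ?_) this
      conv_lhs => rw [hcons m hm]
    have hsplit : ∑ m ∈ F, x m * M (σ m) = ∑ m ∈ F with σ m = [], x m * M (σ m) +
        (∑ m ∈ F with (σ m).head? = some false, x m * M (σ m) +
          ∑ m ∈ F with (σ m).head? = some true, x m * M (σ m)) := by
      rw [Finset.sum_filter, Finset.sum_filter, Finset.sum_filter, ← Finset.sum_add_distrib,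
        ← Finset.sum_add_distrib]
      refine Finset.sum_congr rfl fun m _ => ?_
      cases h : σ m with
      | nil => simp
      | cons e τ => cases e <;> simp
    have hnil : ∑ m ∈ F with σ m = [], x m * M (σ m) = (∑ m ∈ F with σ m = [], x m) * M [] := by
      rw [Finset.sum_mul]
      refine Finset.sum_congr rfl fun m hm => ?_
      rw [(Finset.mem_filter.1 hm).2]
    have hA : ∑ m ∈ F with σ m = [], x m ≤ c := by
      refine le_of_eq_of_le (Finset.sum_congr ?_ fun _ _ => rfl) (hc [])
      simp
    have h₀ := hd false
    have h₁ := hd true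
    have h₂ := hadd []
    simp only [List.nil_append] at h₂
    rw [hsplit, hnil]
    nlinarith [mul_le_mul_of_nonneg_left h₂ (sub_nonneg.2 hA)]

section Stakes

/-- In a list of targets `(κ, σ)`, the one with index `m` has the same level `κ` as the one with
index `l`, and its string is a prefix. -/
def precedes (s : ℕ → ℕ × List Bool) (m l : ℕ) : Bool :=
  (s m).1 == (s l).1 && (s l).2.take (s m).2.length == (s m).2

theorem precedes_iff {s : ℕ → ℕ × List Bool} {m l : ℕ} :
    precedes s m l = true ↔ (s m).1 = (s l).1 ∧ (s m).2 <+: (s l).2 := by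
  rw [precedes, Bool.and_eq_true, beq_iff_eq, beq_iff_eq, List.prefix_iff_eq_take,
    eq_comm (a := (s m).2)]

/-- The largest total of the earlier stakes on the prefixes of a string that is a target, up to the
index `i`, and extends the target of index `i`. -/
def load (s : ℕ → ℕ × List Bool) (env : List ℝ) (i : ℕ) : ℝ :=
  (((List.range (i + 1)).filter (precedes s i)).map fun l =>
    (((List.range i).filter fun m => precedes s m l).map fun m => env.getD m 0).sum).foldr max 0

/-- The list of the first `i` stakes. Each one is the gap that calls for it, scaled down so that the
stakes on the prefixes of any one string sum to at most `1`. -/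
def stakes (s : ℕ → ℕ × List Bool) (gap : ℕ → ℝ) : ℕ → List ℝ
  | 0 => []
  | i + 1 => stakes s gap i ++ [gap i * (1 - load s (stakes s gap i) i)]

/-- The stake on the target of index `i`. -/
def stake (s : ℕ → ℕ × List Bool) (gap : ℕ → ℝ) (i : ℕ) : ℝ :=
  gap i * (1 - load s (stakes s gap i) i)

variable {s : ℕ → ℕ × List Bool} {gap : ℕ → ℝ}

theorem stakes_eq (i : ℕ) : stakes s gap i = (List.range i).map (stake s gap) := by
  induction i with
  | zero => rfl
  | succ i ih => rw [List.range_succ, List.map_append, ← ih]; rfl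

variable (s gap) in
/-- The total of the first `i` stakes of level `κ` on the prefixes of `ρ`. -/
noncomputable def totalStake (i κ : ℕ) (ρ : List Bool) : ℝ :=
  ∑ m ∈ Finset.range i with (s m).1 = κ ∧ (s m).2 <+: ρ, stake s gap m

theorem totalStake_succ (i κ : ℕ) (ρ : List Bool) : totalStake s gap (i + 1) κ ρ =
    totalStake s gap i κ ρ + if (s i).1 = κ ∧ (s i).2 <+: ρ then stake s gap i else 0 := by
  rw [totalStake, totalStake, Finset.range_add_one, Finset.filter_insert]
  split_ifs
  · rw [Finset.sum_insert (by simp), add_comm]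
  · rw [add_zero]

theorem foldr_max_le {l : List ℝ} {u : ℝ} (hu : 0 ≤ u) (h : ∀ x ∈ l, x ≤ u) :
    l.foldr max 0 ≤ u := by
  induction l with
  | nil => exact hu
  | cons a l ih => exact max_le (h a (by simp)) (ih fun x hx => h x (by simp [hx]))

theorem le_foldr_max {l : List ℝ} {x : ℝ} (h : x ∈ l) : x ≤ l.foldr max 0 := by
  induction l with
  | nil => simp at h
  | cons a l ih =>
    rcases List.mem_cons.1 h with rfl | h
    · exact le_max_left _ _
    · exact (ih h).trans (le_max_right _ _)

theorem load_stakes (i : ℕ) : load s (stakes s gap i) i =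
    (((List.range (i + 1)).filter (precedes s i)).map fun l =>
      totalStake s gap i (s l).1 (s l).2).foldr max 0 := by
  rw [load]
  congr 1
  refine List.map_congr_left fun l _ => ?_
  rw [totalStake, ← Finset.sum_map_toList, stakes_eq]
  refine (congrArg List.sum (List.map_congr_left (g := stake s gap) fun m hm => ?_)).trans ?_
  · have := List.mem_range.1 (List.mem_filter.1 hm).1
    simp [List.getD_eq_getElem?_getD, this]
  · refine List.Perm.sum_eq (List.Perm.map _ ?_)
    refine (List.perm_ext_iff_of_nodup (List.nodup_range.filter _) (Finset.nodup_toList _)).2 ?_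
    intro m
    simp [precedes_iff]

theorem load_stakes_le {i : ℕ} {u : ℝ} (hu : 0 ≤ u)
    (h : ∀ ρ, totalStake s gap i (s i).1 ρ ≤ u) : load s (stakes s gap i) i ≤ u := by
  rw [load_stakes]
  refine foldr_max_le hu fun x hx => ?_
  obtain ⟨l, hl, rfl⟩ := List.mem_map.1 hx
  rw [← (precedes_iff.1 (List.mem_filter.1 hl).2).1]
  exact h _

theorem totalStake_le_load {i : ℕ} {ρ : List Bool} (hρ : (s i).2 <+: ρ) :
    totalStake s gap i (s i).1 ρ ≤ load s (stakes s gap i) i := by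
  -- The longest target that is a prefix of `ρ` has the same earlier stakes as `ρ`.
  obtain ⟨l, hl, hmax⟩ := Finset.exists_max_image
    ((Finset.range (i + 1)).filter fun m => (s m).1 = (s i).1 ∧ (s m).2 <+: ρ)
    (fun m => (s m).2.length) ⟨i, by simp [hρ]⟩
  simp only [Finset.mem_filter, Finset.mem_range] at hl hmax
  have hpre : ∀ m < i + 1, ((s m).1 = (s i).1 ∧ (s m).2 <+: ρ) →
      (s m).1 = (s l).1 ∧ (s m).2 <+: (s l).2 := fun m hm h =>
    ⟨h.1.trans hl.2.1.symm, List.prefix_of_prefix_length_le h.2 hl.2.2 (hmax m ⟨hm, h⟩)⟩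
  have heq : totalStake s gap i (s i).1 ρ = totalStake s gap i (s l).1 (s l).2 := by
    refine Finset.sum_congr (Finset.filter_congr fun m hm => ⟨fun h => ?_, fun h => ?_⟩)
      fun _ _ => rfl
    · exact hpre m (by have := Finset.mem_range.1 hm; omega) h
    · exact ⟨h.1.trans hl.2.1, h.2.trans hl.2.2⟩
  rw [load_stakes, heq]
  refine le_foldr_max (List.mem_map.2 ⟨l, ?_, rfl⟩)
  rw [List.mem_filter, List.mem_range, precedes_iff]
  exact ⟨hl.1, hpre i (by omega) ⟨rfl, hρ⟩⟩

theorem totalStake_le_one (h₁ : ∀ i, gap i ≤ 1) (i κ : ℕ)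
    (ρ : List Bool) : totalStake s gap i κ ρ ≤ 1 := by
  induction i generalizing κ ρ with
  | zero => simp [totalStake]
  | succ i ih =>
    rw [totalStake_succ]
    split_ifs with h
    · obtain ⟨rfl, hρ⟩ := h
      have h₂ := totalStake_le_load (s := s) (gap := gap) hρ
      have h₃ := load_stakes_le (s := s) (gap := gap) zero_le_one (ih (s i).1)
      have : stake s gap i ≤ 1 - load s (stakes s gap i) i :=
        mul_le_of_le_one_left (by linarith) (h₁ i)
      linarith
    · linarith [ih κ ρ]

theorem stake_nonneg (h₀ : ∀ i, 0 ≤ gap i) (h₁ : ∀ i, gap i ≤ 1) (i : ℕ) : 0 ≤ stake s gap i :=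
  mul_nonneg (h₀ i) (sub_nonneg.2
    (load_stakes_le zero_le_one fun ρ => totalStake_le_one h₁ i _ ρ))

/-- A target whose gap stays away from `0` attracts stakes until there is a string whose prefixes
carry stakes of at least `1 / 2`. -/
theorem exists_half_le_totalStake (h₀ : ∀ i, 0 ≤ gap i) (h₁ : ∀ i, gap i ≤ 1) {κ : ℕ}
    {τ : List Bool} {ε : ℝ} (hε : 0 < ε) (h : ∃ᶠ i in atTop, s i = (κ, τ) ∧ ε ≤ gap i) :
    ∃ i ρ, 1 / 2 ≤ totalStake s gap i κ ρ := by
  by_contra! hcon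
  have hmono : Monotone fun i => totalStake s gap i κ τ := monotone_nat_of_le_succ fun i => by
    rw [totalStake_succ]
    split_ifs <;> linarith [stake_nonneg (s := s) h₀ h₁ i]
  have key : ∀ n : ℕ, ∃ i, n * (ε / 2) ≤ totalStake s gap i κ τ := by
    intro n
    induction n with
    | zero => exact ⟨0, by simp [totalStake]⟩
    | succ n ih =>
      obtain ⟨i, hi⟩ := ih
      obtain ⟨j, hj, hs, hg⟩ := (frequently_atTop.1 h) i
      refine ⟨j + 1, ?_⟩
      rw [totalStake_succ, if_pos (by simp [hs])]
      have h₂ : load s (stakes s gap j) j ≤ 1 / 2 :=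
        load_stakes_le (by norm_num) fun ρ => by
          rw [hs]
          exact (hcon j ρ).le
      have h₃ : ε / 2 ≤ stake s gap j := by
        have : ε * (1 / 2) ≤ stake s gap j :=
          mul_le_mul hg (by linarith) (by norm_num) (h₀ j)
        linarith
      have h₄ := hmono hj
      simp only at h₄
      push_cast
      linarith
  obtain ⟨n, hn⟩ := exists_nat_gt (1 / (ε / 2))
  rw [div_lt_iff₀ (by positivity)] at hn
  obtain ⟨i, hi⟩ := key n
  linarith [hcon i τ]

/-- Stakes on underpriced targets, with weight `2 ^ κ` on level `κ`, cost at most `2` in all. -/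
theorem sum_cost_le {M : List Bool → ℝ} (hM : IsSemimeasure M) {θ p : ℕ → ℝ}
    (hθ : ∀ i, θ i ≤ M (s i).2 / 4 ^ (s i).1) (hp : ∀ i, 0 ≤ p i)
    (hgap : gap = fun i => max 0 (θ i - p i)) (I : ℕ) :
    ∑ m ∈ Finset.range I, 2 ^ (s m).1 * stake s gap m * p m ≤ 2 := by
  have h₀ : ∀ i, 0 ≤ gap i := fun i => by rw [hgap]; exact le_max_left _ _
  have h₁ : ∀ i, gap i ≤ 1 := fun i => by
    have : M (s i).2 / 4 ^ (s i).1 ≤ 1 :=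
      div_le_one_of_le₀ ((hM.le_one _).trans (one_le_pow₀ (by norm_num))) (by positivity)
    rw [hgap]
    exact max_le zero_le_one (by linarith [hθ i, hp i])
  have hterm : ∀ m, 2 ^ (s m).1 * stake s gap m * p m ≤
      (1 / 2) ^ (s m).1 * (stake s gap m * M (s m).2) := by
    intro m
    have hst := stake_nonneg (s := s) h₀ h₁ m
    have : stake s gap m * p m ≤ stake s gap m * (M (s m).2 / 4 ^ (s m).1) := by
      rcases le_total (θ m) (p m) with h | h
      · have : stake s gap m = 0 := by
          rw [stake, hgap]
          simp [max_eq_left (sub_nonpos.2 h)]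
        simp [this]
      · exact mul_le_mul_of_nonneg_left (h.trans (hθ m)) hst
    have e : (1 / 2 : ℝ) ^ (s m).1 * (stake s gap m * M (s m).2) =
        2 ^ (s m).1 * (stake s gap m * (M (s m).2 / 4 ^ (s m).1)) := by
      have : (4 : ℝ) ^ (s m).1 = 2 ^ (s m).1 * 2 ^ (s m).1 := by
        rw [← mul_pow]
        norm_num
      rw [this, one_div, inv_pow]
      field_simp
    rw [e, mul_assoc]
    exact mul_le_mul_of_nonneg_left this (by positivity)
  refine (Finset.sum_le_sum fun m _ => hterm m).trans ?_
  obtain ⟨K, hK⟩ : ∃ K, ∀ m ∈ Finset.range I, (s m).1 ∈ Finset.range K := by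
    refine ⟨(Finset.range I).sup (fun m => (s m).1) + 1, fun m hm => ?_⟩
    rw [Finset.mem_range, Nat.lt_succ_iff]
    exact Finset.le_sup (f := fun m => (s m).1) hm
  rw [← Finset.sum_fiberwise_of_maps_to hK]
  have hlevel : ∀ κ, ∑ m ∈ Finset.range I with (s m).1 = κ,
      (1 / 2 : ℝ) ^ (s m).1 * (stake s gap m * M (s m).2) ≤ (1 / 2) ^ κ := by
    intro κ
    rw [Finset.sum_congr rfl fun m hm => by rw [(Finset.mem_filter.1 hm).2], ← Finset.mul_sum]
    refine mul_le_of_le_one_right (by positivity) ?_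
    have := sum_mul_semimeasure_le hM.nonneg hM.add_le
      ((Finset.range I).filter fun m => (s m).1 = κ) (fun m => (s m).2) (stake s gap) 1
      ((Finset.range I).sup fun m => (s m).2.length)
      (fun m hm => Finset.le_sup (f := fun m => (s m).2.length) (Finset.mem_filter.1 hm).1)
      (fun ρ => by
        rw [Finset.filter_filter]
        exact totalStake_le_one h₁ I κ ρ)
    linarith [hM.nil_le_one]
  refine (Finset.sum_le_sum fun κ _ => hlevel κ).trans ?_
  exact (Summable.sum_le_tsum _ (fun _ _ => by positivity) summable_geometric_two).trans
    tsum_geometric_two.le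

end Stakes

/-! ### The trader that bets on the prefixes of a string -/

section Expressions

variable {L : Set (List Bool)}

/-- The total of the variables `v_m` with `m < i` where `precedes s m l`. -/
def sumExpr (L : Set (List Bool)) (s : ℕ → ℕ × List Bool) (i l : ℕ) : FeatExpr L :=
  ((List.range i).filter fun m => precedes s m l).foldr (fun m x => .add (.var m) x) (.rat 0 1)

/-- The expression for `load`. -/
def loadExpr (L : Set (List Bool)) (s : ℕ → ℕ × List Bool) (i : ℕ) : FeatExpr L :=
  ((List.range (i + 1)).filter (precedes s i)).foldr
    (fun l x => .max (sumExpr L s i l) x) (.rat 0 1)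

/-- The expression for `stake`, if the gap is the excess of `(q i).1 / (q i).2` over the price of
`φ i` on the given day. -/
def stakeExpr (s : ℕ → ℕ × List Bool) (φ : ℕ → Sentence L) (q : ℕ → ℕ × ℕ) (i day : ℕ) :
    FeatExpr L :=
  .mul (.max (.rat 0 1) (.add (.rat (q i).1 (q i).2) (.mul (.rat (-1) 1) (.price (φ i) day))))
    (.add (.rat 1 1) (.mul (.rat (-1) 1) (loadExpr L s i)))

/-- The strategy for the day `D i`, which buys the target of index `i`. Its variables are the
earlier stakes. -/
def stakeStrategy (s : ℕ → ℕ × List Bool) (φ : ℕ → Sentence L) (q : ℕ → ℕ × ℕ) (D : ℕ → ℕ)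
    (i : ℕ) : Strategy L where
  defs := (List.range i).map fun l => stakeExpr s φ q l (D l)
  trades := [(φ i, .mul (.rat (2 ^ (s i).1 : ℕ) 1) (stakeExpr s φ q i (D i)))]

/-- The amount by which the target of index `i` is underpriced on the day `D i`. -/
noncomputable def priceGap (φ : ℕ → Sentence L) (q : ℕ → ℕ × ℕ) (D : ℕ → ℕ)
    (V : ℕ → Sentence L → ℝ) (i : ℕ) : ℝ :=
  max 0 ((q i).1 / (q i).2 - V (D i) (φ i))

variable {s : ℕ → ℕ × List Bool} {φ : ℕ → Sentence L} {q : ℕ → ℕ × ℕ} {D : ℕ → ℕ}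

theorem eval_sumExpr (i l : ℕ) (V : ℕ → Sentence L → ℝ) (env : List ℝ) :
    (sumExpr L s i l).eval V env =
      (((List.range i).filter fun m => precedes s m l).map fun m => env.getD m 0).sum := by
  rw [sumExpr]
  induction ((List.range i).filter fun m => precedes s m l) with
  | nil => simp [FeatExpr.eval]
  | cons m t ih => simp only [List.foldr_cons, FeatExpr.eval, ih, List.map_cons, List.sum_cons]

theorem eval_loadExpr (i : ℕ) (V : ℕ → Sentence L → ℝ) (env : List ℝ) :
    (loadExpr L s i).eval V env = load s env i := by
  rw [loadExpr, load]
  induction ((List.range (i + 1)).filter (precedes s i)) with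
  | nil => simp [FeatExpr.eval]
  | cons m t ih =>
    simp only [List.foldr_cons, FeatExpr.eval, ih, List.map_cons, eval_sumExpr]

theorem eval_stakeExpr (i : ℕ) (V : ℕ → Sentence L → ℝ) (env : List ℝ) :
    (stakeExpr s φ q i (D i)).eval V env = priceGap φ q D V i * (1 - load s env i) := by
  simp only [stakeExpr, FeatExpr.eval, eval_loadExpr, priceGap]
  push_cast
  ring_nf

theorem env_stakeStrategy (i : ℕ) (V : ℕ → Sentence L → ℝ) :
    (stakeStrategy s φ q D i).env V = stakes s (priceGap φ q D V) i := by
  induction i with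
  | zero => rfl
  | succ i ih =>
    have : (stakeStrategy s φ q D (i + 1)).env V = (stakeStrategy s φ q D i).env V ++
        [(stakeExpr s φ q i (D i)).eval V ((stakeStrategy s φ q D i).env V)] := by
      simp [stakeStrategy, Strategy.env, List.range_succ]
    rw [this, ih, eval_stakeExpr]
    rfl

theorem value_stakeStrategy (i : ℕ) (V : ℕ → Sentence L → ℝ) (W : World L) :
    (stakeStrategy s φ q D i).value (D i) V W = 2 ^ (s i).1 * stake s (priceGap φ q D V) i *
      ((if W (φ i) then 1 else 0) - V (D i) (φ i)) := by
  rw [Strategy.value, env_stakeStrategy]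
  simp [stakeStrategy, FeatExpr.eval, eval_stakeExpr, stake]

theorem wellFormed_stakeExpr (hq : ∀ i, 0 < (q i).2) {i day n k : ℕ} (hn : day ≤ n) (hk : i ≤ k) :
    (stakeExpr s φ q i day).WellFormed n k := by
  have hs : ∀ l, (sumExpr L s i l).WellFormed n k := by
    intro l
    have h : ∀ m ∈ (List.range i).filter fun m => precedes s m l, m < k := fun m hm =>
      (List.mem_range.1 (List.mem_filter.1 hm).1).trans_le hk
    rw [sumExpr]
    generalize ((List.range i).filter fun m => precedes s m l) = t at h
    induction t with
    | nil => exact Nat.one_pos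
    | cons m t ih =>
      exact ⟨h m List.mem_cons_self, ih fun m hm => h m (List.mem_cons_of_mem _ hm)⟩
  have hl : (loadExpr L s i).WellFormed n k := by
    rw [loadExpr]
    induction ((List.range (i + 1)).filter (precedes s i)) with
    | nil => exact Nat.one_pos
    | cons m t ih => exact ⟨hs m, ih⟩
  exact ⟨⟨Nat.one_pos, hq i, Nat.one_pos, hn⟩, Nat.one_pos, Nat.one_pos, hl⟩

theorem isForDay_stakeStrategy (hq : ∀ i, 0 < (q i).2) (hD : StrictMono D) (i : ℕ) :
    (stakeStrategy s φ q D i).IsForDay (D i) := by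
  constructor
  · intro l hl
    have : l < i := by simpa [stakeStrategy] using hl
    simp only [stakeStrategy, List.getElem_map, List.getElem_range]
    exact wellFormed_stakeExpr hq (hD this).le le_rfl
  · simp only [stakeStrategy, List.mem_singleton, forall_eq]
    exact ⟨Nat.one_pos, wellFormed_stakeExpr hq le_rfl (by simp)⟩

end Expressions

/-! ### Computing the strategies of this trader -/

section Codes

variable {L : Set (List Bool)}

theorem encodeInt_natCast (n : ℕ) : encodeInt n = false :: encodeNat n := by
  simp [encodeInt]

/-- The code of `a / d`. -/
def ratCode (a d : ℕ) : List Bool := [false, false, true] ++ (false :: encodeNat a) ++ encodeNat d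

theorem encode_rat (a d : ℕ) : (FeatExpr.rat a d : FeatExpr L).encode = ratCode a d := by
  rw [FeatExpr.encode, encodeInt_natCast, ratCode]

/-- The code of `sumExpr`. -/
def sumCode (s : ℕ → ℕ × List Bool) (i l : ℕ) : List Bool :=
  (List.range i).flatMap (fun m => cond (precedes s m l)
    ([false, true, true] ++ ([false, true, false] ++ encodeUnary m)) []) ++ ratCode 0 1

theorem encode_sumExpr (s : ℕ → ℕ × List Bool) (i l : ℕ) :
    (sumExpr L s i l).encode = sumCode s i l := by
  rw [sumExpr, sumCode]
  induction List.range i with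
  | nil => exact encode_rat 0 1
  | cons m t ih =>
    cases h : precedes s m l <;> simp [h, FeatExpr.encode, ih]

/-- The code of `loadExpr`. -/
def loadCode (s : ℕ → ℕ × List Bool) (i : ℕ) : List Bool :=
  (List.range (i + 1)).flatMap (fun l => cond (precedes s i l)
    ([true, false, true] ++ sumCode s i l) []) ++ ratCode 0 1

theorem encode_loadExpr (s : ℕ → ℕ × List Bool) (i : ℕ) :
    (loadExpr L s i).encode = loadCode s i := by
  rw [loadExpr, loadCode]
  induction List.range (i + 1) with
  | nil => exact encode_rat 0 1
  | cons m t ih =>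
    cases h : precedes s i m <;> simp [h, FeatExpr.encode, ih, encode_sumExpr]

/-- The code of `-1`. -/
def negOneCode : List Bool := [false, false, true] ++ encodeInt (-1) ++ encodeNat 1

/-- The part of the code of `stakeExpr` in front of the day, where `c i` is the
code of the sentence. -/
def stakeCodeLeft (q : ℕ → ℕ × ℕ) (c : ℕ → List Bool) (i : ℕ) : List Bool :=
  [true, false, false, true, false, true] ++ ratCode 0 1 ++ [false, true, true] ++
    ratCode (q i).1 (q i).2 ++ [true, false, false] ++ negOneCode ++ [false, false, false] ++ c i

/-- The part of the code of `stakeExpr` behind the day. -/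
def stakeCodeRight (s : ℕ → ℕ × List Bool) (i : ℕ) : List Bool :=
  [false, true, true] ++ ratCode 1 1 ++ [true, false, false] ++ negOneCode ++ loadCode s i

theorem encode_stakeExpr (s : ℕ → ℕ × List Bool) (φ : ℕ → Sentence L) (q : ℕ → ℕ × ℕ)
    (i day : ℕ) : (stakeExpr s φ q i day).encode =
      stakeCodeLeft q (fun i => (φ i).encode) i ++ encodeUnary day ++ stakeCodeRight s i := by
  have h₀ := encode_rat (L := L) 0 1
  have h₁ := encode_rat (L := L) 1 1
  push_cast at h₀ h₁
  simp only [stakeExpr, FeatExpr.encode.eq_5, FeatExpr.encode.eq_6, FeatExpr.encode.eq_4,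
    FeatExpr.encode.eq_1, h₀, h₁, encode_rat, encode_loadExpr, stakeCodeLeft, stakeCodeRight]
  simp [negOneCode, FeatExpr.encode]

/-- The template of `stakeStrategy` for a day that follows the given earlier trading days. The hole
is the current day. -/
def stakeTemplate (s : ℕ → ℕ × List Bool) (q : ℕ → ℕ × ℕ) (c : ℕ → List Bool) (days : List ℕ) :
    List (Option Bool) :=
  ((List.range days.length).flatMap (fun l =>
    true :: (stakeCodeLeft q c l ++ encodeUnary (days.getD l 0) ++ stakeCodeRight s l)) ++
      false :: true :: (c days.length ++ ([true, false, false] ++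
        ratCode (2 ^ (s days.length).1) 1 ++ stakeCodeLeft q c days.length))).map some ++
    none :: (stakeCodeRight s days.length ++ [false]).map some

theorem fill_stakeTemplate (s : ℕ → ℕ × List Bool) (φ : ℕ → Sentence L) (q : ℕ → ℕ × ℕ)
    (D : ℕ → ℕ) (i : ℕ) :
    fill (D i) (stakeTemplate s q (fun i => (φ i).encode) ((List.range i).map D)) =
      (stakeStrategy s φ q D i).encode := by
  have h : (List.range i).flatMap (fun l => true :: (stakeCodeLeft q (fun i => (φ i).encode) l ++
      encodeUnary (((List.range i).map D).getD l 0) ++ stakeCodeRight s l)) =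
      (List.range i).flatMap fun l => true :: (stakeExpr s φ q l (D l)).encode := by
    rw [List.flatMap_def, List.flatMap_def]
    congr 1
    refine List.map_congr_left fun l hl => ?_
    rw [encode_stakeExpr]
    simp [List.getD_eq_getElem?_getD, List.mem_range.1 hl]
  rw [stakeTemplate, List.length_map, List.length_range, h, fill_append, fill_map_some, fill_cons,
    fill_map_some, Strategy.encode, encodeList, encodeList, stakeStrategy, List.flatMap_map]
  simp only [List.flatMap_cons, List.flatMap_nil, FeatExpr.encode.eq_5, encode_rat,
    encode_stakeExpr, Option.elim_none]
  simp

end Codes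

section Computability

variable {α β : Type} [Primcodable α] [Primcodable β]

theorem Computable.flatMap_range {f : α → ℕ} {g : α → ℕ → List β} (hf : Computable f)
    (hg : Computable₂ g) : Computable fun a => (List.range (f a)).flatMap (g a) := by
  have h : Computable₂ fun (a : α) (p : ℕ × List β) => p.2 ++ g a p.1 :=
    Computable.list_append.comp (Computable.snd.comp .snd)
      (hg.comp .fst (Computable.fst.comp .snd))
  refine (Computable.nat_rec hf (.const []) h).of_eq fun a => ?_
  induction f a with
  | zero => rfl
  | succ n ih => simp [List.range_succ, ← ih]

theorem primrec_encodeStr : Primrec encodeStr :=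
  Primrec.list_append.comp (Primrec.list_flatMap .id
    ((Primrec.dom_finite fun d : Bool => [true, d]).comp .snd).to₂) (.const [false])

theorem primrec_encodeNat : Primrec encodeNat := primrec_encodeStr.comp primrec_bits

theorem primrec_encodeUnary : Primrec encodeUnary := by
  refine (Primrec.list_append.comp (Primrec.list_map .list_range
    (Primrec.const true).to₂) (.const [false])).of_eq fun n => ?_
  simp [encodeUnary, List.map_const']

theorem computable_ratCode : Computable₂ ratCode := by
  refine Primrec.to_comp (Primrec.list_append.comp (Primrec.list_append.comp
    (.const [false, false, true]) (Primrec.list_cons.comp (.const false)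
      (primrec_encodeNat.comp .fst))) (primrec_encodeNat.comp .snd))

variable {L : Set (List Bool)}

/-- The code of `startsWithFrom b k σ`. -/
def startsWithCode (b : ℕ → List Bool) (k : ℕ) (σ : List Bool) : List Bool :=
  cond (σ.length == 0) ([true, false, false] ++ ([false, false, false] ++ encodeStr (b k)) ++
      ([false, false, false] ++ encodeStr (b k)))
    ((List.range σ.length).flatMap fun i => cond (i + 1 == σ.length) [] [false, true, false] ++
      (cond (σ.getD i false) [] [false, false, true] ++
        ([false, false, false] ++ encodeStr (b (k + i)))))

theorem encode_startsWithFrom (b : ℕ → L) (k : ℕ) (σ : List Bool) :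
    (startsWithFrom b k σ).encode = startsWithCode (fun i => b i) k σ := by
  have hlit : ∀ a d, (literal a d : Sentence L).encode =
      cond d [] [false, false, true] ++ ([false, false, false] ++ encodeStr a) := by
    intro a d
    cases d <;> rfl
  induction σ generalizing k with
  | nil => rfl
  | cons d σ ih =>
    cases σ with
    | nil =>
      rw [startsWithFrom, hlit]
      simp [startsWithCode]
    | cons e σ =>
      rw [startsWithFrom, Sentence.encode, hlit, ih]
      simp only [startsWithCode, List.length_cons, List.range_succ_eq_map (n := σ.length + 1),
        List.flatMap_cons, List.flatMap_map]
      simp [Nat.add_assoc, Nat.add_comm 1]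

theorem computable_encode_startsWith {b : ℕ → L} (hb : Computable fun i => (b i : List Bool)) :
    Computable fun σ => (startsWith b σ).encode := by
  have hc : Computable fun i => [false, false, false] ++ encodeStr (b i) :=
    Computable.list_append.comp (.const _) (primrec_encodeStr.to_comp.comp hb)
  have hlen : Computable fun p : List Bool × ℕ => p.1.length := Computable.list_length.comp .fst
  have hbeq : Computable₂ fun a b : ℕ => a == b := Primrec.beq.to_comp
  have hget : Computable₂ fun (σ : List Bool) i => σ.getD i false :=
    (Primrec.list_getD false).to_comp
  have hd : Computable₂ fun (σ : List Bool) i => cond (i + 1 == σ.length) [] [false, true, false] ++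
      (cond (σ.getD i false) [] [false, false, true] ++
        ([false, false, false] ++ encodeStr (b (0 + i)))) := by
    refine Computable.list_append.comp (Computable.cond (hbeq.comp (Computable.succ.comp .snd) hlen)
      (.const _) (.const _)) (Computable.list_append.comp (Computable.cond hget
      (.const _) (.const _)) ?_)
    refine (hc.comp .snd).of_eq fun p => ?_
    rw [Nat.zero_add]
  refine (Computable.cond (hbeq.comp Computable.list_length (.const 0))
    (.const ([true, false, false] ++ ([false, false, false] ++ encodeStr (b 0)) ++
      ([false, false, false] ++ encodeStr (b 0))))
    (Computable.flatMap_range Computable.list_length hd)).of_eq fun σ => ?_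
  rw [startsWith, encode_startsWithFrom, startsWithCode]

variable {s : ℕ → ℕ × List Bool} {q : ℕ → ℕ × ℕ} {c : ℕ → List Bool}

theorem computable_precedes (hs : Computable s) : Computable₂ (precedes s) := by
  have h₁ : Computable fun i => (s i).1 := Computable.fst.comp hs
  have h₂ : Computable fun i => (s i).2 := Computable.snd.comp hs
  have hbeq : Computable₂ fun a b : ℕ => a == b := Primrec.beq.to_comp
  have hbeq' : Computable₂ fun a b : List Bool => a == b :=
    (Primrec.eq (α := List Bool)).decide.to_comp.of_eq fun p => by simp [beq_eq_decide]
  have htake : Computable₂ fun n (l : List Bool) => l.take n := Primrec.list_take.to_comp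
  have hand : Computable₂ and := Primrec.and.to_comp
  exact hand.comp (hbeq.comp (h₁.comp .fst) (h₁.comp .snd))
    (hbeq'.comp (htake.comp (Computable.list_length.comp (h₂.comp .fst)) (h₂.comp .snd))
      (h₂.comp .fst))

theorem computable_sumCode (hs : Computable s) : Computable₂ (sumCode s) := by
  refine Computable.list_append.comp (Computable.flatMap_range .fst ?_) (.const (ratCode 0 1))
  exact Computable.cond ((computable_precedes hs).comp .snd (Computable.snd.comp .fst))
    (Computable.list_append.comp (.const [false, true, true]) (Computable.list_append.comp
      (.const [false, true, false]) (primrec_encodeUnary.to_comp.comp .snd))) (.const [])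

theorem computable_loadCode (hs : Computable s) : Computable (loadCode s) := by
  refine Computable.list_append.comp (Computable.flatMap_range .succ ?_) (.const (ratCode 0 1))
  exact Computable.cond ((computable_precedes hs).comp .fst .snd)
    (Computable.list_append.comp (.const [true, false, true])
      ((computable_sumCode hs).comp .fst .snd)) (.const [])

theorem computable_stakeCodeLeft (hq : Computable q) (hc : Computable c) :
    Computable (stakeCodeLeft q c) := by
  refine Computable.list_append.comp (Computable.list_append.comp (Computable.list_append.comp
    (Computable.list_append.comp (Computable.list_append.comp (.const _) ?_) (.const _))
    (.const _)) (.const _)) hc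
  exact computable_ratCode.comp (Computable.fst.comp hq) (Computable.snd.comp hq)

theorem computable_stakeCodeRight (hs : Computable s) : Computable (stakeCodeRight s) :=
  Computable.list_append.comp (.const _) (computable_loadCode hs)

theorem primrec_two_pow : Primrec fun n : ℕ => 2 ^ n :=
  (primrec_revealDay.comp .id (.const 0)).of_eq fun n => by simp [revealDay]

theorem computable_stakeTemplate (hs : Computable s) (hq : Computable q) (hc : Computable c) :
    Computable (stakeTemplate s q c) := by
  have hl := computable_stakeCodeLeft hq hc
  have hr := computable_stakeCodeRight hs
  have hlen : Computable (List.length : List ℕ → ℕ) := Computable.list_length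
  have hsome : Computable fun w : List Bool => w.map some :=
    (Primrec.list_map .id (Primrec.option_some.comp .snd).to₂).to_comp
  have hget : Computable₂ fun (l : List ℕ) i => l.getD i 0 := (Primrec.list_getD 0).to_comp
  refine Computable.list_append.comp (hsome.comp (Computable.list_append.comp
    (Computable.flatMap_range hlen ?_) (Computable.list_cons.comp (.const false)
      (Computable.list_cons.comp (.const true) (Computable.list_append.comp (hc.comp hlen)
        (Computable.list_append.comp (Computable.list_append.comp (.const _) ?_)
          (hl.comp hlen)))))))
    (Computable.list_cons.comp (.const none) (hsome.comp (Computable.list_append.comp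
      (hr.comp hlen) (.const [false]))))
  · exact Computable.list_cons.comp (.const true) (Computable.list_append.comp
      (Computable.list_append.comp (hl.comp .snd) (primrec_encodeUnary.to_comp.comp
        (hget.comp .fst .snd))) (hr.comp .snd))
  · exact computable_ratCode.comp (primrec_two_pow.to_comp.comp
      (Computable.fst.comp (hs.comp hlen))) (.const 1)

end Computability

/-! ### Domination of the universal semimeasure -/

theorem sum_range_succ_of_strictMono {D : ℕ → ℕ} (hD : StrictMono D) {g : ℕ → ℝ}
    (hg : ∀ j, (∀ i, j ≠ D i) → g j = 0) {n I : ℕ} (hI : ∀ i, D i ≤ n ↔ i < I) :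
    ∑ j ∈ Finset.range (n + 1), g j = ∑ i ∈ Finset.range I, g (D i) := by
  rw [← Finset.sum_image (s := Finset.range I) (g := D) hD.injective.injOn]
  refine (Finset.sum_subset (fun j hj => ?_) fun j hj hj' => hg j fun i hi => hj' ?_).symm
  · obtain ⟨i, hi, rfl⟩ := Finset.mem_image.1 hj
    have := (hI i).2 (Finset.mem_range.1 hi)
    exact Finset.mem_range.2 (by omega)
  · subst hi
    exact Finset.mem_image_of_mem D (Finset.mem_range.2 ((hI i).1 (by
      have := Finset.mem_range.1 hj
      omega)))

theorem LowerSemicomputable.exists_pos_den {M : List Bool → ℝ} (hM : LowerSemicomputable M) :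
    ∃ f : List Bool × ℕ → ℕ × ℕ, Computable f ∧ (∀ p, 0 < (f p).2) ∧
      (∀ σ n, ((f (σ, n)).1 / (f (σ, n)).2 : ℝ) ≤ M σ) ∧
      ∀ σ, Tendsto (fun n => ((f (σ, n)).1 / (f (σ, n)).2 : ℝ)) atTop (nhds (M σ)) := by
  obtain ⟨f, hf, q, hq, hmono, hlim⟩ := hM
  have key : ∀ σ n, (((if (f (σ, n)).2 = 0 then (0, 1) else f (σ, n)).1 : ℕ) /
      ((if (f (σ, n)).2 = 0 then (0, 1) else f (σ, n)).2 : ℕ) : ℝ) = q σ n := by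
    intro σ n
    rw [hq]
    split_ifs with h
    · simp [h]
    · push_cast
      rfl
  refine ⟨fun p => if (f p).2 = 0 then (0, 1) else f p, ?_, fun p => ?_, fun σ n => ?_, fun σ => ?_⟩
  · have hbeq : Computable₂ fun a b : ℕ => a == b := Primrec.beq.to_comp
    refine (Computable.cond (hbeq.comp (Computable.snd.comp hf) (.const 0)) (.const (0, 1))
      hf).of_eq fun p => ?_
    simp only [Bool.cond_eq_ite, beq_iff_eq]
  · dsimp only
    split_ifs with h
    · exact Nat.one_pos
    · exact Nat.pos_of_ne_zero h
  · dsimp only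
    rw [key]
    have : Monotone fun n => (q σ n : ℝ) := fun m n h => Rat.cast_le.2 (hmono σ h)
    exact this.ge_of_tendsto (hlim σ) n
  · dsimp only
    simp only [key]
    exact hlim σ

/-- An enumeration of the pairs of a level and a string in which each pair occurs infinitely
often. -/
def target (i : ℕ) : ℕ × List Bool :=
  (i.unpair.1.unpair.1, (Encodable.decode (α := List Bool) i.unpair.1.unpair.2).getD [])

theorem target_pair (κ : ℕ) (τ : List Bool) (a : ℕ) :
    target (Nat.pair (Nat.pair κ (Encodable.encode τ)) a) = (κ, τ) := by
  simp [target]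

theorem computable_target : Computable target := by
  have h : Primrec fun i : ℕ => i.unpair.1.unpair :=
    Primrec.unpair.comp (Primrec.fst.comp .unpair)
  exact (Primrec.pair (Primrec.fst.comp h) (Primrec.option_getD.comp
    (Primrec.decode.comp (Primrec.snd.comp h)) (.const []))).to_comp

/-- A logical inductor's limiting prices dominate a lower semicomputable semimeasure: otherwise, on
each level `κ`, some string would cost less than `4 ^ (-κ)` times its weight, and a trader could
bet on the prefixes of a string, on each level with a budget of `2 ^ (-κ)` and with a possible gain
of `2 ^ κ / 2`. -/
theorem exists_mul_semimeasure_le {L : Set (List Bool)} {P : ℕ → Sentence L → ℚ} (hP : IsMarket P)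
    {D : ℕ → Finset (Sentence L)} (hLIC : SatisfiesLIC P D) {b : ℕ → L}
    (hb : Computable (fun i => (b i : List Bool)))
    (hD : ∀ ρ, ∃ W : World L, (∀ n, W ∈ pcWorlds (D n : Set (Sentence L))) ∧
      ∀ σ, σ <+: ρ → W (startsWith b σ) = true)
    {M : List Bool → ℝ} (hM : IsSemimeasure M) (hM' : LowerSemicomputable M)
    {Pinf : Sentence L → ℝ}
    (hlim : ∀ φ, Tendsto (fun n => (P n φ : ℝ)) atTop (nhds (Pinf φ))) :
    ∃ C : ℝ, 0 < C ∧ ∀ σ : List Bool, C * M σ ≤ Pinf (startsWith b σ) := by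
  by_contra! hcon
  obtain ⟨f, hf, hf₀, hf₁, hf₂⟩ := hM'.exists_pos_den
  set φ : ℕ → Sentence L := fun i => startsWith b (target i).2 with hφ
  set q : ℕ → ℕ × ℕ := fun i =>
    ((f ((target i).2, i)).1, (f ((target i).2, i)).2 * 2 ^ (2 * (target i).1)) with hq
  have hq₀ : ∀ i, 0 < (q i).2 := fun i => Nat.mul_pos (hf₀ _) (by positivity)
  have hqc : Computable q := by
    have h₁ : Computable fun i => f ((target i).2, i) :=
      hf.comp ((Computable.snd.comp computable_target).pair .id)
    have h₂ : Computable fun i => 2 ^ (2 * (target i).1) :=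
      (primrec_two_pow.comp (Primrec.nat_mul.comp (.const 2) .id)).to_comp.comp
        (Computable.fst.comp computable_target)
    exact (Computable.fst.comp h₁).pair
      (Primrec.nat_mul.to_comp.comp (Computable.snd.comp h₁) h₂)
  have hc : Computable fun i => (φ i).encode :=
    (computable_encode_startsWith hb).comp (Computable.snd.comp computable_target)
  obtain ⟨day, hday, hEC⟩ := exists_efficientlyComputable_delay
    (computable_stakeTemplate computable_target hqc hc)
  set V : ℕ → Sentence L → ℝ := fun n φ => (P n φ : ℝ) with hV
  set st : ℕ → ℝ := stake target (priceGap φ q day V) with hst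
  -- The threshold for the price of the target of index `i`.
  have hθ : ∀ i, ((q i).1 / (q i).2 : ℝ) =
      (f ((target i).2, i)).1 / (f ((target i).2, i)).2 / 4 ^ (target i).1 := fun i => by
    simp only [hq]
    push_cast
    rw [pow_mul, div_div]
    norm_num
  have hθM : ∀ i, ((q i).1 / (q i).2 : ℝ) ≤ M (target i).2 / 4 ^ (target i).1 := fun i => by
    rw [hθ]
    exact div_le_div_of_nonneg_right (hf₁ _ _) (by positivity)
  have hp₀ : ∀ n φ, 0 ≤ V n φ := fun n φ => Rat.cast_nonneg.2 (hP.nonneg n φ)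
  have hgap₀ : ∀ i, 0 ≤ priceGap φ q day V i := fun i => le_max_left _ _
  have hgap₁ : ∀ i, priceGap φ q day V i ≤ 1 := fun i => by
    have : M (target i).2 / 4 ^ (target i).1 ≤ 1 :=
      div_le_one_of_le₀ ((hM.le_one _).trans (one_le_pow₀ (by norm_num))) (by positivity)
    exact max_le zero_le_one (by linarith [hθM i, hp₀ (day i) (φ i)])
  have hst₀ : ∀ i, 0 ≤ st i := stake_nonneg hgap₀ hgap₁
  have hcost : ∀ I, ∑ m ∈ Finset.range I, 2 ^ (target m).1 * st m * V (day m) (φ m) ≤ 2 :=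
    sum_cost_le hM hθM (fun i => hp₀ _ _) rfl
  classical
  let T : ℕ → Strategy L := fun n => if h : ∃ i, day i = n then
    stakeStrategy target φ q day h.choose else ⟨[], []⟩
  have hT : ∀ i, T (day i) = stakeStrategy target φ q day i := fun i => by
    have h : ∃ j, day j = day i := ⟨i, rfl⟩
    simp only [T, dif_pos h]
    rw [hday.injective h.choose_spec]
  have hT' : ∀ n, (∀ i, n ≠ day i) → T n = ⟨[], []⟩ := fun n hn =>
    dif_neg fun ⟨i, hi⟩ => hn i hi.symm
  -- The net worth after the first `I` trades.
  have hworth : ∀ (n I : ℕ) (W : World L), (∀ i, day i ≤ n ↔ i < I) →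
      ∑ m ∈ Finset.range I, 2 ^ (target m).1 * st m * (if W (φ m) then 1 else 0) - 2 ≤
        ∑ j ∈ Finset.range (n + 1), (T j).value j V W := by
    intro n I W hI
    rw [sum_range_succ_of_strictMono hday (g := fun j => (T j).value j V W)
      (fun j hj => by simp [hT' j hj, Strategy.value]) hI]
    have : ∀ m, (T (day m)).value (day m) V W =
        2 ^ (target m).1 * st m * (if W (φ m) then 1 else 0) -
          2 ^ (target m).1 * st m * V (day m) (φ m) := fun m => by
      rw [hT, value_stakeStrategy, mul_sub]
    simp only [this, Finset.sum_sub_distrib]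
    linarith [hcost I]
  have hnonneg : ∀ m (W : World L),
      0 ≤ 2 ^ (target m).1 * st m * (if W (φ m) then 1 else 0 : ℝ) := fun m W => by
    have := hst₀ m
    split_ifs <;> positivity
  refine hLIC ⟨T, fun n => ?_, ?_, ⟨-2, ?_⟩, ?_⟩
  · by_cases h : ∃ i, day i = n
    · obtain ⟨i, rfl⟩ := h
      rw [hT]
      exact isForDay_stakeStrategy hq₀ hday i
    · rw [hT' n fun i hi => h ⟨i, hi.symm⟩]
      exact ⟨fun i hi => absurd hi (Nat.not_lt_zero i), fun t ht => absurd ht List.not_mem_nil⟩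
  · refine hEC _ (fun i => ?_) fun n hn => ?_
    · rw [hT, fill_stakeTemplate]
    · rw [hT' n hn]
      rfl
  · rintro _ ⟨n, W, -, rfl⟩
    have hex : ∃ i, n < day i := ⟨n + 1, Nat.lt_of_lt_of_le (Nat.lt_succ_self n) hday.le_apply⟩
    refine le_trans ?_ (hworth n (Nat.find hex) W fun i => ?_)
    · linarith [Finset.sum_nonneg fun m (_ : m ∈ Finset.range (Nat.find hex)) => hnonneg m W]
    · refine ⟨fun h => ?_, fun h => not_lt.1 (Nat.find_min hex h)⟩
      by_contra h'
      exact absurd ((Nat.find_spec hex).trans_le (hday.monotone (not_lt.1 h'))) (not_lt.2 h)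
  · rintro ⟨K, hK⟩
    obtain ⟨κ, hκ⟩ := pow_unbounded_of_one_lt (2 * (K + 2)) (one_lt_two (α := ℝ))
    obtain ⟨τ, hτ⟩ := hcon (1 / 4 ^ κ) (by positivity)
    set ε : ℝ := (M τ / 4 ^ κ - Pinf (startsWith b τ)) / 2 with hε
    have hε₀ : 0 < ε := by
      rw [one_div_mul_eq_div] at hτ
      linarith
    have hev : ∀ᶠ i in atTop,
        ε < (f (τ, i)).1 / (f (τ, i)).2 / (4 : ℝ) ^ κ - V (day i) (startsWith b τ) :=
      (((hf₂ τ).div_const (4 ^ κ)).sub ((hlim (startsWith b τ)).comp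
        hday.tendsto_atTop)).eventually_const_lt (by linarith)
    have hfreq : ∃ᶠ i in atTop, target i = (κ, τ) ∧ ε ≤ priceGap φ q day V i := by
      refine ((frequently_atTop.2 fun a => ⟨_, Nat.right_le_pair _ a,
        target_pair κ τ a⟩).and_eventually hev).mono fun i hi => ⟨hi.1, le_max_of_le_right ?_⟩
      rw [hθ]
      simp only [hφ, hi.1]
      exact hi.2.le
    obtain ⟨I, ρ, hI⟩ := exists_half_le_totalStake hgap₀ hgap₁ hε₀ hfreq
    cases I with
    | zero => norm_num [totalStake] at hI
    | succ i =>
      obtain ⟨W, hW, hW'⟩ := hD ρ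
      have h₁ := hworth (day i) (i + 1) W fun j => by rw [hday.le_iff_le, Nat.lt_succ_iff]
      have h₂ := hK ⟨day i, W, hW _, rfl⟩
      have h₃ : 2 ^ κ * totalStake target (priceGap φ q day V) (i + 1) κ ρ ≤
          ∑ m ∈ Finset.range (i + 1),
            2 ^ (target m).1 * st m * (if W (φ m) then 1 else 0 : ℝ) := by
        rw [totalStake, Finset.mul_sum]
        refine le_trans (Finset.sum_le_sum fun m hm => ?_)
          (Finset.sum_le_sum_of_subset_of_nonneg (Finset.filter_subset _ _)
            fun m _ _ => hnonneg m W)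
        obtain ⟨-, h, hpre⟩ := Finset.mem_filter.1 hm
        rw [h, hW' _ hpre, if_pos rfl, mul_one]
      have h₄ := mul_le_mul_of_nonneg_left hI (pow_nonneg (zero_le_two (α := ℝ)) κ)
      linarith

end LogicalInduction

theorem mainTheorem8 (L : Set (List Bool)) (Γ : Set (Sentence L))
    (hΓ : IsCE Γ) (hcons : Consistent Γ)
    (P : ℕ → Sentence L → ℚ) (hP : IsLogicalInductor Γ P)
    (b : ℕ → L) (hb_inj : Function.Injective b)
    (hb_comp : Computable (fun i => (b i : List Bool)))
    (hb_fresh : ∀ i, ∀ φ ∈ Γ, ¬ φ.Mentions (b i))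
    (M : List Bool → ℝ) (hM : IsUniversalSemimeasure M) :
    ∃ Pinf : Sentence L → ℝ,
      (∀ φ, Filter.Tendsto (fun n => (P n φ : ℝ)) Filter.atTop (nhds (Pinf φ))) ∧
      ∃ C : ℝ, 0 < C ∧ ∀ σ : List Bool, C * M σ ≤ Pinf (startsWith b σ) := by
  obtain ⟨hP, D, -, hD, hLIC⟩ := hP
  have hworld := exists_world_startsWith hcons hb_inj hb_fresh hD
  have hlim : ∀ φ, ∃ x : ℝ, Filter.Tendsto (fun n => (P n φ : ℝ)) Filter.atTop (nhds x) := by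
    obtain ⟨W, hW, -⟩ := hworld []
    exact exists_tendsto_price hP ⟨W, hW⟩ hLIC
  choose Pinf hPinf using hlim
  exact ⟨Pinf, hPinf, exists_mul_semimeasure_le hP hLIC hb_comp hworld hM.1 hM.2.1 hPinf⟩
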